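/- Let $R$ be a commutative artinian ring and $\Lambda$ an artin $R$-algebra (an $R$-algebra that is finitely generated as an $R$-module). Modules are finitely generated left modules; $\mathrm{mod}(\Lambda)$ is their category. For a family $\mathcal C$ of modules, $\mathcal F(\mathcal C)$ is the class of modules $M$ having a finite filtration $0=M_0\subseteq M_1\subseteq\cdots\subseteq M_s=M$ with each factor $M_{k+1}/M_k$ isomorphic to a member of $\mathcal C$; ${}^{\perp_1}\mathcal X$ is the class of modules $M$ with $\mathrm{Ext}^1(M,X)=0$ for all $X\in\mathcal X$; $\mathrm{add}(M)$ is the class of direct summands of finite direct sums of copies of $M$. A class is \emph{resolving} if it is closed under extensions and under kernels of epimorphisms and contains all projective modules. Given a representative set $P=\{P(i)\}$ of the indecomposable projective modules of an artin algebra $A$ (one from each isomorphism class) and a linear order $\preceq$ on the index set, put $\Delta(i)=P(i)/\mathrm{Tr}_{\bigoplus_{j\succ i}P(j)}(P(i))$ and $\overline\Delta(i)=P(i)/\mathrm{Tr}_{\bigoplus_{j\succeq i}P(j)}(\mathrm{rad}\,P(i))$, where $\mathrm{Tr}_M(N)$ is the submodule of $N$ generated by the images of all morphisms $M\to N$. The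 pair $(A,\preceq)$ is \emph{standardly stratified} if every projective $A$-module is in $\mathcal F(\Delta)$. For $A^{op}$ one uses the representative set $P(i)^*=\mathrm{Hom}_A(P(i),A)$. Let $(\Psi,\mathbf Q,\leq)$ be a proper costratifying system of size $t$ in $\mathrm{mod}(\Lambda)$, that is: $\Psi=\{\Psi(i)\}_{i=1}^t$ and $\mathbf Q=\{Q(i)\}_{i=1}^t$ are families of $\Lambda$-modules with every $Q(i)$ indecomposable, and $\leq$ is a linear order on $\{1,\dots,t\}$, such that (i) $\mathrm{End}_\Lambda(\Psi(i))$ is a division ring for all $i$; (ii) $\mathrm{Hom}_\Lambda(\Psi(i),\Psi(j))=0$ if $i<j$; (iii) for each $i$ there is an exact sequence $0\to Z(i)\to Q(i)\to\Psi(i)\to 0$ with $Z(i)\in\mathcal F(\{\Psi(j):j\leq i\})$; (iv) $\mathrm{Ext}^1_\Lambda(Q(i),\Psi(j))=0$ for all $i,j$. Let $Q=\bigoplus_{i=1}^tQ(i)$, $\Gamma=\mathrm{End}_\Lambda(Q)^{op}$, $F=\mathrm{Hom}_\Lambda(Q,-):\mathrm{mod}(\Lambda)\to\mathrm{mod}(\Gamma)$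 and $G=Q\otimes_\Gamma-:\mathrm{mod}(\Gamma)\to\mathrm{mod}(\Lambda)$. Put ${}_\Gamma P(i)=F(Q(i))$, and let ${}_\Gamma\overline\Delta=\{{}_\Gamma\overline\Delta(i)\}_{i=1}^t$ be formed from ${}_\Gamma P$ and the opposite order $\leq^{op}$. Then: (a) $\{F(Q(i)):1\le i\le t\}$ is a representative set of the indecomposable projective $\Gamma$-modules (with $F(Q(i))\not\simeq F(Q(j))$ for $i\neq j$); $\Gamma$ is basic, i.e. ${}_\Gamma\Gamma$ is a finite direct sum of pairwise non-isomorphic indecomposable modules; and the Grothendieck group $K_0(\Gamma)$ of $\mathrm{mod}(\Gamma)$ has rank $t$. (b) $F$ restricts to an exact equivalence of categories $\mathcal F(\Psi)\to\mathcal F({}_\Gamma\overline\Delta)$ (it carries short exact sequences with terms in $\mathcal F(\Psi)$ to short exact sequences), and $G$ restricts to a functor $\mathcal F({}_\Gamma\overline\Delta)\to\mathcal F(\Psi)$ that is a quasi-inverse of it. (c) $F(\Psi(i))\simeq{}_\Gamma\overline\Delta(i)$ for all $i$. (d) $(\Gamma^{op},\leq^{op})$ is a standardly stratified algebra. (e)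 $\mathrm{add}(Q)=\mathcal F(\Psi)\cap{}^{\perp_1}\mathcal F(\Psi)$. (f) $\mathcal F({}_\Gamma\overline\Delta)$ is resolving and closed under direct summands in $\mathrm{mod}(\Gamma)$. -/

import Mathlib

open CategoryTheory

open scoped TensorProduct

universe u w

noncomputable section

namespace Costrat

section Ring

variable {A : Type u} [Ring A]

/-- Modules with a finite filtration `0 = N 0 ⊆ N 1 ⊆ ⋯ ⊆ N s = M` each of whose factors
`N (k+1) / N k` is isomorphic to a member of the family `C`. -/
def Filt {ι : Type w} (C : ι → ModuleCat.{u} A) : ObjectProperty (ModuleCat.{u} A) :=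
  fun M => ∃ (s : ℕ) (N : ℕ → Submodule A M), N 0 = ⊥ ∧ N s = ⊤ ∧
    ∀ k < s, N k ≤ N (k + 1) ∧
      ∃ i, Nonempty ((N (k + 1) ⧸ (N k).submoduleOf (N (k + 1))) ≃ₗ[A] C i)

/-- The trace of `M` in `N`. -/
def trace (A : Type u) [Ring A] (M N : Type u) [AddCommGroup M] [Module A M]
    [AddCommGroup N] [Module A N] : Submodule A N :=
  ⨆ f : M →ₗ[A] N, LinearMap.range f

/-- `add M`: direct summands of finite direct sums of copies of `M`. -/
def addClosure (M : ModuleCat.{u} A) : ObjectProperty (ModuleCat.{u} A) :=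
  fun X => ∃ (n : ℕ) (s : X →ₗ[A] (Fin n → M)) (r : (Fin n → M) →ₗ[A] X),
    r ∘ₗ s = LinearMap.id

/-- The finitely generated modules `M` with `Ext¹(M, X) = 0` for all `X` in the class. -/
def leftPerpOne (X : ObjectProperty (ModuleCat.{u} A)) : ObjectProperty (ModuleCat.{u} A) :=
  fun M => Module.Finite A M ∧ ∀ Y, X Y → Subsingleton (Abelian.Ext M Y 1)

/-- Resolving classes of finitely generated modules. -/
structure IsResolving (X : ObjectProperty (ModuleCat.{u} A)) : Prop where
  finite : ∀ M, X M → Module.Finite A M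
  extensions : ∀ S : ShortComplex (ModuleCat.{u} A), S.ShortExact → X S.X₁ → X S.X₃ → X S.X₂
  kernels : ∀ S : ShortComplex (ModuleCat.{u} A), S.ShortExact → X S.X₂ → X S.X₃ → X S.X₁
  projectives : ∀ M : ModuleCat.{u} A, Module.Finite A M → Module.Projective A M → X M

/-- `P` contains exactly one module of each isomorphism class of finitely generated
indecomposable projective `A`-modules. -/
structure IsRepresentativeSet {ι : Type w} (P : ι → ModuleCat.{u} A) : Prop where
  finite : ∀ i, Module.Finite A (P i)
  projective : ∀ i, Module.Projective A (P i)
  indecomposable : ∀ i, Indecomposable (P i)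
  not_iso : ∀ i j, i ≠ j → IsEmpty (P i ≃ₗ[A] P j)
  exists_iso : ∀ M : ModuleCat.{u} A, Module.Finite A M → Module.Projective A M →
    Indecomposable M → ∃ i, Nonempty (M ≃ₗ[A] P i)

/-- `A` is basic: the regular module is a finite direct sum of pairwise non-isomorphic
indecomposable modules. -/
def IsBasic (A : Type u) [Ring A] : Prop :=
  ∃ (n : ℕ) (P : Fin n → ModuleCat.{u} A), (∀ i, Indecomposable (P i)) ∧
    (∀ i j, i ≠ j → IsEmpty (P i ≃ₗ[A] P j)) ∧ Nonempty (A ≃ₗ[A] (∀ i, P i))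

/-- Finitely generated `A`-modules. -/
abbrev FG (A : Type u) [Ring A] : Type (u + 1) :=
  {M : ModuleCat.{u} A // Module.Finite A M}

/-- The relations `[Y] = [X] + [Z]`, one for each exact sequence `0 → X → Y → Z → 0`. -/
def K0Relations (A : Type u) [Ring A] : AddSubgroup (FreeAbelianGroup (FG A)) :=
  AddSubgroup.closure {x | ∃ (X Y Z : FG A) (f : X.1 →ₗ[A] Y.1) (g : Y.1 →ₗ[A] Z.1),
    Function.Injective f ∧ Function.Exact f g ∧ Function.Surjective g ∧
    x = FreeAbelianGroup.of Y - FreeAbelianGroup.of X - FreeAbelianGroup.of Z}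

/-- The Grothendieck group of the category of finitely generated `A`-modules. -/
abbrev K0 (A : Type u) [Ring A] : Type (u + 1) :=
  FreeAbelianGroup (FG A) ⧸ K0Relations A

section Standard

variable {ι : Type} [Fintype ι] [LinearOrder ι]

/-- The standard module `Δ(i) = P(i) / Tr_{⨁_{j>i} P(j)} P(i)`; the direct sum is finite and
is written as a product. -/
def standard (P : ι → ModuleCat.{u} A) (i : ι) : ModuleCat.{u} A :=
  ModuleCat.of A (P i ⧸ trace A (∀ j : {j // i < j}, P j) (P i))

/-- The proper standard module `Δ̄(i) = P(i) / Tr_{⨁_{j≥i} P(j)} (rad P(i))`. -/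
def properStandard (P : ι → ModuleCat.{u} A) (i : ι) : ModuleCat.{u} A :=
  ModuleCat.of A (P i ⧸
    (trace A (∀ j : {j // i ≤ j}, P j) (Module.jacobson A (P i))).map
      (Module.jacobson A (P i)).subtype)

/-- The algebra `A`, with the representative set `P` of its indecomposable projectives indexed
by the linearly ordered set `ι`, is standardly stratified. -/
structure IsStandardlyStratified (P : ι → ModuleCat.{u} A) : Prop where
  representative : IsRepresentativeSet P
  projectives : ∀ M : ModuleCat.{u} A, Module.Finite A M → Module.Projective A M →
    Filt (standard P) M

end Standard

/-- The `Aᵒᵖ`-module `P^* = Hom_A(P, A)`. -/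
def dual (P : ModuleCat.{u} A) : ModuleCat.{u} Aᵐᵒᵖ :=
  ModuleCat.of Aᵐᵒᵖ (P →ₗ[A] A)

/-- The `A`-module `⨁ i, Q i` for a finite index set. -/
def sum {ι : Type} [Fintype ι] (Q : ι → ModuleCat.{u} A) : ModuleCat.{u} A :=
  ModuleCat.of A (∀ i, Q i)

/-- The algebra `End_A(M)ᵒᵖ`. Multiplication in `End M` is composition of maps, `f * g = f ∘ g`. -/
abbrev EndOp (M : ModuleCat.{u} A) : Type u := (End M)ᵐᵒᵖ

/-- The functor `F = Hom_A(M, -)`; `γ ∈ End_A(M)ᵒᵖ` acts by `γ • f = f ∘ γ`. -/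
abbrev homFunctor (M : ModuleCat.{u} A) : ModuleCat.{u} A ⥤ ModuleCat.{u} (EndOp M) :=
  preadditiveCoyonedaObj M

/-- The elements `(m γ) ⊗ y - m ⊗ (γ y)`, where `m γ = γ(m)`. Their `A`-span coincides with
their additive span, since `a ((m γ) ⊗ y) = ((a m) γ) ⊗ y`. -/
def balancing (M : ModuleCat.{u} A) (Y : ModuleCat.{u} (EndOp M)) : Submodule A (M ⊗[ℤ] Y) :=
  Submodule.span A {x | ∃ (γ : EndOp M) (m : M) (y : Y),
    x = (γ.unop.hom m) ⊗ₜ[ℤ] y - m ⊗ₜ[ℤ] (γ • y)}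

/-- The map induced by `f` on `M ⊗_ℤ Y`, as an `A`-linear map. -/
def tensorMap (M : ModuleCat.{u} A) {Y Y' : ModuleCat.{u} (EndOp M)} (f : Y ⟶ Y') :
    (M ⊗[ℤ] Y) →ₗ[A] (M ⊗[ℤ] Y') :=
  TensorProduct.AlgebraTensorModule.map (LinearMap.id : M →ₗ[A] M)
    (f.hom.toAddMonoidHom.toIntLinearMap)

theorem tensorMap_tmul (M : ModuleCat.{u} A) {Y Y' : ModuleCat.{u} (EndOp M)} (f : Y ⟶ Y')
    (m : M) (y : Y) : tensorMap M f (m ⊗ₜ[ℤ] y) = m ⊗ₜ[ℤ] (f.hom y) := rfl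

theorem balancing_le (M : ModuleCat.{u} A) {Y Y' : ModuleCat.{u} (EndOp M)} (f : Y ⟶ Y') :
    balancing M Y ≤ (balancing M Y').comap (tensorMap M f) := by
  refine Submodule.span_le.2 ?_
  rintro _ ⟨γ, m, y, rfl⟩
  refine Submodule.subset_span ⟨γ, m, f.hom y, ?_⟩
  rw [map_sub, tensorMap_tmul, tensorMap_tmul, map_smul]

/-- The functor `G = M ⊗_Γ -` with `Γ = End_A(M)ᵒᵖ`. -/
def tensorFunctor (M : ModuleCat.{u} A) : ModuleCat.{u} (EndOp M) ⥤ ModuleCat.{u} A where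
  obj Y := ModuleCat.of A ((M ⊗[ℤ] Y) ⧸ balancing M Y)
  map {Y Y'} f := ModuleCat.ofHom
    (Submodule.mapQ (balancing M Y) (balancing M Y') (tensorMap M f) (balancing_le M f))
  map_id Y := by
    refine ModuleCat.hom_ext (LinearMap.ext fun x => ?_)
    obtain ⟨x, rfl⟩ := Submodule.Quotient.mk_surjective _ x
    induction x using TensorProduct.induction_on with
    | zero => simp
    | tmul m y => rfl
    | add x y hx hy => rw [Submodule.Quotient.mk_add, map_add, hx, hy, map_add]
  map_comp f g := by
    refine ModuleCat.hom_ext (LinearMap.ext fun x => ?_)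
    obtain ⟨x, rfl⟩ := Submodule.Quotient.mk_surjective _ x
    induction x using TensorProduct.induction_on with
    | zero => simp
    | tmul m y => rfl
    | add x y hx hy => rw [Submodule.Quotient.mk_add, map_add, hx, hy, map_add]

end Ring

/-- Proper costratifying systems `(Ψ, Q, ≤)` in the category of finitely generated `A`-modules,
indexed by a finite linearly ordered set `ι`; the size is the cardinality of `ι`. -/
structure IsProperCostratifyingSystem {A : Type u} [Ring A] {ι : Type} [Fintype ι]
    [LinearOrder ι] (Ψ Q : ι → ModuleCat.{u} A) : Prop where
  finite_Ψ : ∀ i, Module.Finite A (Ψ i)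
  finite_Q : ∀ i, Module.Finite A (Q i)
  indecomposable : ∀ i, Indecomposable (Q i)
  /-- `End(Ψ(i))` is a division ring. -/
  division : ∀ i, Nontrivial (Module.End A (Ψ i)) ∧
    ∀ f : Module.End A (Ψ i), f ≠ 0 → IsUnit f
  hom_eq_zero : ∀ i j, i < j → ∀ f : Ψ i →ₗ[A] Ψ j, f = 0
  exact_sequence : ∀ i, ∃ (Z : ModuleCat.{u} A) (α : Z →ₗ[A] Q i) (β : Q i →ₗ[A] Ψ i),
    Function.Injective α ∧ Function.Exact α β ∧ Function.Surjective β ∧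
    Filt (fun j : {j // j ≤ i} => Ψ j) Z
  ext_eq_zero : ∀ i j, Subsingleton (Abelian.Ext (Q i) (Ψ j) 1)

/-- `F` restricts to an equivalence from the full subcategory `X` to the full subcategory `Y`,
exact in the sense that it sends short exact sequences with terms in `X` to short exact
sequences, and `G` restricts to a quasi-inverse of it. -/
def IsExactEquivalenceWithQuasiInverse {A B : Type u} [Ring A] [Ring B]
    (X : ObjectProperty (ModuleCat.{u} A)) (Y : ObjectProperty (ModuleCat.{u} B))
    (F : ModuleCat.{u} A ⥤ ModuleCat.{u} B) [F.Additive]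
    (G : ModuleCat.{u} B ⥤ ModuleCat.{u} A) : Prop :=
  ∃ (hF : ∀ M : X.FullSubcategory, Y ((X.ι ⋙ F).obj M))
    (hG : ∀ N : Y.FullSubcategory, X ((Y.ι ⋙ G).obj N)),
    (Y.lift (X.ι ⋙ F) hF).IsEquivalence ∧
    (∀ S : ShortComplex (ModuleCat.{u} A), X S.X₁ → X S.X₂ → X S.X₃ →
      S.ShortExact → (S.map F).ShortExact) ∧
    Nonempty (Y.lift (X.ι ⋙ F) hF ⋙ X.lift (Y.ι ⋙ G) hG ≅ 𝟭 X.FullSubcategory) ∧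
    Nonempty (X.lift (Y.ι ⋙ G) hG ⋙ Y.lift (X.ι ⋙ F) hF ≅ 𝟭 Y.FullSubcategory)

/-- The family `P(i) = F(Q(i))` of modules over `Γ = End_A(Q)ᵒᵖ`, `Q = ⨁ i, Q i`, indexed by
`ι` with the opposite order. -/
def ΓP {A : Type u} [Ring A] {ι : Type} [Fintype ι] (Q : ι → ModuleCat.{u} A) :
    ιᵒᵈ → ModuleCat.{u} (EndOp (sum Q)) :=
  fun i => (homFunctor (sum Q)).obj (Q (OrderDual.ofDual i))

end Costrat

end

/-! The functor `F = Hom(Q, -)` turns the system into one of projectives over `Γ`, recorded as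
`ProjSystem`, and the remaining structure is read off there.

Passage to `Γ`. Condition (iv) spreads along filtrations to `Ext¹(Q, M) = 0` for every filtered `M`,
so `F` preserves epimorphisms with filtered kernel. A horseshoe argument built on (iii)
(`exists_presentation`) covers each filtered `M` by an object of `add Q` with filtered kernel; doing
this twice presents `M` by `add Q`, and `F` keeps the presentation exact. On `add Q` full
faithfulness of `F` and invertibility of the counit `Q ⊗ Hom(Q, M) → M` are formal, and
presentations carry both to all filtered modules. The essential image is closed under extensions by
the `F(Ψ i)`: such an extension is encoded by a map out of `F(ker (Q i → Ψ i))`, which comes from a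
map over `Λ` by fullness, and the pushout over `Λ` realises it (`exists_equiv_hom`). This gives (b),
once the `F(Ψ i)` are known to be the proper standard modules. For (e), a module in `add Q` has
projective, hence filtered, image, and the equivalence brings the filtration back; conversely
Ext-vanishing splits the cover from `add Q`.

Over `Γ`, write `P i` and `Ψ i` for the images, in the reversed order. The decisive fact is
`comp_eq_zero`: every map `P i → Ψ i` kills the image of each non-unit endomorphism of `P i`. It is
proved for a nonzero map of minimal image and carries over because `End(Ψ i)` is a division ring. It
identifies `ker (P i → Ψ i)` with the trace defining the proper standard module, whence (c). The
vanishing of `Hom(P j, Ψ i)` for `i < j` separates the `P i`, which gives (a); the rank of `K₀`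
comes from pairing simple tops with the lengths of `Hom(P i, -)`.

For (f), traces of upper sets cut a filtered module into layers filtered by a single `Ψ a`
(`isFiltered_traceOn`), so kernels of epimorphisms and retracts reduce to one `Ψ a`, where the
division ring property suffices. For (d), `(P k)^*` is filtered by the forms with values in the
trace ideals of `A`. Each layer is `Hom(P k, N)` with `N` filtered by `Ψ a`; a basis of `Hom(P k, Ψ
a)` over `End(Ψ a)` identifies it with a power of `Hom(P a, N)`, and `Hom(P a, N)` is the standard
module of the opposite algebra at `a`. -/

namespace Costrat

noncomputable section

/-! ### Filtrations as iterated extensions -/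

section Filtrations

variable {A : Type u} [Ring A] {ι : Type w}

/-- Modules built from the zero module by finitely many extensions by members `C j`, `j ∈ s`. -/
inductive IsFiltered (C : ι → ModuleCat.{u} A) (s : Set ι) :
    ∀ (M : Type u) [AddCommGroup M] [Module A M], Prop
  | zero {M} [AddCommGroup M] [Module A M] [Subsingleton M] : IsFiltered C s M
  | step {M} [AddCommGroup M] [Module A M] (j : ι) (hj : j ∈ s) (π : M →ₗ[A] C j)
      (hπ : Function.Surjective π) : IsFiltered C s (LinearMap.ker π) → IsFiltered C s M

variable {C : ι → ModuleCat.{u} A} {s t : Set ι} {M N L : Type u} [AddCommGroup M] [Module A M]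
  [AddCommGroup N] [Module A N] [AddCommGroup L] [Module A L]

/-- The equivalence between the kernels of `π` and of `π ∘ e`. -/
def kerEquivComp {B : Type*} [AddCommGroup B] [Module A B] (e : N ≃ₗ[A] M) (π : M →ₗ[A] B) :
    LinearMap.ker (π ∘ₗ e.toLinearMap) ≃ₗ[A] LinearMap.ker π :=
  e.ofSubmodules _ _ (by
    ext x
    simp only [Submodule.mem_map, LinearMap.mem_ker, LinearMap.comp_apply]
    constructor
    · rintro ⟨y, hy, rfl⟩
      exact hy
    · intro hx
      exact ⟨e.symm x, by simpa using hx, by simp⟩)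

theorem IsFiltered.of_equiv (h : IsFiltered C s M) (e : N ≃ₗ[A] M) : IsFiltered C s N := by
  induction h generalizing N with
  | zero =>
    have := e.toEquiv.subsingleton
    exact .zero
  | step j hj π hπ _ ih =>
    exact .step j hj (π ∘ₗ e.toLinearMap) (hπ.comp e.surjective) (ih (kerEquivComp e π))

theorem IsFiltered.mono (h : IsFiltered C s M) (hst : s ⊆ t) : IsFiltered C t M := by
  induction h with
  | zero => exact .zero
  | step j hj π hπ _ ih => exact .step j (hst hj) π hπ ih

/-- Induction on the filtration of `L`: its top map composed with `g` is a top map for `M`, whose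
kernel is an extension of the smaller kernel by `N`. -/
theorem IsFiltered.of_exact (hL : IsFiltered C s L) (f : N →ₗ[A] M) (g : M →ₗ[A] L)
    (hf : Function.Injective f) (hfg : Function.Exact f g) (hg : Function.Surjective g)
    (hN : IsFiltered C s N) : IsFiltered C s M := by
  induction hL generalizing M with
  | zero =>
    refine hN.of_equiv (LinearEquiv.ofBijective f ⟨hf, fun x => ?_⟩).symm
    exact (hfg x).1 (Subsingleton.elim _ _)
  | step j hj π hπ _ ih =>
    refine .step j hj (π ∘ₗ g) (hπ.comp hg) (ih
      (f.codRestrict _ fun x => by simp [hfg.apply_apply_eq_zero])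
      (g.restrict fun x hx => hx) ?_ ?_ ?_)
    · intro x y hxy
      exact hf (congrArg Subtype.val hxy)
    · rintro ⟨x, hx⟩
      constructor
      · intro h
        obtain ⟨y, rfl⟩ := (hfg x).1 (congrArg Subtype.val h)
        exact ⟨y, rfl⟩
      · rintro ⟨y, hy⟩
        have : f y = x := congrArg Subtype.val hy
        exact Subtype.ext ((hfg x).2 ⟨y, this⟩)
    · rintro ⟨y, hy⟩
      obtain ⟨x, rfl⟩ := hg y
      exact ⟨⟨x, hy⟩, rfl⟩

theorem IsFiltered.of_submodule (K : Submodule A M) (hK : IsFiltered C s K)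
    (hQ : IsFiltered C s (M ⧸ K)) : IsFiltered C s M :=
  hQ.of_exact K.subtype K.mkQ K.injective_subtype
    (LinearMap.exact_subtype_mkQ K) K.mkQ_surjective hK

theorem IsFiltered.of_eq_top {K : Submodule A M} (hK : IsFiltered C s K) (h : K = ⊤) :
    IsFiltered C s M :=
  hK.of_equiv (LinearEquiv.ofTop K h).symm

theorem isFiltered_of_equiv_member {j : ι} (hj : j ∈ s) (e : M ≃ₗ[A] C j) : IsFiltered C s M := by
  refine .step j hj e.toLinearMap e.surjective ?_
  have : Subsingleton (LinearMap.ker e.toLinearMap) := by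
    rw [LinearEquiv.ker]
    infer_instance
  exact .zero

theorem isFiltered_member (C : ι → ModuleCat.{u} A) {j : ι} (hj : j ∈ s) : IsFiltered C s (C j) :=
  isFiltered_of_equiv_member hj (LinearEquiv.refl A _)

theorem IsFiltered.prod (hM : IsFiltered C s M) (hN : IsFiltered C s N) :
    IsFiltered C s (M × N) :=
  hN.of_exact (LinearMap.inl A M N) (LinearMap.snd A M N) LinearMap.inl_injective
    (Function.Exact.inl_snd) LinearMap.snd_surjective hM

theorem IsFiltered.pi {n : ℕ} {X : Fin n → Type u} [∀ k, AddCommGroup (X k)]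
    [∀ k, Module A (X k)] (h : ∀ k, IsFiltered C s (X k)) : IsFiltered C s (∀ k, X k) := by
  induction n with
  | zero => exact .zero
  | succ n ih =>
    exact ((h 0).prod (ih fun k => h k.succ)).of_equiv (Fin.consLinearEquiv A X).symm

theorem IsFiltered.pi_fintype {κ : Type} [Fintype κ] {X : κ → Type u} [∀ k, AddCommGroup (X k)]
    [∀ k, Module A (X k)] (h : ∀ k, IsFiltered C s (X k)) : IsFiltered C s (∀ k, X k) :=
  (IsFiltered.pi fun k => h ((Fintype.equivFin κ).symm k)).of_equiv
    (LinearEquiv.piCongrLeft A X (Fintype.equivFin κ).symm).symm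

theorem IsFiltered.of_family {ι' : Type*} {C' : ι' → ModuleCat.{u} A} {s' : Set ι'}
    (h : IsFiltered C s M) (H : ∀ j ∈ s, IsFiltered C' s' (C j)) : IsFiltered C' s' M := by
  induction h with
  | zero => exact .zero
  | step j hj π hπ _ ih =>
    exact (H j hj).of_exact (LinearMap.ker π).subtype π (Submodule.injective_subtype _)
      (LinearMap.exact_subtype_ker_map π) hπ ih

/-- A chain of submodules gives an iterated extension. -/
theorem isFiltered_of_filt {M : ModuleCat.{u} A} (h : Filt C M) :
    IsFiltered C Set.univ M := by
  obtain ⟨n, N, h0, hn, hN⟩ := h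
  have key : ∀ k ≤ n, IsFiltered C Set.univ (N k) := by
    intro k
    induction k with
    | zero =>
      intro _
      rw [h0]
      exact .zero
    | succ k ih =>
      intro hk
      obtain ⟨hle, i, ⟨e⟩⟩ := hN k hk
      refine .step i trivial (e.toLinearMap ∘ₗ Submodule.mkQ _)
        (e.surjective.comp (Submodule.mkQ_surjective _)) ((ih (by omega)).of_equiv ?_)
      refine LinearEquiv.ofEq _ _ ?_ ≪≫ₗ Submodule.submoduleOfEquivOfLe hle
      rw [LinearEquiv.ker_comp, Submodule.ker_mkQ]
  have := key n le_rfl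
  rw [hn] at this
  exact this.of_equiv Submodule.topEquiv.symm

/-- The chain inside `ker π` is pushed forward to `M`, and `M` itself is put on top of it. -/
theorem filt_of_isFiltered_aux (h : IsFiltered C Set.univ M) : Filt C (ModuleCat.of A M) := by
  induction h with
  | zero => exact ⟨0, fun _ => ⊥, rfl, Subsingleton.elim _ _, fun k hk => absurd hk (by omega)⟩
  | @step M _ _ j hj π hπ _ ih =>
    obtain ⟨n, N, h0, hn, hN⟩ := ih
    let K := LinearMap.ker π
    let N' : ℕ → Submodule A M := fun k => if k ≤ n then (N k).map K.subtype else ⊤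
    refine ⟨n + 1, N', ?_, if_neg (by omega), fun k hk => ?_⟩
    · change (if 0 ≤ n then (N 0).map K.subtype else ⊤) = ⊥
      rw [if_pos (Nat.zero_le n), h0, Submodule.map_bot]
    · rcases Nat.lt_or_ge k n with hkn | hkn
      · obtain ⟨hle, i, ⟨e⟩⟩ := hN k hkn
        have e1 : N' k = (N k).map K.subtype := if_pos hkn.le
        have e2 : N' (k + 1) = (N (k + 1)).map K.subtype := if_pos hkn
        rw [e1, e2]
        refine ⟨Submodule.map_mono hle, i, ⟨?_ ≪≫ₗ e⟩⟩
        refine (Submodule.Quotient.equiv _ _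
          (Submodule.equivMapOfInjective K.subtype K.injective_subtype (N (k + 1))) ?_).symm
        ext ⟨x, hx⟩
        simp only [Submodule.mem_map, Submodule.submoduleOf, Submodule.mem_comap,
          Submodule.subtype_apply]
        constructor
        · rintro ⟨⟨y, hy⟩, hy', h⟩
          exact ⟨y, hy', congrArg Subtype.val h⟩
        · rintro ⟨y, hy, rfl⟩
          exact ⟨⟨y, hle hy⟩, hy, rfl⟩
      · obtain rfl : k = n := by omega
        have e1 : N' k = K := by
          change (if k ≤ k then (N k).map K.subtype else ⊤) = K
          rw [if_pos le_rfl, hn, Submodule.map_top, Submodule.range_subtype]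
        have e2 : N' (k + 1) = ⊤ := if_neg (by omega)
        rw [e1, e2]
        refine ⟨le_top, j, ⟨?_⟩⟩
        refine Submodule.Quotient.equiv _ K Submodule.topEquiv ?_ ≪≫ₗ
          π.quotKerEquivOfSurjective hπ
        ext x
        simp [Submodule.submoduleOf]

theorem filt_iff_isFiltered {M : ModuleCat.{u} A} : Filt C M ↔ IsFiltered C Set.univ M :=
  ⟨isFiltered_of_filt, fun h => filt_of_isFiltered_aux h⟩

theorem filt_subtype_iff {M : ModuleCat.{u} A} :
    Filt (fun j : s => C j) M ↔ IsFiltered C s M := by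
  rw [filt_iff_isFiltered]
  constructor
  · intro h
    exact h.of_family fun j _ => isFiltered_of_equiv_member j.2 (LinearEquiv.refl A _)
  · intro h
    exact h.of_family fun j hj => isFiltered_of_equiv_member
      (C := fun j : s => C j) (j := ⟨j, hj⟩) trivial (LinearEquiv.refl A _)

end Filtrations


/-! ### Indecomposable modules, local endomorphism rings and projectives -/

section Indecomposable

variable {A : Type u} [Ring A]

/-- A nonzero module whose only idempotent endomorphisms are `0` and `1`. -/
structure IsIndec (A : Type u) [Ring A] (M : Type u) [AddCommGroup M] [Module A M] : Prop where
  nontrivial : Nontrivial M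
  idempotent : ∀ e : Module.End A M, e * e = e → e = 0 ∨ e = 1

/-- An idempotent splits `M` into its range and kernel; a biproduct decomposition conversely yields
the idempotent projecting onto one factor. -/
theorem indecomposable_iff {M : ModuleCat.{u} A} : Indecomposable M ↔ IsIndec A M := by
  constructor
  · rintro ⟨h0, h⟩
    refine ⟨?_, fun e he => ?_⟩
    · rw [← not_subsingleton_iff_nontrivial]
      intro _
      exact h0 (ModuleCat.isZero_of_subsingleton M)
    · have hc : IsCompl (LinearMap.range e) (LinearMap.ker e) :=
        LinearMap.IsIdempotentElem.isCompl (f := e) he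
      have i : M ≅ ModuleCat.of A (LinearMap.range e) ⊞ ModuleCat.of A (LinearMap.ker e) :=
        (Submodule.prodEquivOfIsCompl _ _ hc).symm.toModuleIso ≪≫
          (ModuleCat.biprodIsoProd (ModuleCat.of A (LinearMap.range e))
            (ModuleCat.of A (LinearMap.ker e))).symm
      rcases h _ _ i with h | h
      · left
        have := ModuleCat.subsingleton_of_isZero h
        ext x
        exact congrArg Subtype.val (Subsingleton.elim (⟨e x, x, rfl⟩ : LinearMap.range e) 0)
      · right
        have := ModuleCat.subsingleton_of_isZero h
        ext x
        have hx : e (x - e x) = 0 := by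
          rw [map_sub, sub_eq_zero]
          exact (LinearMap.congr_fun he x).symm
        have := congrArg Subtype.val (Subsingleton.elim (⟨x - e x, hx⟩ : LinearMap.ker e) 0)
        exact (sub_eq_zero.1 this).symm
  · rintro ⟨hn, h⟩
    refine ⟨fun h0 => ?_, fun Y Z i => ?_⟩
    · have := ModuleCat.subsingleton_of_isZero h0
      exact not_subsingleton M this
    · let e : M ⟶ M := i.hom ≫ Limits.biprod.fst ≫ Limits.biprod.inl ≫ i.inv
      have he : e ≫ e = e := by simp [e]
      rcases h e.hom (by
        change e.hom ∘ₗ e.hom = e.hom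
        rw [← ModuleCat.hom_comp, he]) with h | h
      · left
        have h' : e = 0 := ModuleCat.hom_ext h
        rw [Limits.IsZero.iff_id_eq_zero]
        calc 𝟙 Y = Limits.biprod.inl ≫ i.inv ≫ e ≫ i.hom ≫ Limits.biprod.fst := by simp [e]
          _ = 0 := by simp [h']
      · right
        have h' : e = 𝟙 M := ModuleCat.hom_ext h
        rw [Limits.IsZero.iff_id_eq_zero]
        calc 𝟙 Z = Limits.biprod.inr ≫ i.inv ≫ 𝟙 M ≫ i.hom ≫ Limits.biprod.snd := by simp
          _ = 0 := by rw [← h']; simp [e]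

variable {M N : Type u} [AddCommGroup M] [Module A M] [AddCommGroup N] [Module A N]

theorem IsIndec.eq_bot_or_eq_bot (h : IsIndec A M) {U V : Submodule A M} (hUV : IsCompl U V) :
    U = ⊥ ∨ V = ⊥ := by
  have hp : U.projection V hUV * U.projection V hUV = U.projection V hUV :=
    Submodule.isIdempotentElem_projection hUV
  rcases h.idempotent _ hp with h0 | h1
  · left
    rw [← Submodule.range_projection hUV, h0, LinearMap.range_zero]
  · right
    rw [← Submodule.ker_projection hUV, h1]
    exact LinearMap.ker_id

/-- Fitting's lemma. -/
theorem IsIndec.isUnit_or_isNilpotent [IsNoetherian A M] [IsArtinian A M] (h : IsIndec A M)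
    (f : Module.End A M) : IsUnit f ∨ IsNilpotent f := by
  obtain ⟨n, hn⟩ := Filter.eventually_atTop.1 f.eventually_isCompl_ker_pow_range_pow
  have hn := hn (n + 1) (by omega)
  rcases h.eq_bot_or_eq_bot hn with h0 | h0
  · left
    rw [Module.End.isUnit_iff]
    have hr : LinearMap.range (f ^ (n + 1)) = ⊤ := by
      have := hn.sup_eq_top
      rwa [h0, bot_sup_eq] at this
    constructor
    · rw [← LinearMap.ker_eq_bot, eq_bot_iff, ← h0, pow_succ]
      exact LinearMap.ker_le_ker_comp f (f ^ n)
    · rw [← LinearMap.range_eq_top, eq_top_iff, ← hr, pow_succ']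
      exact LinearMap.range_comp_le_range (f ^ n) f
  · right
    exact ⟨n + 1, LinearMap.range_eq_bot.1 h0⟩

theorem IsIndec.isLocalRing [IsNoetherian A M] [IsArtinian A M] (h : IsIndec A M) :
    IsLocalRing (Module.End A M) := by
  have := h.nontrivial
  refine IsLocalRing.of_isUnit_or_isUnit_one_sub_self fun f => ?_
  rcases h.isUnit_or_isNilpotent f with h | h
  · exact .inl h
  · exact .inr h.isUnit_one_sub

theorem exists_isUnit_of_isUnit_sum {B : Type*} [Ring B] [IsLocalRing B] {κ : Type*}
    (s : Finset κ) (x : κ → B) (h : IsUnit (∑ k ∈ s, x k)) : ∃ k ∈ s, IsUnit (x k) := by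
  classical
  induction s using Finset.induction_on with
  | empty =>
    rw [Finset.sum_empty] at h
    exact absurd h not_isUnit_zero
  | insert a s ha ih =>
    rw [Finset.sum_insert ha] at h
    obtain ⟨v, hv⟩ := h
    have key : (↑v⁻¹ : B) * x a + ↑v⁻¹ * ∑ k ∈ s, x k = 1 := by
      rw [← mul_add, ← hv, Units.inv_mul]
    rcases IsLocalRing.isUnit_or_isUnit_of_add_one key with h | h
    · exact ⟨a, Finset.mem_insert_self a s, (Units.isUnit_units_mul _ _).1 h⟩
    · obtain ⟨k, hk, hunit⟩ := ih ((Units.isUnit_units_mul _ _).1 h)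
      exact ⟨k, Finset.mem_insert_of_mem hk, hunit⟩

/-- A nonzero module through which the identity of `M` factors up to a unit, and which is
indecomposable, is isomorphic to `M`. -/
theorem IsIndec.nonempty_equiv_of_isUnit [Nontrivial M] (h : IsIndec A N) (s : M →ₗ[A] N)
    (r : N →ₗ[A] M) (hu : IsUnit (r ∘ₗ s : Module.End A M)) : Nonempty (M ≃ₗ[A] N) := by
  obtain ⟨v, hv⟩ := hu
  let w : M →ₗ[A] M := (↑v⁻¹ : Module.End A M)
  have hw : w ∘ₗ (r ∘ₗ s) = LinearMap.id := by
    rw [← hv]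
    exact v.inv_mul
  have hw1 : ∀ x, w (r (s x)) = x := LinearMap.congr_fun hw
  have hinj : Function.Injective s := fun x y hxy => by rw [← hw1 x, hxy, hw1 y]
  rcases h.idempotent (s ∘ₗ w ∘ₗ r) (by ext x; simp [hw1]) with h0 | h1
  · exfalso
    obtain ⟨x, hx⟩ := exists_ne (0 : M)
    have := LinearMap.congr_fun h0 (s x)
    simp only [LinearMap.comp_apply, hw1, LinearMap.zero_apply] at this
    exact hx (hinj (by rw [this, map_zero]))
  · exact ⟨LinearEquiv.ofBijective s ⟨hinj, fun y => ⟨w (r y), LinearMap.congr_fun h1 y⟩⟩⟩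

section Projective

/-- The quotient map onto `M ⧸ V` lifts to an endomorphism `k` with image in `U`. Then `1 - k` has
image in `V`, and one of `k`, `1 - k` is a unit. -/
theorem eq_top_or_eq_top_of_sup_eq_top [Module.Projective A M] [IsLocalRing (Module.End A M)]
    {U V : Submodule A M} (h : U ⊔ V = ⊤) : U = ⊤ ∨ V = ⊤ := by
  have hs : Function.Surjective (V.mkQ ∘ₗ U.subtype) := by
    intro x
    obtain ⟨x, rfl⟩ := V.mkQ_surjective x
    obtain ⟨a, ha, b, hb, rfl⟩ := Submodule.mem_sup.1 (h ▸ Submodule.mem_top : x ∈ U ⊔ V)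
    refine ⟨⟨a, ha⟩, ?_⟩
    simp [(Submodule.Quotient.mk_eq_zero V).2 hb]
  obtain ⟨k, hk⟩ := Module.projective_lifting_property _ V.mkQ hs
  rcases IsLocalRing.isUnit_or_isUnit_of_add_one
      (add_sub_cancel (U.subtype ∘ₗ k : Module.End A M) 1) with hu | hu
  · left
    rw [Module.End.isUnit_iff] at hu
    rw [eq_top_iff]
    intro x _
    obtain ⟨y, rfl⟩ := hu.2 x
    exact (k y).2
  · right
    rw [Module.End.isUnit_iff] at hu
    rw [eq_top_iff]
    intro x _
    obtain ⟨y, rfl⟩ := hu.2 x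
    rw [← Submodule.ker_mkQ V, LinearMap.mem_ker, LinearMap.sub_apply, map_sub, sub_eq_zero]
    exact (LinearMap.congr_fun hk y).symm

theorem IsIndec.le_jacobson [Module.Projective A M] [IsNoetherian A M] [IsArtinian A M]
    (h : IsIndec A M) {U : Submodule A M} (hU : U ≠ ⊤) : U ≤ Module.jacobson A M := by
  have := h.isLocalRing
  refine le_sInf fun m hm => ?_
  by_contra hle
  rcases eq_top_or_eq_top_of_sup_eq_top
    (hm.2 (U ⊔ m) (lt_of_le_of_ne le_sup_right fun h0 => hle (h0 ▸ le_sup_left))) with h1 | h1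
  · exact hU h1
  · exact hm.1 h1

variable {κ : Type} [Fintype κ] {P : κ → Type u} [∀ i, AddCommGroup (P i)] [∀ i, Module A (P i)]

/-- Finitely generated projective modules are direct summands of sums of summands of `A`. -/
theorem exists_sum_eq_id (e : A ≃ₗ[A] ∀ i, P i) [Module.Finite A M] [Module.Projective A M] :
    ∃ (n : ℕ) (s : Fin n → ∀ i, M →ₗ[A] P i) (r : Fin n → ∀ i, P i →ₗ[A] M),
      ∑ k, ∑ i, r k i ∘ₗ s k i = LinearMap.id := by
  classical
  obtain ⟨n, r, s, -, -, hrs⟩ := Module.Finite.exists_comp_eq_id_of_projective A M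
  refine ⟨n, fun k i => LinearMap.proj i ∘ₗ e.toLinearMap ∘ₗ LinearMap.proj k ∘ₗ s,
    fun k i => r ∘ₗ LinearMap.single A (fun _ => A) k ∘ₗ e.symm.toLinearMap ∘ₗ
      LinearMap.single A P i, ?_⟩
  ext x
  have h1 : ∀ k, ∑ i, e.symm (Pi.single i (e (s x k) i)) = s x k := fun k => by
    rw [← map_sum, Finset.univ_sum_single, LinearEquiv.symm_apply_apply]
  have h2 : ∑ k, Pi.single k (s x k) = s x := Finset.univ_sum_single _
  simp only [LinearMap.sum_apply, LinearMap.comp_apply, LinearEquiv.coe_coe, LinearMap.proj_apply,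
    LinearMap.single_apply, LinearMap.id_apply]
  calc ∑ k, ∑ i, r (Pi.single k (e.symm (Pi.single i (e (s x k) i))))
      = ∑ k, r (Pi.single k (s x k)) := Finset.sum_congr rfl fun k _ => by
        rw [← map_sum]
        congr 1
        conv_rhs => rw [← h1 k]
        exact (map_sum (LinearMap.single A (fun _ => A) k) _ _).symm
    _ = x := by
      rw [← map_sum, h2]
      exact LinearMap.congr_fun hrs x

/-- The indecomposable finitely generated projective modules are the summands of `A`. -/
theorem exists_equiv_of_projective (e : A ≃ₗ[A] ∀ i, P i) (hP : ∀ i, IsIndec A (P i))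
    [Module.Finite A M] [Module.Projective A M] [IsNoetherian A M] [IsArtinian A M]
    (hM : IsIndec A M) : ∃ i, Nonempty (M ≃ₗ[A] P i) := by
  obtain ⟨n, s, r, hsr⟩ := exists_sum_eq_id (M := M) e
  have := hM.isLocalRing
  have := hM.nontrivial
  have h1 : IsUnit (∑ k, ∑ i, r k i ∘ₗ s k i : Module.End A M) := by
    rw [hsr]
    exact isUnit_one
  obtain ⟨k, -, hk⟩ := exists_isUnit_of_isUnit_sum _ _ h1
  obtain ⟨i, -, hi⟩ := exists_isUnit_of_isUnit_sum _ _ hk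
  exact ⟨i, (hP i).nonempty_equiv_of_isUnit _ _ hi⟩

/-- Induction on length: a nontrivial idempotent splits `M` into two shorter projectives, and an
indecomposable `M` is some `P i`. Uniqueness of decompositions plays no role. -/
theorem isFiltered_of_projective [IsArtinianRing A] {ι : Type w} {C : ι → ModuleCat.{u} A}
    {s : Set ι} (e : A ≃ₗ[A] ∀ i, P i) (hP : ∀ i, IsIndec A (P i))
    (hC : ∀ i, IsFiltered C s (P i)) [Module.Finite A M] [Module.Projective A M] :
    IsFiltered C s M := by
  induction hl : Module.length A M using WellFoundedLT.induction generalizing M with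
  | ind l ih =>
    subst hl
    by_cases hM : IsIndec A M
    · obtain ⟨i, ⟨e'⟩⟩ := exists_equiv_of_projective e hP hM
      exact (hC i).of_equiv e'
    · rcases subsingleton_or_nontrivial M with h0 | h0
      · exact .zero
      · obtain ⟨f, hf, hf0, hf1⟩ : ∃ f : Module.End A M, f * f = f ∧ f ≠ 0 ∧ f ≠ 1 := by
          by_contra! hc
          exact hM ⟨h0, fun f hf => or_iff_not_imp_left.2 fun h => hc f hf h⟩
        have hf' : ∀ x, f (f x) = f x := LinearMap.congr_fun hf
        have hr : LinearMap.range f ≠ ⊤ := by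
          intro h
          apply hf1
          ext x
          obtain ⟨y, rfl⟩ := LinearMap.range_eq_top.1 h x
          exact hf' y
        have hk : LinearMap.ker f ≠ ⊤ := fun h => hf0 (LinearMap.ker_eq_top.1 h)
        have p1 : Module.Projective A (LinearMap.range f) :=
          .of_split (LinearMap.range f).subtype f.rangeRestrict (by
            ext ⟨_, y, rfl⟩
            exact hf' y)
        have p2 : Module.Projective A (LinearMap.ker f) :=
          .of_split (LinearMap.ker f).subtype
            ((LinearMap.id - f).codRestrict _ fun x => by simp [hf']) (by
            ext ⟨y, hy⟩
            simpa using hy)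
        exact (ih _ (Submodule.length_lt hr) rfl).of_exact (LinearMap.ker f).subtype
          f.rangeRestrict (Submodule.injective_subtype _)
          (by
            intro x
            rw [← LinearMap.mem_ker, LinearMap.ker_rangeRestrict]
            simp)
          f.surjective_rangeRestrict (ih _ (Submodule.length_lt hk) rfl)

end Projective

end Indecomposable


/-! ### Trace submodules -/

section Trace

variable {A : Type u} [Ring A] {κ : Type w} {P : κ → ModuleCat.{u} A} {s : Set κ}
  {M N : Type u} [AddCommGroup M] [Module A M] [AddCommGroup N] [Module A N]

/-- The submodule of `M` generated by the images of the modules `P j`, `j ∈ s`. -/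
def traceOn (P : κ → ModuleCat.{u} A) (s : Set κ) (M : Type u) [AddCommGroup M] [Module A M] :
    Submodule A M :=
  ⨆ j : s, trace A (P j) M

theorem range_le_traceOn {j : κ} (hj : j ∈ s) (f : P j →ₗ[A] M) :
    LinearMap.range f ≤ traceOn P s M :=
  (le_iSup (fun f : P j →ₗ[A] M => LinearMap.range f) f).trans
    (le_iSup (fun j : s => trace A (P j) M) ⟨j, hj⟩)

theorem apply_mem_traceOn {j : κ} (hj : j ∈ s) (f : P j →ₗ[A] M) (x : P j) :
    f x ∈ traceOn P s M :=
  range_le_traceOn hj f ⟨x, rfl⟩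

theorem traceOn_le {U : Submodule A M} (h : ∀ j ∈ s, ∀ f : P j →ₗ[A] M, LinearMap.range f ≤ U) :
    traceOn P s M ≤ U :=
  iSup_le fun j => iSup_le fun f => h j j.2 f

theorem map_traceOn_le (g : M →ₗ[A] N) : (traceOn P s M).map g ≤ traceOn P s N := by
  rw [Submodule.map_le_iff_le_comap]
  refine traceOn_le fun j hj f => ?_
  rintro _ ⟨x, rfl⟩
  exact apply_mem_traceOn hj (g ∘ₗ f) x

theorem map_mem_traceOn (g : M →ₗ[A] N) {x : M} (hx : x ∈ traceOn P s M) :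
    g x ∈ traceOn P s N :=
  map_traceOn_le g ⟨x, hx, rfl⟩

/-- Maps out of the projective `P j` lift along `g`, so traces are compatible with epimorphic
images. -/
theorem map_traceOn_eq (hP : ∀ j, Module.Projective A (P j)) (g : M →ₗ[A] N)
    (hg : Function.Surjective g) : (traceOn P s M).map g = traceOn P s N := by
  refine le_antisymm (map_traceOn_le g) (traceOn_le fun j hj f => ?_)
  obtain ⟨f', rfl⟩ := Module.projective_lifting_property g f hg
  rintro _ ⟨x, rfl⟩
  exact ⟨f' x, apply_mem_traceOn hj f' x, rfl⟩

theorem traceOn_mono {t : Set κ} (hst : s ⊆ t) : traceOn P s M ≤ traceOn P t M :=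
  traceOn_le fun _ hj f => range_le_traceOn (hst hj) f

theorem traceOn_induction {p : M → Prop} (hf : ∀ j ∈ s, ∀ (f : P j →ₗ[A] M) (x : P j), p (f x))
    (h0 : p 0) (hadd : ∀ x y, p x → p y → p (x + y)) {x : M} (hx : x ∈ traceOn P s M) : p x := by
  refine Submodule.iSup_induction _ (motive := p) hx (fun j y hy => ?_) h0 hadd
  refine Submodule.iSup_induction _ (motive := p) hy ?_ h0 hadd
  rintro f _ ⟨z, rfl⟩
  exact hf j j.2 f z

/-- The trace of `⨁_{j ∈ s} P j` is the sum of the traces of the summands. -/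
theorem trace_pi {κ : Type} {P : κ → ModuleCat.{u} A} (s : Set κ) [Finite s] :
    trace A (∀ j : s, P j) M = traceOn P s M := by
  classical
  have := Fintype.ofFinite s
  apply le_antisymm
  · refine iSup_le fun f => ?_
    rintro _ ⟨x, rfl⟩
    rw [← Finset.univ_sum_single x, map_sum]
    refine Submodule.sum_mem _ fun j _ => ?_
    exact apply_mem_traceOn j.2 (f ∘ₗ LinearMap.single A (fun j : s => P j) j) (x j)
  · refine traceOn_le fun j hj f => ?_
    rintro _ ⟨x, rfl⟩
    refine le_iSup (fun f : (∀ j : s, P j) →ₗ[A] M => LinearMap.range f)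
      (f ∘ₗ LinearMap.proj (⟨j, hj⟩ : s)) ⟨Pi.single ⟨j, hj⟩ x, ?_⟩
    simp

end Trace

/-! ### Vanishing of Hom along filtrations -/

section HomVanishing

variable {A : Type u} [Ring A] {κ : Type w} {C : κ → ModuleCat.{u} A} {s : Set κ}
  {M N : Type u} [AddCommGroup M] [Module A M] [AddCommGroup N] [Module A N]

theorem IsFiltered.hom_to_eq_zero (hN : IsFiltered C s N)
    (h : ∀ j ∈ s, ∀ g : M →ₗ[A] C j, g = 0) (f : M →ₗ[A] N) : f = 0 := by
  induction hN with
  | zero => exact LinearMap.ext fun _ => Subsingleton.elim _ _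
  | step j hj π _ _ ih =>
    have hf : ∀ x, f x ∈ LinearMap.ker π := LinearMap.congr_fun (h j hj (π ∘ₗ f))
    have := ih (f.codRestrict _ hf)
    ext x
    exact congrArg Subtype.val (LinearMap.congr_fun this x)

theorem IsFiltered.hom_from_eq_zero (hM : IsFiltered C s M)
    (h : ∀ j ∈ s, ∀ g : C j →ₗ[A] N, g = 0) (f : M →ₗ[A] N) : f = 0 := by
  induction hM with
  | zero =>
    ext x
    rw [Subsingleton.elim x 0, map_zero, map_zero]
  | step j hj π hπ _ ih =>
    have hk := ih (f ∘ₗ (LinearMap.ker π).subtype)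
    have hle : LinearMap.ker π ≤ LinearMap.ker f := fun x hx => LinearMap.congr_fun hk ⟨x, hx⟩
    have := h j hj ((LinearMap.ker π).liftQ f hle ∘ₗ
      (π.quotKerEquivOfSurjective hπ).symm.toLinearMap)
    ext x
    have := LinearMap.congr_fun this (π x)
    have h2 : (π.quotKerEquivOfSurjective hπ).symm (π x) = (LinearMap.ker π).mkQ x := by
      rw [LinearEquiv.symm_apply_eq]
      rfl
    rw [LinearMap.comp_apply, LinearEquiv.coe_coe, h2] at this
    exact this

end HomVanishing

/-! ### Systems of projectives and their trace filtrations -/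

/-- Proper costratifying systems `(Ψ, P)`, for the opposite order, whose second member is a
complete family of indecomposable projective modules over a basic ring. -/
structure ProjSystem {A : Type u} [Ring A] {κ : Type} [Fintype κ] [LinearOrder κ]
    (Ψ P : κ → ModuleCat.{u} A) : Prop where
  finite : ∀ i, Module.Finite A (P i)
  projective : ∀ i, Module.Projective A (P i)
  indec : ∀ i, IsIndec A (P i)
  total : Nonempty (A ≃ₗ[A] ∀ i, P i)
  nontrivial : ∀ i, Nontrivial (Ψ i)
  division : ∀ i (f : Ψ i →ₗ[A] Ψ i), f ≠ 0 → Function.Bijective f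
  hom_eq_zero : ∀ i j, j < i → ∀ f : Ψ i →ₗ[A] Ψ j, f = 0
  cover : ∀ i, ∃ β : P i →ₗ[A] Ψ i, Function.Surjective β ∧
    IsFiltered Ψ (Set.Ici i) (LinearMap.ker β)

namespace ProjSystem

variable {A : Type u} [Ring A] {κ : Type} [Fintype κ] [LinearOrder κ] {Ψ P : κ → ModuleCat.{u} A}
  {M N : Type u} [AddCommGroup M] [Module A M] [AddCommGroup N] [Module A N]

/-- The chosen epimorphism `P i → Ψ i`. -/
def β (h : ProjSystem Ψ P) (i : κ) : P i →ₗ[A] Ψ i := (h.cover i).choose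

theorem β_surjective (h : ProjSystem Ψ P) (i : κ) : Function.Surjective (h.β i) := (h.cover i).choose_spec.1

theorem isFiltered_ker (h : ProjSystem Ψ P) (i : κ) : IsFiltered Ψ (Set.Ici i) (LinearMap.ker (h.β i)) :=
  (h.cover i).choose_spec.2

theorem isFiltered_P (h : ProjSystem Ψ P) (i : κ) : IsFiltered Ψ (Set.Ici i) (P i) :=
  .step i Set.self_mem_Ici (h.β i) (h.β_surjective i) (h.isFiltered_ker i)

theorem β_ne_zero (h : ProjSystem Ψ P) (i : κ) : h.β i ≠ 0 := by
  have := h.nontrivial i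
  intro h0
  obtain ⟨y, hy⟩ := exists_ne (0 : Ψ i)
  obtain ⟨x, rfl⟩ := h.β_surjective i y
  exact hy (by rw [h0, LinearMap.zero_apply])

theorem finite_Ψ (h : ProjSystem Ψ P) (i : κ) : Module.Finite A (Ψ i) :=
  have := h.finite i
  .of_surjective (h.β i) (h.β_surjective i)

theorem finite_of_isFiltered (h : ProjSystem Ψ P) {s : Set κ} (hM : IsFiltered Ψ s M) : Module.Finite A M := by
  induction hM with
  | zero => infer_instance
  | @step M _ _ j _ π hπ _ ih =>
    have := h.finite_Ψ j
    have : Module.Finite A (M ⧸ LinearMap.ker π) :=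
      .of_surjective (π.quotKerEquivOfSurjective hπ).symm.toLinearMap
        (π.quotKerEquivOfSurjective hπ).symm.surjective
    exact .of_submodule_quotient (LinearMap.ker π)

theorem hom_eq_zero_of_isFiltered (h : ProjSystem Ψ P) {s t : Set κ} (hM : IsFiltered Ψ s M) (hN : IsFiltered Ψ t N)
    (hst : ∀ i ∈ s, ∀ j ∈ t, j < i) (f : M →ₗ[A] N) : f = 0 :=
  hM.hom_from_eq_zero (fun i hi g =>
    hN.hom_to_eq_zero (fun j hj k => h.hom_eq_zero i j (hst i hi j hj) k) g) f

theorem hom_P_eq_zero (h : ProjSystem Ψ P) {i j : κ} (hij : i < j) (f : P j →ₗ[A] Ψ i) : f = 0 :=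
  (h.isFiltered_P j).hom_from_eq_zero
    (fun l hl g => h.hom_eq_zero l i (hij.trans_le hl) g) f

theorem exists_lift (h : ProjSystem Ψ P) {j : κ} (g : M →ₗ[A] N) (hg : Function.Surjective g) (f : P j →ₗ[A] N) :
    ∃ f' : P j →ₗ[A] M, g ∘ₗ f' = f :=
  have := h.projective j
  Module.projective_lifting_property g f hg

/-- The cover `P j → Ψ j` of the top factor lifts to `M`, so modulo `ker π` every element comes from
`P j`; induction handles the kernel. -/
theorem traceOn_eq_top (h : ProjSystem Ψ P) {s : Set κ} (hM : IsFiltered Ψ s M) : traceOn P s M = ⊤ := by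
  induction hM with
  | zero => exact Subsingleton.elim _ _
  | step j hj π hπ _ ih =>
    obtain ⟨l, hl⟩ := h.exists_lift π hπ (h.β j)
    rw [eq_top_iff]
    intro m _
    obtain ⟨p, hp⟩ := h.β_surjective j (π m)
    have hk : m - l p ∈ LinearMap.ker π := by
      rw [LinearMap.mem_ker, map_sub, ← hp, ← hl, LinearMap.comp_apply, sub_self]
    have h1 : m - l p ∈ traceOn P s _ := map_mem_traceOn (LinearMap.ker π).subtype
      (x := ⟨m - l p, hk⟩) (by rw [ih]; trivial)
    rw [← sub_add_cancel m (l p)]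
    exact add_mem h1 (apply_mem_traceOn hj l p)

/-- The trace filtration of a filtered module has filtered subquotients. -/
theorem isFiltered_traceOn (h : ProjSystem Ψ P) {s t : Set κ} (hs : IsUpperSet s) (hM : IsFiltered Ψ t M) :
    IsFiltered Ψ (t ∩ s) (traceOn P s M) ∧ IsFiltered Ψ (t \ s) (M ⧸ traceOn P s M) := by
  induction hM with
  | zero => exact ⟨.zero, .zero⟩
  | @step M _ _ j hj π hπ hK ih =>
    set K := LinearMap.ker π with hKdef
    set T := traceOn P s M with hT
    obtain ⟨ih1, ih2⟩ := ih
    -- The trace of `K` is exactly `K ⊓ T`, and `Ψ j` contributes either wholly to the trace or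
    -- wholly to the quotient, according to whether `j ∈ s`.
    have key : T.comap K.subtype = traceOn P s K ∧
        ((j ∉ s ∧ T ≤ K) ∨ (j ∈ s ∧ T.map π = ⊤)) := by
      by_cases hjs : j ∈ s
      · obtain ⟨l, hl⟩ := h.exists_lift π hπ (h.β j)
        have hl' : ∀ p, π (l p) = h.β j p := LinearMap.congr_fun hl
        have hZ : ∀ p, (hp : h.β j p = 0) → ∃ hk : l p ∈ K, (⟨l p, hk⟩ : K) ∈ traceOn P s K := by
          intro p hp
          have hk : ∀ q : LinearMap.ker (h.β j), l q ∈ K := fun q => by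
            rw [hKdef, LinearMap.mem_ker, hl']
            exact q.2
          -- The kernel of `P j → Ψ j` has factors of index at least `j`, all in the upper set `s`,
          -- while `K ⧸ traceOn P s K` has factors outside `s`. No nonzero map exists between them,
          -- so the lift `l` sends this kernel into the trace of `K`.
          have h0 := h.hom_eq_zero_of_isFiltered (h.isFiltered_ker j) ih2
            (fun a ha b hb => lt_of_not_ge fun hab => hb.2 (hs (le_trans ha hab) hjs))
            ((traceOn P s K).mkQ ∘ₗ (l ∘ₗ (LinearMap.ker (h.β j)).subtype).codRestrict K hk)
          refine ⟨hk ⟨p, hp⟩, ?_⟩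
          rw [← Submodule.ker_mkQ (traceOn P s K)]
          exact LinearMap.congr_fun h0 ⟨p, hp⟩
        have hTle : T ≤ (traceOn P s K).map K.subtype ⊔ LinearMap.range l := by
          refine traceOn_le fun i hi f => ?_
          obtain ⟨g, hg⟩ := h.exists_lift (h.β j) (h.β_surjective j) (π ∘ₗ f)
          have hk : ∀ x, (f - l ∘ₗ g) x ∈ K := fun x => by
            rw [hKdef, LinearMap.mem_ker, LinearMap.sub_apply, map_sub, LinearMap.comp_apply, hl']
            exact sub_eq_zero.2 (LinearMap.congr_fun hg x).symm
          rintro _ ⟨x, rfl⟩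
          have : f x = (f - l ∘ₗ g) x + l (g x) := by simp
          rw [this]
          exact Submodule.add_mem_sup
            ⟨_, apply_mem_traceOn hi ((f - l ∘ₗ g).codRestrict K hk) x, rfl⟩ ⟨g x, rfl⟩
        refine ⟨le_antisymm ?_ ?_, .inr ⟨hjs, ?_⟩⟩
        · rintro ⟨x, hx⟩ hxT
          obtain ⟨_, ⟨y, hy, rfl⟩, _, ⟨p, rfl⟩, hxy⟩ := Submodule.mem_sup.1 (hTle hxT)
          have hp : h.β j p = 0 := by
            rw [← hl']
            have hx' : π x = 0 := hx
            have hy' : π y = 0 := y.2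
            have hxy' : x = y + l p := hxy.symm
            rw [hxy', map_add, hy', zero_add] at hx'
            exact hx'
          obtain ⟨hk, hk'⟩ := hZ p hp
          have : (⟨x, hx⟩ : K) = y + ⟨l p, hk⟩ := Subtype.ext hxy.symm
          rw [this]
          exact add_mem hy hk'
        · intro x hx
          exact map_mem_traceOn K.subtype hx
        · rw [eq_top_iff]
          intro y _
          obtain ⟨p, rfl⟩ := h.β_surjective j y
          exact ⟨l p, apply_mem_traceOn hjs l p, hl' p⟩
      · have hle : ∀ i ∈ s, ∀ f : P i →ₗ[A] M, ∀ x, f x ∈ K := fun i hi f x =>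
          LinearMap.congr_fun
            (h.hom_P_eq_zero (lt_of_not_ge fun hij => hjs (hs hij hi)) (π ∘ₗ f)) x
        refine ⟨le_antisymm ?_ ?_, .inl ⟨hjs, ?_⟩⟩
        · have : T ≤ (traceOn P s K).map K.subtype := traceOn_le fun i hi f => by
            rintro _ ⟨x, rfl⟩
            exact ⟨_, apply_mem_traceOn hi (f.codRestrict K (hle i hi f)) x, rfl⟩
          intro x hx
          obtain ⟨y, hy, hxy⟩ := this hx
          rwa [← Subtype.ext hxy]
        · intro x hx
          exact map_mem_traceOn K.subtype hx
        · refine traceOn_le fun i hi f => ?_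
          rintro _ ⟨x, rfl⟩
          exact hle i hi f x
    obtain ⟨hcomap, hcase⟩ := key
    have hmap : (traceOn P s K).map K.subtype = K ⊓ T := by
      rw [← hcomap, Submodule.map_comap_subtype]
    let φ : (K ⧸ traceOn P s K) →ₗ[A] (M ⧸ T) := Submodule.mapQ _ _ K.subtype hcomap.ge
    have hφ : Function.Injective φ := by
      rw [← LinearMap.ker_eq_bot, Submodule.ker_mapQ, hcomap, Submodule.mkQ_map_self]
    rcases hcase with ⟨hjs, hTK⟩ | ⟨hjs, hTπ⟩
    · constructor
      · rw [inf_eq_right.2 hTK] at hmap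
        refine ih1.of_equiv (LinearEquiv.ofEq _ _ hmap.symm ≪≫ₗ
          (Submodule.equivMapOfInjective K.subtype K.injective_subtype _).symm)
      · have hj' : j ∈ t \ s := ⟨hj, hjs⟩
        refine (isFiltered_of_equiv_member hj' (LinearEquiv.refl A _)).of_exact
          φ (T.liftQ π hTK) hφ ?_ ?_ ih2
        · intro x
          obtain ⟨x, rfl⟩ := T.mkQ_surjective x
          constructor
          · intro hx
            exact ⟨Submodule.Quotient.mk ⟨x, hx⟩, rfl⟩
          · rintro ⟨y, hy⟩
            obtain ⟨y, rfl⟩ := Submodule.mkQ_surjective _ y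
            rw [← hy]
            exact y.2
        · intro y
          obtain ⟨x, rfl⟩ := hπ y
          exact ⟨T.mkQ x, rfl⟩
    · constructor
      · refine .step j ⟨hj, hjs⟩ (π ∘ₗ T.subtype) ?_ (ih1.of_equiv ?_)
        · intro y
          obtain ⟨x, hx, rfl⟩ := (hTπ ▸ Submodule.mem_top : y ∈ T.map π)
          exact ⟨⟨x, hx⟩, rfl⟩
        · refine Submodule.equivMapOfInjective T.subtype T.injective_subtype _ ≪≫ₗ
            LinearEquiv.ofEq _ _ ?_ ≪≫ₗ
            (Submodule.equivMapOfInjective K.subtype K.injective_subtype _).symm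
          rw [hmap, LinearMap.ker_comp, Submodule.map_comap_subtype, inf_comm]
      · refine ih2.of_equiv (LinearEquiv.ofBijective φ ⟨hφ, fun x => ?_⟩).symm
        obtain ⟨x, rfl⟩ := T.mkQ_surjective x
        obtain ⟨y, hy, hxy⟩ := (hTπ ▸ Submodule.mem_top : π x ∈ T.map π)
        have hk : x - y ∈ K := by
          rw [hKdef, LinearMap.mem_ker, map_sub, hxy, sub_self]
        refine ⟨Submodule.Quotient.mk ⟨x - y, hk⟩, ?_⟩
        change T.mkQ (x - y) = T.mkQ x
        rw [map_sub, sub_eq_self, ← LinearMap.mem_ker, Submodule.ker_mkQ]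
        exact hy

/-- Splitting off the largest index `a`: its layer is the trace of the `P j` with `j ≥ a`, and the
remaining indices survive in the quotient. This drives the inductions over finite index sets. -/
theorem isFiltered_traceOn_insert (h : ProjSystem Ψ P) {a : κ} {t : Finset κ}
    (ha : ∀ x ∈ t, x < a) (hM : IsFiltered Ψ ↑(insert a t) M) :
    IsFiltered Ψ {a} (traceOn P (Set.Ici a) M) ∧
      IsFiltered Ψ ↑t (M ⧸ traceOn P (Set.Ici a) M) := by
  have e1 : (↑(insert a t) : Set κ) ∩ Set.Ici a = {a} := by
    ext x
    simp only [Finset.coe_insert, Set.mem_inter_iff, Set.mem_insert_iff, Finset.mem_coe,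
      Set.mem_Ici, Set.mem_singleton_iff]
    constructor
    · rintro ⟨rfl | hx, hx'⟩
      · rfl
      · exact absurd (ha x hx) (not_lt.2 hx')
    · rintro rfl
      exact ⟨.inl rfl, le_rfl⟩
  have e2 : (↑(insert a t) : Set κ) \ Set.Ici a = ↑t := by
    ext x
    simp only [Finset.coe_insert, Set.mem_sdiff, Set.mem_insert_iff, Finset.mem_coe,
      Set.mem_Ici, not_le]
    constructor
    · rintro ⟨rfl | hx, hx'⟩
      · exact absurd hx' (lt_irrefl _)
      · exact hx
    · intro hx
      exact ⟨.inr hx, ha x hx⟩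
  have := h.isFiltered_traceOn (isUpperSet_Ici a) hM
  rwa [e1, e2] at this

end ProjSystem


/-! ### Factorisation through epimorphisms and iterated kernels -/

section Auxiliary

variable {A : Type u} [Ring A] {M N L : Type*} [AddCommGroup M] [Module A M] [AddCommGroup N]
  [Module A N] [AddCommGroup L] [Module A L]

theorem exists_comp_eq_of_ker_le (π : M →ₗ[A] N) (hπ : Function.Surjective π) (f : M →ₗ[A] L)
    (h : LinearMap.ker π ≤ LinearMap.ker f) : ∃ d : N →ₗ[A] L, d ∘ₗ π = f := by
  refine ⟨(LinearMap.ker π).liftQ f h ∘ₗ (π.quotKerEquivOfSurjective hπ).symm.toLinearMap, ?_⟩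
  ext x
  have h2 : (π.quotKerEquivOfSurjective hπ).symm (π x) = (LinearMap.ker π).mkQ x := by
    rw [LinearEquiv.symm_apply_eq]
    rfl
  rw [LinearMap.comp_apply, LinearMap.comp_apply, LinearEquiv.coe_coe, h2]
  rfl

/-- Iterated kernels: the kernel of the restriction of `g` to `ker f` and the kernel of the
restriction of `f` to `ker g` agree. -/
def kerRestrictEquiv (f : M →ₗ[A] N) (g : M →ₗ[A] L) :
    LinearMap.ker (g ∘ₗ (LinearMap.ker f).subtype) ≃ₗ[A]
      LinearMap.ker (f ∘ₗ (LinearMap.ker g).subtype) where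
  toFun x := ⟨⟨x.1.1, x.2⟩, x.1.2⟩
  invFun x := ⟨⟨x.1.1, x.2⟩, x.1.2⟩
  map_add' _ _ := rfl
  map_smul' _ _ := rfl
  left_inv _ := rfl
  right_inv _ := rfl

theorem not_isUnit_of_range_ne_top {g : Module.End A M} (hg : LinearMap.range g ≠ ⊤) :
    ¬ IsUnit g := fun hu =>
  hg (LinearMap.range_eq_top.2 ((Module.End.isUnit_iff g).1 hu).2)

end Auxiliary

/-! ### Identification with the proper standard modules -/

namespace ProjSystem

variable {A : Type u} [Ring A] {κ : Type} [Fintype κ] [LinearOrder κ] {Ψ P : κ → ModuleCat.{u} A}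

theorem ker_β_ne_top (h : ProjSystem Ψ P) (i : κ) : LinearMap.ker (h.β i) ≠ ⊤ := fun h0 =>
  h.β_ne_zero i (LinearMap.ker_eq_top.1 h0)

/-- The kernel of `β i` is generated by images of `P j`, `j ≥ i`. For `j > i` they die because
`Hom(P j, Ψ i) = 0`; for `j = i` they are images of non-surjective, hence non-unit, endomorphisms.
-/
theorem ker_β_le (h : ProjSystem Ψ P) {i : κ} (f : P i →ₗ[A] Ψ i)
    (hf : ∀ g : Module.End A (P i), ¬ IsUnit g → f ∘ₗ g = 0) :
    LinearMap.ker (h.β i) ≤ LinearMap.ker f := by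
  have h1 : traceOn P (Set.Ici i) (LinearMap.ker (h.β i)) ≤
      (LinearMap.ker f).comap (LinearMap.ker (h.β i)).subtype := by
    refine traceOn_le fun j hj g => ?_
    rintro _ ⟨x, rfl⟩
    rcases eq_or_lt_of_le (show i ≤ j from hj) with rfl | hij
    · refine LinearMap.congr_fun (hf ((LinearMap.ker (h.β i)).subtype ∘ₗ g)
        (not_isUnit_of_range_ne_top fun h0 => h.ker_β_ne_top i ?_)) x
      rw [eq_top_iff, ← h0]
      rintro _ ⟨y, rfl⟩
      exact (g y).2
    · exact LinearMap.congr_fun (h.hom_P_eq_zero hij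
        (f ∘ₗ (LinearMap.ker (h.β i)).subtype ∘ₗ g)) x
  rw [h.traceOn_eq_top (h.isFiltered_ker i)] at h1
  intro x hx
  exact h1 (Submodule.mem_top : (⟨x, hx⟩ : LinearMap.ker (h.β i)) ∈ ⊤)

variable [IsArtinianRing A] {M N : Type u} [AddCommGroup M] [Module A M] [AddCommGroup N] [Module A N]

theorem isLocalRing_end (h : ProjSystem Ψ P) (i : κ) : IsLocalRing (Module.End A (P i)) :=
  have := h.finite i
  (h.indec i).isLocalRing

/-- A nonzero `f` with minimal image works. If `f ∘ g ≠ 0`, both maps have the same image, so `f = f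
∘ g ∘ k` for some `k`. Since `g` is not a unit, neither is `g * k`, so `1 - g * k` is invertible and
killed by `f`, a contradiction. -/
theorem exists_ne_zero_comp_eq_zero (h : ProjSystem Ψ P) (i : κ) : ∃ f : P i →ₗ[A] Ψ i, f ≠ 0 ∧
    ∀ g : Module.End A (P i), ¬ IsUnit g → f ∘ₗ g = 0 := by
  have := h.finite_Ψ i
  have := h.isLocalRing_end i
  obtain ⟨_, ⟨f, hf, rfl⟩, hmin⟩ := (wellFounded_lt (α := Submodule A (Ψ i))).has_min
    {U | ∃ f : P i →ₗ[A] Ψ i, f ≠ 0 ∧ LinearMap.range f = U} ⟨_, h.β i, h.β_ne_zero i, rfl⟩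
  refine ⟨f, hf, fun g hg => ?_⟩
  by_contra h0
  have hle : LinearMap.range (f ∘ₗ g) ≤ LinearMap.range f := LinearMap.range_comp_le_range g f
  have heq : LinearMap.range (f ∘ₗ g) = LinearMap.range f := by
    by_contra hne
    exact hmin _ ⟨f ∘ₗ g, h0, rfl⟩ (lt_of_le_of_ne hle hne)
  obtain ⟨k, hk⟩ := h.exists_lift (f ∘ₗ g).rangeRestrict (LinearMap.surjective_rangeRestrict _)
    (f.codRestrict _ fun x => heq ▸ LinearMap.mem_range_self f x)
  have hk' : ∀ x, f (g (k x)) = f x := fun x =>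
    congrArg Subtype.val (LinearMap.congr_fun hk x)
  have hgk : ¬ IsUnit (g * k) := by
    intro hu
    refine hg ((Module.End.isUnit_iff g).2 ?_)
    have hs : Function.Surjective g := by
      have := ((Module.End.isUnit_iff _).1 hu).2
      exact Function.Surjective.of_comp (g := k) this
    have := h.finite i
    exact IsNoetherian.bijective_of_surjective_endomorphism g hs
  have hu : IsUnit (1 - g * k) :=
    (IsLocalRing.isUnit_or_isUnit_of_add_one (add_sub_cancel (g * k) 1)).resolve_left hgk
  apply hf
  ext x
  obtain ⟨y, rfl⟩ := ((Module.End.isUnit_iff _).1 hu).2 x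
  simp [hk']

/-- The special map `f₀` factors as `d ∘ β i` with `d` injective, by the division ring property.
Writing `f = β i ∘ k`, the composite `d ∘ f ∘ g` equals `f₀ ∘ (k * g)`, which vanishes because `k *
g` is again a non-unit. -/
theorem comp_eq_zero (h : ProjSystem Ψ P) {i : κ} (f : P i →ₗ[A] Ψ i) (g : Module.End A (P i))
    (hg : ¬ IsUnit g) : f ∘ₗ g = 0 := by
  obtain ⟨f₀, hf₀, h0⟩ := h.exists_ne_zero_comp_eq_zero i
  obtain ⟨d, rfl⟩ := exists_comp_eq_of_ker_le (h.β i) (h.β_surjective i) f₀ (h.ker_β_le f₀ h0)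
  have hd : Function.Injective d := (h.division i d fun hd => hf₀ (by rw [hd]; rfl)).1
  obtain ⟨k, rfl⟩ := h.exists_lift (h.β i) (h.β_surjective i) f
  have hkg : ¬ IsUnit (k * g) := by
    intro hu
    refine hg ((Module.End.isUnit_iff g).2 ?_)
    have hs : Function.Injective g := by
      have := ((Module.End.isUnit_iff _).1 hu).1
      exact Function.Injective.of_comp (f := k) this
    have := h.finite i
    exact IsArtinian.bijective_of_injective_endomorphism g hs
  ext x
  apply hd
  rw [LinearMap.zero_apply, map_zero]
  exact LinearMap.congr_fun (h0 (k * g) hkg) x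

/-- `Hom(P i, Ψ i)` is generated over `End(Ψ i)` by the canonical epimorphism. -/
theorem exists_eq_comp_β (h : ProjSystem Ψ P) {i : κ} (f : P i →ₗ[A] Ψ i) :
    ∃ d : Ψ i →ₗ[A] Ψ i, d ∘ₗ h.β i = f :=
  exists_comp_eq_of_ker_le (h.β i) (h.β_surjective i) f (h.ker_β_le f fun g hg =>
    h.comp_eq_zero f g hg)

theorem surjective_of_ne_zero (h : ProjSystem Ψ P) {i : κ} {f : P i →ₗ[A] Ψ i} (hf : f ≠ 0) :
    Function.Surjective f := by
  obtain ⟨d, rfl⟩ := h.exists_eq_comp_β f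
  have hd : Function.Surjective d := (h.division i d fun hd => hf (by rw [hd]; rfl)).2
  exact hd.comp (h.β_surjective i)

theorem le_jacobson (h : ProjSystem Ψ P) {i : κ} {U : Submodule A (P i)} (hU : U ≠ ⊤) :
    U ≤ Module.jacobson A (P i) :=
  have := h.finite i
  have := h.projective i
  (h.indec i).le_jacobson hU

/-- A proper submodule of `P i` lies in the radical, and `ker (β i)` is generated by the `P j` with
`j ≥ i`, so it lies in the trace. Conversely `comp_eq_zero` and `hom_P_eq_zero` say that `β i` kills
this trace. -/
theorem ker_β_eq (h : ProjSystem Ψ P) (i : κ) : LinearMap.ker (h.β i) =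
    (trace A (∀ j : {j // i ≤ j}, P j) (Module.jacobson A (P i))).map
      (Module.jacobson A (P i)).subtype := by
  have ht : trace A (∀ j : {j // i ≤ j}, P j) (Module.jacobson A (P i)) =
      traceOn P (Set.Ici i) (Module.jacobson A (P i)) := trace_pi (Set.Ici i)
  have hle := h.le_jacobson (h.ker_β_ne_top i)
  have := h.finite i
  have := (h.indec i).nontrivial
  rw [ht]
  apply le_antisymm
  · intro x hx
    refine ⟨Submodule.inclusion hle ⟨x, hx⟩, map_mem_traceOn _ ?_, rfl⟩
    rw [h.traceOn_eq_top (h.isFiltered_ker i)]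
    trivial
  · rw [Submodule.map_le_iff_le_comap]
    refine traceOn_le fun j hj g => ?_
    rintro _ ⟨x, rfl⟩
    rcases eq_or_lt_of_le (show i ≤ j from hj) with rfl | hij
    · refine LinearMap.congr_fun (h.comp_eq_zero (h.β i) ((Module.jacobson A (P i)).subtype ∘ₗ g)
        (not_isUnit_of_range_ne_top fun h0 => ?_)) x
      refine (Module.jacobson_lt_top A (P i)).ne ?_
      rw [eq_top_iff, ← h0]
      rintro _ ⟨y, rfl⟩
      exact (g y).2
    · exact LinearMap.congr_fun (h.hom_P_eq_zero hij
        (h.β i ∘ₗ (Module.jacobson A (P i)).subtype ∘ₗ g)) x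

theorem nonempty_equiv_properStandard (h : ProjSystem Ψ P) (i : κ) :
    Nonempty (Ψ i ≃ₗ[A] properStandard P i) :=
  ⟨((h.β i).quotKerEquivOfSurjective (h.β_surjective i)).symm ≪≫ₗ
    Submodule.quotEquivOfEq _ _ (h.ker_β_eq i)⟩

theorem filt_properStandard_iff (h : ProjSystem Ψ P) {M : ModuleCat.{u} A} :
    Filt (properStandard P) M ↔ IsFiltered Ψ Set.univ M := by
  rw [filt_iff_isFiltered]
  constructor
  · intro hM
    exact hM.of_family fun j _ =>
      isFiltered_of_equiv_member trivial (h.nonempty_equiv_properStandard j).some.symm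
  · intro hM
    exact hM.of_family fun j _ =>
      isFiltered_of_equiv_member trivial (h.nonempty_equiv_properStandard j).some

/-! ### Kernels of epimorphisms and direct summands of filtered modules -/

section Resolving

/-- `M` is generated by images of `P i`, so `f` is nonzero on one of them, and nonzero maps `P i → Ψ
i` are onto. -/
theorem surjective_of_traceOn_eq_top (h : ProjSystem Ψ P) {i : κ} (hM : traceOn P {i} M = ⊤)
    {f : M →ₗ[A] Ψ i} (hf : f ≠ 0) : Function.Surjective f := by
  by_contra hs
  apply hf
  rw [← LinearMap.ker_eq_top, eq_top_iff, ← hM]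
  refine traceOn_le fun j hj g => ?_
  obtain rfl : j = i := hj
  rintro _ ⟨x, rfl⟩
  by_contra hx
  exact hs (Function.Surjective.of_comp (g := g) (h.surjective_of_ne_zero (f := f ∘ₗ g)
    fun h0 => hx (LinearMap.congr_fun h0 x)))

/-- If `f` vanishes on `ker π`, then `f` and `π` differ by an automorphism of `Ψ i` and have the
same kernel. Otherwise `f` is already onto on `ker π`, and `π` stays onto on `ker f` with kernel
`ker f ⊓ ker π`, to which induction applies. -/
theorem isFiltered_ker_singleton (h : ProjSystem Ψ P) {i : κ} (hM : IsFiltered Ψ {i} M)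
    (f : M →ₗ[A] Ψ i) (hf : Function.Surjective f) : IsFiltered Ψ {i} (LinearMap.ker f) := by
  induction hM with
  | zero => exact .zero
  | step j hj π hπ hK ih =>
    obtain rfl : j = i := hj
    by_cases h0 : f ∘ₗ (LinearMap.ker π).subtype = 0
    · obtain ⟨d, rfl⟩ := exists_comp_eq_of_ker_le π hπ f
        fun x hx => LinearMap.congr_fun h0 ⟨x, hx⟩
      have := h.nontrivial j
      have hd : Function.Injective d := (h.division j d fun hd => by
        obtain ⟨y, hy⟩ := exists_ne (0 : Ψ j)
        obtain ⟨x, rfl⟩ := hf y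
        exact hy (by rw [hd]; rfl)).1
      rwa [LinearMap.ker_comp_of_ker_eq_bot _ (LinearMap.ker_eq_bot.2 hd)]
    · have hs := h.surjective_of_traceOn_eq_top (h.traceOn_eq_top hK) h0
      refine .step j rfl (π ∘ₗ (LinearMap.ker f).subtype) ?_ ((ih _ hs).of_equiv
        (kerRestrictEquiv f π))
      intro y
      obtain ⟨m, rfl⟩ := hπ y
      obtain ⟨k, hk⟩ := hs (f m)
      refine ⟨⟨m - k, ?_⟩, ?_⟩
      · rw [LinearMap.mem_ker, map_sub, sub_eq_zero]
        exact hk.symm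
      · have : π k = 0 := k.2
        simp [this]

/-- The comparison of the kernel of `f` with the kernel of its restriction to `ker (π ∘ f)`. -/
def kerRestrictCompEquiv {L : Type*} [AddCommGroup L] [Module A L] (f : M →ₗ[A] N)
    (π : N →ₗ[A] L) (hf : ∀ x ∈ LinearMap.ker (π ∘ₗ f), f x ∈ LinearMap.ker π) :
    LinearMap.ker f ≃ₗ[A] LinearMap.ker (f.restrict hf) where
  toFun x := ⟨⟨x.1, by rw [LinearMap.mem_ker, LinearMap.comp_apply, x.2, map_zero]⟩,
    Subtype.ext x.2⟩
  invFun x := ⟨x.1.1, congrArg Subtype.val x.2⟩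
  map_add' _ _ := rfl
  map_smul' _ _ := rfl
  left_inv _ := rfl
  right_inv _ := rfl

/-- Induction on the filtration of `N`: `ker f` is the kernel of the restriction of `f` to `ker (π ∘
f)`, a filtered module by the case of target `Ψ i`. -/
theorem isFiltered_ker_of_singleton (h : ProjSystem Ψ P) {i : κ} (hM : IsFiltered Ψ {i} M)
    (hN : IsFiltered Ψ {i} N) (f : M →ₗ[A] N) (hf : Function.Surjective f) :
    IsFiltered Ψ {i} (LinearMap.ker f) := by
  induction hN generalizing M with
  | zero =>
    refine hM.of_equiv (LinearEquiv.ofTop _ ?_)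
    rw [LinearMap.ker_eq_top]
    exact LinearMap.ext fun _ => Subsingleton.elim _ _
  | step j hj π hπ _ ih =>
    obtain rfl : j = i := hj
    refine (ih (h.isFiltered_ker_singleton hM (π ∘ₗ f) (hπ.comp hf)) (f.restrict fun x hx => hx)
      ?_).of_equiv (kerRestrictCompEquiv f π _)
    rintro ⟨y, hy⟩
    obtain ⟨x, rfl⟩ := hf y
    exact ⟨⟨x, hy⟩, rfl⟩

/-- Trace layers for the largest index are compared as in the snake lemma: since `TM → TN` is onto,
`ker f` is an extension of the kernel on quotients by the kernel on traces. -/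
theorem isFiltered_ker_of_finset (h : ProjSystem Ψ P) (t : Finset κ) :
    ∀ {M N : Type u} [AddCommGroup M] [Module A M] [AddCommGroup N] [Module A N],
    IsFiltered Ψ ↑t M → IsFiltered Ψ ↑t N → ∀ f : M →ₗ[A] N, Function.Surjective f →
      IsFiltered Ψ ↑t (LinearMap.ker f) := by
  induction t using Finset.induction_on_max with
  | empty =>
    intro M N _ _ _ _ hM hN f _
    cases hM with
    | zero => exact .zero
    | step j hj => simp at hj
  | insert a t ha ih =>
    intro M N _ _ _ _ hM hN f hf
    obtain ⟨hM1, hM2⟩ := h.isFiltered_traceOn_insert ha hM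
    obtain ⟨hN1, hN2⟩ := h.isFiltered_traceOn_insert ha hN
    set TM := traceOn P (Set.Ici a) M
    set TN := traceOn P (Set.Ici a) N
    have hT : TM.map f = TN := map_traceOn_eq h.projective f hf
    have hle : ∀ x ∈ TM, f x ∈ TN := fun x hx => map_mem_traceOn f hx
    have k1 := h.isFiltered_ker_of_singleton hM1 hN1 (f.restrict hle) (by
      rintro ⟨y, hy⟩
      obtain ⟨x, hx, rfl⟩ := (hT.symm ▸ hy : y ∈ TM.map f)
      exact ⟨⟨x, hx⟩, rfl⟩)
    have k2 := ih hM2 hN2 (TM.mapQ TN f hle) (by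
      intro y
      obtain ⟨y, rfl⟩ := TN.mkQ_surjective y
      obtain ⟨x, rfl⟩ := hf y
      exact ⟨TM.mkQ x, rfl⟩)
    refine (k2.mono (by simp)).of_exact
      ((TM.subtype ∘ₗ (LinearMap.ker (f.restrict hle)).subtype).codRestrict (LinearMap.ker f)
        fun x => congrArg Subtype.val x.2)
      ((TM.mkQ ∘ₗ (LinearMap.ker f).subtype).codRestrict _ fun x => ?_) ?_ ?_ ?_
      (k1.mono (by simp))
    · have : f x = 0 := x.2
      simp [this]
    · intro x y hxy
      have h1 : (x.1.1 : M) = y.1.1 :=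
        congrArg (fun z : LinearMap.ker f => (z : M)) hxy
      exact Subtype.ext (Subtype.ext h1)
    · rintro ⟨x, hx⟩
      constructor
      · intro h0
        have hxT : x ∈ TM := by
          rw [← Submodule.ker_mkQ TM]
          exact congrArg Subtype.val h0
        exact ⟨⟨⟨x, hxT⟩, Subtype.ext hx⟩, rfl⟩
      · rintro ⟨y, hy⟩
        apply Subtype.ext
        have : x = y.1.1 := (congrArg Subtype.val hy).symm
        subst this
        exact (Submodule.Quotient.mk_eq_zero TM).2 y.1.2
    · rintro ⟨y, hy⟩
      obtain ⟨x, rfl⟩ := TM.mkQ_surjective y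
      have hfx : f x ∈ TN := (Submodule.Quotient.mk_eq_zero TN).1 hy
      obtain ⟨z, hz, hzx⟩ := (hT.symm ▸ hfx : f x ∈ TM.map f)
      refine ⟨⟨x - z, ?_⟩, Subtype.ext ?_⟩
      · rw [LinearMap.mem_ker, map_sub, hzx, sub_self]
      · change TM.mkQ (x - z) = TM.mkQ x
        rw [map_sub, sub_eq_self, ← LinearMap.mem_ker, Submodule.ker_mkQ]
        exact hz

/-- A nonzero summand `N` maps nontrivially to `Ψ i`, since it embeds in `M`, and such a map is onto
because `N` inherits generation by `P i`. Its kernel is a summand of the shorter filtered module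
`ker (f ∘ r)`. -/
theorem isFiltered_retract_singleton (h : ProjSystem Ψ P) {i : κ} (hM : IsFiltered Ψ {i} M)
    (s : N →ₗ[A] M) (r : M →ₗ[A] N) (hrs : r ∘ₗ s = LinearMap.id) : IsFiltered Ψ {i} N := by
  induction hl : Module.length A M using WellFoundedLT.induction generalizing M N with
  | ind l ih =>
    subst hl
    have hrs' : ∀ x, r (s x) = x := LinearMap.congr_fun hrs
    have hr : Function.Surjective r := fun x => ⟨s x, hrs' x⟩
    rcases subsingleton_or_nontrivial N with h0 | h0
    · exact .zero
    · have hs : s ≠ 0 := by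
        rintro rfl
        obtain ⟨x, hx⟩ := exists_ne (0 : N)
        exact hx (by simpa using (hrs' x).symm)
      obtain ⟨f, hf⟩ : ∃ f : N →ₗ[A] Ψ i, f ≠ 0 := by
        by_contra! hc
        refine hs (hM.hom_to_eq_zero (fun j hj g => ?_) s)
        obtain rfl : j = i := hj
        exact hc g
      have hN : traceOn P {i} N = ⊤ := by
        rw [← map_traceOn_eq h.projective r hr, h.traceOn_eq_top hM, Submodule.map_top,
          LinearMap.range_eq_top.2 hr]
      have hfs := h.surjective_of_traceOn_eq_top hN hf
      have := h.finite_of_isFiltered hM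
      refine .step i rfl f hfs (ih _ (Submodule.length_lt (N := LinearMap.ker (f ∘ₗ r)) ?_)
        (h.isFiltered_ker_singleton hM (f ∘ₗ r) (hfs.comp hr))
        (s.restrict fun x hx => ?_) (r.restrict fun x hx => hx) ?_ rfl)
      · intro h0
        apply hf
        ext x
        have : s x ∈ LinearMap.ker (f ∘ₗ r) := h0 ▸ Submodule.mem_top
        simpa [hrs'] using this
      · rw [LinearMap.mem_ker, LinearMap.comp_apply, hrs']
        exact hx
      · ext x
        exact hrs' x

/-- Traces are functorial, so a retraction restricts to the trace layer of the largest index and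
descends to the quotient. -/
theorem isFiltered_retract_finset (h : ProjSystem Ψ P) (t : Finset κ) :
    ∀ {M N : Type u} [AddCommGroup M] [Module A M] [AddCommGroup N] [Module A N],
    IsFiltered Ψ ↑t M → ∀ (s : N →ₗ[A] M) (r : M →ₗ[A] N), r ∘ₗ s = LinearMap.id →
      IsFiltered Ψ ↑t N := by
  induction t using Finset.induction_on_max with
  | empty =>
    intro M N _ _ _ _ hM s r hrs
    cases hM with
    | zero =>
      have : Subsingleton N :=
        Function.Injective.subsingleton (LinearMap.injective_of_comp_eq_id s r hrs)
      exact .zero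
    | step j hj => simp at hj
  | insert a t ha ih =>
    intro M N _ _ _ _ hM s r hrs
    have hrs' : ∀ x, r (s x) = x := LinearMap.congr_fun hrs
    obtain ⟨hM1, hM2⟩ := h.isFiltered_traceOn_insert ha hM
    have k1 := h.isFiltered_retract_singleton hM1
      (s.restrict (p := traceOn P (Set.Ici a) N) fun x hx => map_mem_traceOn s hx)
      (r.restrict fun x hx => map_mem_traceOn r hx) (by
        ext x
        exact hrs' x)
    have k2 := ih hM2
      ((traceOn P (Set.Ici a) N).mapQ _ s fun x hx => map_mem_traceOn s hx)
      ((traceOn P (Set.Ici a) M).mapQ _ r fun x hx => map_mem_traceOn r hx) (by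
        ext x
        simp [hrs'])
    exact .of_submodule _ (k1.mono (by simp)) (k2.mono (by simp))

/-- The modules filtered by the proper standard modules form a resolving class. -/
theorem isResolving (h : ProjSystem Ψ P) : IsResolving (Filt (properStandard P)) where
  finite M hM := h.finite_of_isFiltered (h.filt_properStandard_iff.1 hM)
  extensions S hS h1 h3 := by
    rw [h.filt_properStandard_iff] at *
    exact h3.of_exact S.f.hom S.g.hom hS.moduleCat_injective_f
      ((ShortComplex.ShortExact.moduleCat_exact_iff_function_exact S).1 hS.exact)
      hS.moduleCat_surjective_g h1
  kernels S hS h2 h3 := by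
    rw [h.filt_properStandard_iff] at *
    have hex := (ShortComplex.ShortExact.moduleCat_exact_iff_function_exact S).1 hS.exact
    rw [← Finset.coe_univ] at *
    refine (h.isFiltered_ker_of_finset Finset.univ h2 h3 S.g.hom
      hS.moduleCat_surjective_g).of_equiv (LinearEquiv.ofBijective
        (S.f.hom.codRestrict _ fun x => hex.apply_apply_eq_zero x) ⟨?_, ?_⟩)
    · intro x y hxy
      exact hS.moduleCat_injective_f (congrArg Subtype.val hxy)
    · rintro ⟨y, hy⟩
      obtain ⟨x, rfl⟩ := (hex y).1 hy
      exact ⟨x, rfl⟩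
  projectives M hM1 hM2 := by
    rw [h.filt_properStandard_iff]
    exact isFiltered_of_projective h.total.some h.indec
      fun i => (h.isFiltered_P i).mono (Set.subset_univ _)

theorem isStableUnderRetracts (h : ProjSystem Ψ P) :
    (Filt (properStandard P)).IsStableUnderRetracts where
  of_retract {X Y} R hY := by
    rw [h.filt_properStandard_iff, ← Finset.coe_univ] at *
    refine h.isFiltered_retract_finset Finset.univ hY R.i.hom R.r.hom ?_
    rw [← ModuleCat.hom_comp, R.retract, ModuleCat.hom_id]

end Resolving

end ProjSystem


/-! ### Basic rings and complete families of indecomposable projectives -/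

section Representatives

variable {A : Type u} [Ring A] {κ : Type} [Fintype κ] {P : κ → ModuleCat.{u} A}

theorem isBasic_of_equiv (e : A ≃ₗ[A] ∀ i, P i) (hP : IsRepresentativeSet P) : IsBasic A := by
  let ε := Fintype.equivFin κ
  refine ⟨Fintype.card κ, fun k => P (ε.symm k), fun k => hP.indecomposable _, fun k l hkl =>
    hP.not_iso _ _ fun h => hkl (ε.symm.injective h), ⟨e ≪≫ₗ ?_⟩⟩
  exact (LinearEquiv.piCongrLeft A (fun i => P i) ε.symm).symm

variable [IsArtinianRing A]

theorem isRepresentativeSet_of_equiv (e : A ≃ₗ[A] ∀ i, P i) (hf : ∀ i, Module.Finite A (P i))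
    (hp : ∀ i, Module.Projective A (P i)) (hi : ∀ i, IsIndec A (P i))
    (hn : ∀ i j, i ≠ j → IsEmpty (P i ≃ₗ[A] P j)) : IsRepresentativeSet P where
  finite := hf
  projective := hp
  indecomposable i := indecomposable_iff.2 (hi i)
  not_iso := hn
  exists_iso _ _ _ hM := exists_equiv_of_projective e hi (indecomposable_iff.1 hM)

end Representatives

/-! ### The rank of the Grothendieck group -/

section Grothendieck

variable {A : Type u} [Ring A] {κ : Type} {P : κ → ModuleCat.{u} A}
  {Q M N L : Type u} [AddCommGroup Q] [Module A Q] [AddCommGroup M] [Module A M]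
  [AddCommGroup N] [Module A N] [AddCommGroup L] [Module A L]

/-- Composition with `g`, as a map of right `End(Q)`-modules. -/
def postcomp (Q : Type u) [AddCommGroup Q] [Module A Q] (g : M →ₗ[A] N) :
    (Q →ₗ[A] M) →ₗ[(Module.End A Q)ᵈᵐᵃ] (Q →ₗ[A] N) where
  toFun f := g ∘ₗ f
  map_add' _ _ := LinearMap.comp_add _ _ _
  map_smul' _ _ := rfl

/-- The length of `Hom(Q, M)` as a right `End(Q)`-module. -/
def homLength (Q M : Type u) [AddCommGroup Q] [Module A Q] [AddCommGroup M] [Module A M] : ℕ∞ :=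
  Module.length (Module.End A Q)ᵈᵐᵃ (Q →ₗ[A] M)

theorem homLength_eq_add [Module.Projective A Q] (f : M →ₗ[A] N) (g : N →ₗ[A] L)
    (hf : Function.Injective f) (hfg : Function.Exact f g) (hg : Function.Surjective g) :
    homLength (A := A) Q N = homLength (A := A) Q M + homLength (A := A) Q L := by
  refine Module.length_eq_add_of_exact (postcomp Q f) (postcomp Q g) ?_ ?_ ?_
  · intro a b hab
    ext x
    exact hf (LinearMap.congr_fun hab x)
  · intro a
    obtain ⟨b, hb⟩ := Module.projective_lifting_property g a hg
    exact ⟨b, hb⟩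
  · intro b
    constructor
    · intro hb
      have hb' : ∀ x, ∃ y, f y = b x := fun x => (hfg (b x)).1 (LinearMap.congr_fun hb x)
      refine ⟨(LinearEquiv.ofInjective f hf).symm.toLinearMap ∘ₗ
        b.codRestrict (LinearMap.range f) hb', ?_⟩
      ext x
      exact congrArg Subtype.val
        ((LinearEquiv.ofInjective f hf).apply_symm_apply ⟨b x, hb' x⟩)
    · rintro ⟨a, rfl⟩
      ext x
      exact hfg.apply_apply_eq_zero (a x)

/-- Any nonzero `g : Q → M` is onto, so by projectivity every map factors through it: a nonzero
element generates `Hom(Q, M)` over `End(Q)`. -/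
theorem homLength_simple [Module.Projective A Q] [IsSimpleModule A M] (f : Q →ₗ[A] M)
    (hf : f ≠ 0) : homLength (A := A) Q M = 1 := by
  rw [homLength, Module.length_eq_one_iff, isSimpleModule_iff_toSpanSingleton_surjective]
  refine ⟨⟨f, 0, hf⟩, fun g hg k => ?_⟩
  obtain ⟨c, hc⟩ := Module.projective_lifting_property g k (LinearMap.surjective_of_ne_zero hg)
  exact ⟨DomMulAct.mk c, hc⟩

theorem homLength_eq_zero (h : ∀ f : Q →ₗ[A] M, f = 0) : homLength (A := A) Q M = 0 := by
  rw [homLength, Module.length_eq_zero_iff]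
  exact ⟨fun f g => by rw [h f, h g]⟩

theorem homLength_ne_top [Module.Projective A Q] (hM : IsFiniteLength A M) :
    homLength (A := A) Q M ≠ ⊤ := by
  induction hM with
  | of_subsingleton =>
    rw [homLength_eq_zero fun f => LinearMap.ext fun _ => Subsingleton.elim _ _]
    exact ENat.zero_ne_top
  | @of_simple_quotient M _ _ N _ _ ih =>
    rw [homLength_eq_add N.subtype N.mkQ N.injective_subtype (LinearMap.exact_subtype_mkQ N)
      N.mkQ_surjective]
    refine WithTop.add_ne_top.2 ⟨ih, ?_⟩
    by_cases h : ∀ f : Q →ₗ[A] M ⧸ N, f = 0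
    · rw [homLength_eq_zero h]
      exact ENat.zero_ne_top
    · push Not at h
      obtain ⟨f, hf⟩ := h
      rw [homLength_simple f hf]
      exact ENat.one_ne_top

/-- The class of a module in the Grothendieck group. -/
def K0.of (M : FG A) : K0 A := QuotientAddGroup.mk (FreeAbelianGroup.of M)

theorem K0.of_eq_add (X Y Z : FG A) (f : X.1 →ₗ[A] Y.1) (g : Y.1 →ₗ[A] Z.1)
    (hf : Function.Injective f) (hfg : Function.Exact f g) (hg : Function.Surjective g) :
    K0.of Y = K0.of X + K0.of Z := by
  rw [← sub_eq_zero, ← sub_sub]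
  exact (QuotientAddGroup.eq_zero_iff (N := K0Relations A)
    (FreeAbelianGroup.of Y - FreeAbelianGroup.of X - FreeAbelianGroup.of Z)).2
    (AddSubgroup.subset_closure ⟨X, Y, Z, f, g, hf, hfg, hg, rfl⟩)

variable [IsArtinianRing A]

theorem isFiniteLength_of_finite [Module.Finite A M] : IsFiniteLength A M :=
  isFiniteLength_iff_isNoetherian_isArtinian.2 ⟨inferInstance, inferInstance⟩

/-- The additive function `M ↦ length Hom(Q, M)` on the Grothendieck group. -/
def K0.homLength (Q : Type u) [AddCommGroup Q] [Module A Q] [Module.Projective A Q] : K0 A →+ ℤ :=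
  QuotientAddGroup.lift (K0Relations A)
    (FreeAbelianGroup.lift fun X : FG A => ((Costrat.homLength (A := A) Q X.1).toNat : ℤ)) (by
      refine (AddSubgroup.closure_le _).2 ?_
      rintro _ ⟨X, Y, Z, f, g, hf, hfg, hg, rfl⟩
      have := X.2
      have := Z.2
      simp only [SetLike.mem_coe, AddMonoidHom.mem_ker, map_sub, FreeAbelianGroup.lift_apply_of]
      rw [homLength_eq_add f g hf hfg hg, ENat.toNat_add
        (homLength_ne_top isFiniteLength_of_finite) (homLength_ne_top isFiniteLength_of_finite)]
      push_cast
      ring)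

theorem K0.homLength_of (Q : Type u) [AddCommGroup Q] [Module A Q] [Module.Projective A Q]
    (X : FG A) : K0.homLength Q (K0.of X) = ((Costrat.homLength (A := A) Q X.1).toNat : ℤ) := by
  change FreeAbelianGroup.lift _ (FreeAbelianGroup.of X) = _
  rw [FreeAbelianGroup.lift_apply_of]

theorem isCoatom_jacobson [Module.Projective A M] [Module.Finite A M] (h : IsIndec A M) :
    IsCoatom (Module.jacobson A M) := by
  have := h.nontrivial
  refine ⟨(Module.jacobson_lt_top A M).ne, fun V hV => ?_⟩
  by_contra h0
  exact absurd (h.le_jacobson h0) (not_le_of_gt hV)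

/-- The simple top of an indecomposable projective module. -/
def simpleTop (P : κ → ModuleCat.{u} A) (hP : IsRepresentativeSet P) (i : κ) : FG A :=
  ⟨ModuleCat.of A (P i ⧸ Module.jacobson A (P i)), by
    have := hP.finite i
    change Module.Finite A (P i ⧸ Module.jacobson A (P i))
    infer_instance⟩

theorem isSimpleModule_simpleTop (hP : IsRepresentativeSet P) (i : κ) :
    IsSimpleModule A (simpleTop P hP i).1 := by
  have := hP.finite i
  have := hP.projective i
  exact isSimpleModule_iff_isCoatom.2
    (isCoatom_jacobson (indecomposable_iff.1 (hP.indecomposable i)))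

/-- Some `P i` maps nontrivially, hence onto, to a simple module. The kernel is maximal, so it
contains the radical, and it is contained in the radical because it is proper. -/
theorem exists_equiv_simpleTop [Fintype κ] (hP : IsRepresentativeSet P) (e : A ≃ₗ[A] ∀ i, P i)
    [IsSimpleModule A M] : ∃ i, Nonempty (M ≃ₗ[A] (simpleTop P hP i).1) := by
  classical
  have := IsSimpleModule.nontrivial A M
  obtain ⟨x, hx⟩ := exists_ne (0 : M)
  obtain ⟨i, f, hf⟩ : ∃ (i : κ) (f : P i →ₗ[A] M), f ≠ 0 := by
    by_contra! hc
    apply hx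
    have h1 : ∀ y, (LinearMap.toSpanSingleton A M x ∘ₗ e.symm.toLinearMap) y = 0 := by
      intro y
      rw [← Finset.univ_sum_single y, map_sum]
      exact Finset.sum_eq_zero fun i _ => LinearMap.congr_fun (hc i
        (LinearMap.toSpanSingleton A M x ∘ₗ e.symm.toLinearMap ∘ₗ
          LinearMap.single A (fun i => P i) i)) (y i)
    simpa using h1 (e 1)
  have hs := LinearMap.surjective_of_ne_zero hf
  have := hP.finite i
  have := hP.projective i
  have hi := indecomposable_iff.1 (hP.indecomposable i)
  have hk : LinearMap.ker f = Module.jacobson A (P i) := by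
    have h0 : LinearMap.ker f ≠ ⊤ := fun h => hf (LinearMap.ker_eq_top.1 h)
    have : IsSimpleModule A (P i ⧸ LinearMap.ker f) :=
      IsSimpleModule.congr (f.quotKerEquivOfSurjective hs)
    have hc : IsCoatom (LinearMap.ker f) := isSimpleModule_iff_isCoatom.1 this
    refine le_antisymm (hi.le_jacobson h0) (sInf_le hc)
  exact ⟨i, ⟨(f.quotKerEquivOfSurjective hs).symm ≪≫ₗ Submodule.quotEquivOfEq _ _ hk⟩⟩

/-- A nonzero map lifts to `P i → P j` whose image is not in the radical, hence is everything. This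
epimorphism splits, and indecomposability of `P i` makes it an isomorphism. -/
theorem hom_simpleTop_eq_zero (hP : IsRepresentativeSet P) {i j : κ} (hij : i ≠ j)
    (f : P i →ₗ[A] (simpleTop P hP j).1) : f = 0 := by
  by_contra hf
  have := isSimpleModule_simpleTop hP j
  have hs := LinearMap.surjective_of_ne_zero hf
  have := hP.finite i
  have := hP.projective i
  have := hP.finite j
  have := hP.projective j
  have hi := indecomposable_iff.1 (hP.indecomposable i)
  have hj := indecomposable_iff.1 (hP.indecomposable j)
  let q : P j →ₗ[A] (simpleTop P hP j).1 := (Module.jacobson A (P j)).mkQ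
  have hq : Function.Surjective q := Submodule.mkQ_surjective _
  obtain ⟨g, hg⟩ := Module.projective_lifting_property q f hq
  have hgs : LinearMap.range g = ⊤ := by
    by_contra h0
    have := hj.le_jacobson h0
    apply hf
    rw [← hg]
    ext x
    exact (Submodule.Quotient.mk_eq_zero _).2 (this ⟨x, rfl⟩)
  obtain ⟨s, hs⟩ := Module.projective_lifting_property g LinearMap.id
    (LinearMap.range_eq_top.1 hgs)
  have := hj.nontrivial
  obtain ⟨ε⟩ := hi.nonempty_equiv_of_isUnit s g (by rw [hs]; exact isUnit_one)
  exact (hP.not_iso i j hij).false ε.symm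

/-- Dévissage along a composition series. -/
theorem K0.of_mem_span [Fintype κ] (hP : IsRepresentativeSet P) (e : A ≃ₗ[A] ∀ i, P i)
    (hM : IsFiniteLength A M) (hM' : Module.Finite A M) :
    K0.of ⟨ModuleCat.of A M, hM'⟩ ∈
      Submodule.span ℤ (Set.range fun i => K0.of (simpleTop P hP i)) := by
  induction hM with
  | @of_subsingleton M =>
    have h0 : K0.of ⟨ModuleCat.of A M, hM'⟩ = 0 := by
      have := K0.of_eq_add ⟨ModuleCat.of A M, hM'⟩ ⟨ModuleCat.of A M, hM'⟩
        ⟨ModuleCat.of A M, hM'⟩ 0 0 (Function.injective_of_subsingleton _)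
        (fun x => ⟨fun _ => ⟨0, Subsingleton.elim _ _⟩, fun _ => Subsingleton.elim _ _⟩)
        (fun x => ⟨0, Subsingleton.elim _ _⟩)
      simpa using this
    rw [h0]
    exact zero_mem _
  | @of_simple_quotient M _ _ N _ _ ih =>
    obtain ⟨i, ⟨ε⟩⟩ := exists_equiv_simpleTop (M := M ⧸ N) hP e
    have hN : Module.Finite A N := inferInstance
    rw [K0.of_eq_add ⟨ModuleCat.of A N, hN⟩ ⟨ModuleCat.of A M, hM'⟩ (simpleTop P hP i)
      N.subtype (ε.toLinearMap ∘ₗ N.mkQ) N.injective_subtype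
      (LinearMap.exact_iff.2 (by rw [LinearEquiv.ker_comp, Submodule.ker_mkQ]; simp))
      (ε.surjective.comp N.mkQ_surjective)]
    exact add_mem (ih hN) (Submodule.subset_span ⟨i, rfl⟩)

/-- The additive functions given by the lengths of `Hom(P i, -)` are dual to the classes of the
simple tops, which makes these classes independent; they span by dévissage. -/
theorem rank_K0 [Fintype κ] (hP : IsRepresentativeSet P) (e : A ≃ₗ[A] ∀ i, P i) :
    Module.rank ℤ (K0 A) = (Fintype.card κ : Cardinal) := by
  classical
  have hd : ∀ i j, (have := hP.projective i; K0.homLength (P i) (K0.of (simpleTop P hP j))) =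
      if i = j then 1 else 0 := by
    intro i j
    have := hP.projective i
    rw [K0.homLength_of]
    split_ifs with hij
    · subst hij
      have := isSimpleModule_simpleTop hP i
      let q : P i →ₗ[A] (simpleTop P hP i).1 := (Module.jacobson A (P i)).mkQ
      have hq : Function.Surjective q := Submodule.mkQ_surjective _
      have := IsSimpleModule.nontrivial A (simpleTop P hP i).1
      rw [homLength_simple q]
      · rfl
      · intro h0
        obtain ⟨y, hy⟩ := exists_ne (0 : (simpleTop P hP i).1)
        obtain ⟨x, rfl⟩ := hq y
        exact hy (by rw [h0]; rfl)
    · rw [homLength_eq_zero (hom_simpleTop_eq_zero hP hij)]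
      rfl
  have hli : LinearIndependent ℤ fun i => K0.of (simpleTop P hP i) := by
    rw [Fintype.linearIndependent_iff]
    intro c hc i
    have := hP.projective i
    have h1 := congrArg (K0.homLength (P i)) hc
    rw [map_sum, map_zero] at h1
    simp only [map_zsmul] at h1
    rw [Finset.sum_congr rfl fun j _ => by rw [show K0.homLength (P i) _ = _ from hd i j]] at h1
    simpa using h1
  have hsp : ⊤ ≤ Submodule.span ℤ (Set.range fun i => K0.of (simpleTop P hP i)) := by
    rintro x -
    obtain ⟨x, rfl⟩ := QuotientAddGroup.mk_surjective x
    induction x using FreeAbelianGroup.induction_on with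
    | zero => exact zero_mem _
    | of X =>
      have := X.2
      exact K0.of_mem_span hP e isFiniteLength_of_finite X.2
    | neg X hX => exact neg_mem hX
    | add x y hx hy => exact add_mem hx hy
  exact rank_eq_card_basis (Module.Basis.mk hli hsp)

end Grothendieck

/-! ### The projectives form a representative set -/

namespace ProjSystem

variable {A : Type u} [Ring A] {κ : Type} [Fintype κ] [LinearOrder κ]
  {Ψ P : κ → ModuleCat.{u} A}

/-- An isomorphism would turn the nonzero map `β i` into a nonzero map `P j → Ψ i`. -/
theorem not_iso_of_lt (h : ProjSystem Ψ P) {i j : κ} (hij : i < j) : IsEmpty (P i ≃ₗ[A] P j) := by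
  refine ⟨fun e => h.β_ne_zero i ?_⟩
  have h0 := h.hom_P_eq_zero hij (h.β i ∘ₗ e.symm.toLinearMap)
  ext x
  simpa using LinearMap.congr_fun h0 (e x)

theorem not_iso (h : ProjSystem Ψ P) {i j : κ} (hij : i ≠ j) : IsEmpty (P i ≃ₗ[A] P j) := by
  rcases lt_or_gt_of_ne hij with h1 | h1
  · exact h.not_iso_of_lt h1
  · exact ⟨fun e => (h.not_iso_of_lt h1).false e.symm⟩

theorem isRepresentativeSet [IsArtinianRing A] (h : ProjSystem Ψ P) : IsRepresentativeSet P :=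
  isRepresentativeSet_of_equiv h.total.some h.finite h.projective h.indec fun _ _ => h.not_iso

end ProjSystem


/-! ### Finiteness over artin algebras -/

section Finiteness

theorem finite_hom_restrictScalars (R : Type w) [CommRing R] [IsArtinianRing R] {A : Type u}
    [Ring A] [Algebra R A] [Module.Finite R A] (X Y : Type u) [AddCommGroup X] [Module A X]
    [AddCommGroup Y] [Module A Y] [Module.Finite A X] [Module.Finite A Y] [Module R Y]
    [IsScalarTower R A Y] [SMulCommClass A R Y] : Module.Finite R (X →ₗ[A] Y) := by
  have : Module.Finite R Y := .trans A Y
  obtain ⟨n, p, hp⟩ := Module.Finite.exists_fin (R := A) (M := X)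
  let ev : (X →ₗ[A] Y) →ₗ[R] (Fin n → Y) :=
    { toFun := fun f k => f (p k)
      map_add' := fun _ _ => rfl
      map_smul' := fun _ _ => rfl }
  exact .of_injective ev fun f g hfg => LinearMap.ext_on_range hp fun k => congrFun hfg k

/-- Over an artin algebra, `Hom(X, Y)` is finitely generated over `End(Y)`. -/
theorem finite_hom (R : Type w) [CommRing R] [IsArtinianRing R] {A : Type u} [Ring A]
    [Algebra R A] [Module.Finite R A]
    (X Y : Type u) [AddCommGroup X] [Module A X] [AddCommGroup Y] [Module A Y]
    [Module.Finite A X] [Module.Finite A Y] : Module.Finite (Module.End A Y) (X →ₗ[A] Y) := by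
  let _ : Module R Y := Module.compHom Y (algebraMap R A)
  have hst : IsScalarTower R A Y := ⟨fun r a y => by
    rw [Algebra.smul_def, mul_smul]
    rfl⟩
  have : SMulCommClass A R Y := IsScalarTower.to_smulCommClass'
  have := finite_hom_restrictScalars R (A := A) X Y
  have : IsScalarTower R (Module.End A Y) (X →ₗ[A] Y) := ⟨fun r d f => rfl⟩
  exact .of_restrictScalars_finite R _ _

theorem isArtinianRing_mulOpposite (R : Type w) [CommRing R] [IsArtinianRing R] {A : Type u} [Ring A]
    [Algebra R A] [Module.Finite R A] :
    IsArtinianRing Aᵐᵒᵖ := by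
  have : Module.Finite R Aᵐᵒᵖ := .equiv (MulOpposite.opLinearEquiv R)
  exact IsArtinianRing.of_finite R Aᵐᵒᵖ

end Finiteness

/-! ### Duality of finitely generated projectives -/

section Dual

variable {A : Type u} [Ring A] {P P' : Type u} [AddCommGroup P] [Module A P] [AddCommGroup P']
  [Module A P']

theorem exists_dual_basis (P : Type u) [AddCommGroup P] [Module A P] [Module.Finite A P]
    [Module.Projective A P] : ∃ (n : ℕ) (p : Fin n → P) (x : Fin n → (P →ₗ[A] A)),
      ∀ q, ∑ k, x k q • p k = q := by
  obtain ⟨n, r, s, -, -, hrs⟩ := Module.Finite.exists_comp_eq_id_of_projective A P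
  refine ⟨n, fun k => r (Pi.single k 1), fun k => LinearMap.proj k ∘ₗ s, fun q => ?_⟩
  simp_rw [← map_smul, ← map_sum]
  have : ∑ k, s q k • (Pi.single k 1 : Fin n → A) = s q := by
    ext l
    simp [Finset.sum_apply, Pi.single_apply]
  exact (congrArg r this).trans (LinearMap.congr_fun hrs q)

/-- The transpose of `f`. -/
def transpose (f : P →ₗ[A] P') : (P' →ₗ[A] A) →ₗ[Aᵐᵒᵖ] (P →ₗ[A] A) where
  toFun g := g ∘ₗ f
  map_add' _ _ := LinearMap.add_comp _ _ _
  map_smul' _ _ := rfl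

/-- A dual basis `(p k, x k)` of `P'` shows that `φ` is determined by the forms `φ (x k)`, and `∑ k,
φ (x k) (·) • p k` is the map with transpose `φ`. -/
theorem exists_transpose_eq [Module.Finite A P'] [Module.Projective A P']
    (φ : (P' →ₗ[A] A) →ₗ[Aᵐᵒᵖ] (P →ₗ[A] A)) : ∃ f : P →ₗ[A] P', transpose f = φ := by
  obtain ⟨n, p, x, hx⟩ := exists_dual_basis (A := A) P'
  refine ⟨∑ k, (φ (x k)).smulRight (p k), ?_⟩
  ext g q
  have hg : g = ∑ k, MulOpposite.op (g (p k)) • x k := by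
    ext q
    conv_lhs => rw [← hx q]
    simp
  conv_rhs => rw [hg, map_sum]
  simp [transpose]

theorem transpose_injective [Module.Finite A P'] [Module.Projective A P'] :
    Function.Injective (transpose : (P →ₗ[A] P') → _) := by
  intro f f' hff
  obtain ⟨n, p, x, hx⟩ := exists_dual_basis (A := A) P'
  ext q
  rw [← hx (f q), ← hx (f' q)]
  refine Finset.sum_congr rfl fun k _ => ?_
  have : x k (f q) = x k (f' q) := LinearMap.congr_fun (LinearMap.congr_fun hff (x k)) q
  rw [this]

theorem exists_dual_retract (P : Type u) [AddCommGroup P] [Module A P] [Module.Finite A P]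
    [Module.Projective A P] : ∃ (n : ℕ) (s : (P →ₗ[A] A) →ₗ[Aᵐᵒᵖ] (Fin n → Aᵐᵒᵖ))
      (r : (Fin n → Aᵐᵒᵖ) →ₗ[Aᵐᵒᵖ] (P →ₗ[A] A)), r ∘ₗ s = LinearMap.id := by
  obtain ⟨n, p, x, hx⟩ := exists_dual_basis (A := A) P
  refine ⟨n, { toFun := fun g k => MulOpposite.op (g (p k)), map_add' := fun _ _ => rfl,
               map_smul' := fun _ _ => rfl },
    { toFun := fun c => ∑ k, c k • x k
      map_add' := fun c d => by simp [add_smul, Finset.sum_add_distrib]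
      map_smul' := fun c d => by simp [mul_smul, Finset.smul_sum] }, ?_⟩
  ext g q
  conv_rhs => rw [LinearMap.id_apply, ← hx q]
  simp

theorem finite_dual (P : Type u) [AddCommGroup P] [Module A P] [Module.Finite A P]
    [Module.Projective A P] : Module.Finite Aᵐᵒᵖ (P →ₗ[A] A) := by
  obtain ⟨n, s, r, hrs⟩ := exists_dual_retract (A := A) P
  exact .of_surjective r fun x => ⟨s x, LinearMap.congr_fun hrs x⟩

theorem projective_dual (P : Type u) [AddCommGroup P] [Module A P] [Module.Finite A P]
    [Module.Projective A P] : Module.Projective Aᵐᵒᵖ (P →ₗ[A] A) := by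
  obtain ⟨n, s, r, hrs⟩ := exists_dual_retract (A := A) P
  exact .of_split s r hrs

theorem isIndec_dual [Module.Finite A P] [Module.Projective A P] (h : IsIndec A P) :
    IsIndec Aᵐᵒᵖ (P →ₗ[A] A) := by
  constructor
  · by_contra hn
    rw [not_nontrivial_iff_subsingleton] at hn
    have : (LinearMap.id : P →ₗ[A] P) = 0 :=
      transpose_injective (LinearMap.ext fun _ => Subsingleton.elim _ _)
    have hnt := h.nontrivial
    obtain ⟨x, hx⟩ := exists_ne (0 : P)
    exact hx (LinearMap.congr_fun this x)
  · intro φ hφ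
    obtain ⟨f, rfl⟩ := exists_transpose_eq φ
    rcases h.idempotent f (transpose_injective hφ) with rfl | rfl
    · exact .inl (LinearMap.ext fun g => LinearMap.comp_zero g)
    · exact .inr rfl

theorem nonempty_equiv_of_dual [Module.Finite A P] [Module.Projective A P] [Module.Finite A P']
    [Module.Projective A P'] (e : (P →ₗ[A] A) ≃ₗ[Aᵐᵒᵖ] (P' →ₗ[A] A)) :
    Nonempty (P ≃ₗ[A] P') := by
  obtain ⟨f, hf⟩ := exists_transpose_eq e.toLinearMap
  obtain ⟨g, hg⟩ := exists_transpose_eq e.symm.toLinearMap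
  refine ⟨LinearEquiv.ofLinearMap g f (transpose_injective ?_) (transpose_injective ?_)⟩
  · change transpose f ∘ₗ transpose g = LinearMap.id
    rw [hf, hg]
    ext x
    simp
  · change transpose g ∘ₗ transpose f = LinearMap.id
    rw [hf, hg]
    ext x
    simp

theorem nonempty_equiv_pi_dual {κ : Type} [Fintype κ] {P : κ → ModuleCat.{u} A}
    (e : A ≃ₗ[A] ∀ i, P i) : Nonempty (Aᵐᵒᵖ ≃ₗ[Aᵐᵒᵖ] ∀ i, dual (P i)) := by
  classical
  let v : ∀ i, P i →ₗ[A] A := fun i => e.symm.toLinearMap ∘ₗ LinearMap.single A (fun i => P i) i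
  let φ : Aᵐᵒᵖ →ₗ[Aᵐᵒᵖ] ∀ i, (P i →ₗ[A] A) :=
    LinearMap.pi fun i => LinearMap.toSpanSingleton Aᵐᵒᵖ (P i →ₗ[A] A) (v i)
  have hφ : ∀ c i x, φ c i x = v i x * c.unop := fun c i x => rfl
  have h1 : ∑ i, v i (e 1 i) = 1 := by
    change ∑ i, e.symm (Pi.single i (e 1 i)) = 1
    rw [← map_sum, Finset.univ_sum_single, LinearEquiv.symm_apply_apply]
  refine ⟨LinearEquiv.ofBijective φ ⟨fun c d hcd => ?_, fun g => ?_⟩⟩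
  · apply MulOpposite.unop_injective
    rw [← one_mul c.unop, ← one_mul d.unop, ← h1, Finset.sum_mul, Finset.sum_mul]
    refine Finset.sum_congr rfl fun i _ => ?_
    rw [← hφ, ← hφ, hcd]
  · let g' : ∀ i, P i →ₗ[A] A := g
    -- Assembling `g` into a single form on `A`: such a form is right multiplication by its value at
    -- `1`, which gives the preimage.
    let G : A →ₗ[A] A := ∑ i, g' i ∘ₗ LinearMap.proj i ∘ₗ e.toLinearMap
    refine ⟨MulOpposite.op (G 1), funext fun i => LinearMap.ext fun x => ?_⟩
    rw [hφ, MulOpposite.unop_op, ← smul_eq_mul, ← map_smul, smul_eq_mul, mul_one]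
    change _ = g' i x
    simp only [G, v, LinearMap.sum_apply, LinearMap.comp_apply, LinearEquiv.coe_coe,
      LinearEquiv.apply_symm_apply, LinearMap.proj_apply, LinearMap.single_apply]
    rw [Finset.sum_eq_single i]
    · simp
    · intro j _ hj
      simp [Pi.single_eq_of_ne hj]
    · simp

end Dual


/-! ### Forms with values in trace ideals and the stratification of the opposite algebra -/

/-- Two epimorphisms with the same kernel have isomorphic targets. -/
theorem nonempty_equiv_of_ker_eq {A : Type*} [Ring A] {M N L : Type*} [AddCommGroup M] [Module A M]
    [AddCommGroup N] [Module A N] [AddCommGroup L] [Module A L] (f : M →ₗ[A] N) (g : M →ₗ[A] L)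
    (hf : Function.Surjective f) (hg : Function.Surjective g)
    (h : LinearMap.ker f = LinearMap.ker g) : Nonempty (N ≃ₗ[A] L) :=
  ⟨(f.quotKerEquivOfSurjective hf).symm ≪≫ₗ Submodule.quotEquivOfEq _ _ h ≪≫ₗ
    g.quotKerEquivOfSurjective hg⟩

/-- `V ⧸ U` and `F` are quotients of `E` by the same kernel, hence isomorphic, so `V` is an
extension of `F` by `U`. -/
theorem IsFiltered.of_layer {B : Type u} [Ring B] {ι : Type w} {C : ι → ModuleCat.{u} B}
    {s : Set ι} {D E F : Type u} [AddCommGroup D] [Module B D] [AddCommGroup E] [Module B E]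
    [AddCommGroup F] [Module B F] (U V : Submodule B D) (hU : IsFiltered C s U) (hUV : U ≤ V)
    (Θ : E →ₗ[B] D) (hΘ : ∀ e, Θ e ∈ V) (Ξ : E →ₗ[B] F) (hΞ : Function.Surjective Ξ)
    (hs : ∀ v ∈ V, ∃ e, v - Θ e ∈ U) (hker : ∀ e, Θ e ∈ U ↔ Ξ e = 0) (hF : IsFiltered C s F) :
    IsFiltered C s V := by
  let q : E →ₗ[B] V ⧸ U.submoduleOf V := (U.submoduleOf V).mkQ ∘ₗ Θ.codRestrict V hΘ
  obtain ⟨e⟩ := nonempty_equiv_of_ker_eq q Ξ (fun y => by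
    obtain ⟨⟨v, hv⟩, rfl⟩ := Submodule.mkQ_surjective _ y
    obtain ⟨e, he⟩ := hs v hv
    exact ⟨e, ((Submodule.Quotient.eq (U.submoduleOf V)).2 he).symm⟩) hΞ (by
    ext e
    rw [LinearMap.mem_ker, LinearMap.mem_ker, ← hker e]
    exact Submodule.Quotient.mk_eq_zero (U.submoduleOf V))
  exact .of_submodule (U.submoduleOf V) (hU.of_equiv (Submodule.submoduleOfEquivOfLe hUV))
    (hF.of_equiv e)

section DualTrace

variable {A : Type u} [Ring A] {κ : Type} {P : κ → ModuleCat.{u} A}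

/-- The forms on `X` with values in the trace ideal of the modules `P j`, `j ∈ s`. -/
def formsIn (P : κ → ModuleCat.{u} A) (s : Set κ) (X : Type u) [AddCommGroup X] [Module A X] :
    Submodule Aᵐᵒᵖ (X →ₗ[A] A) where
  carrier := {g | ∀ x, g x ∈ traceOn P s A}
  add_mem' hf hg x := add_mem (hf x) (hg x)
  zero_mem' _ := zero_mem _
  smul_mem' c _ hg x := map_mem_traceOn (LinearMap.toSpanSingleton A A c.unop) (hg x)

/-- Maps `(P j)^* → (P k)^*` are transposes, so their images take values in the trace ideal.
Conversely a dual basis writes `g` as a sum of terms `x l` scaled by elements of the ideal, and a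
term with scalar `f y` is the image of `f` under the transpose of `q ↦ x l q • y`. -/
theorem traceOn_dual (hf : ∀ i, Module.Finite A (P i)) (hp : ∀ i, Module.Projective A (P i))
    (s : Set κ) (k : κ) :
    traceOn (fun i => dual (P i)) s (P k →ₗ[A] A) = formsIn P s (P k) := by
  apply le_antisymm
  · refine traceOn_le fun j hj φ => ?_
    have := hf j
    have := hp j
    obtain ⟨f, hf⟩ := exists_transpose_eq (P := P k) (P' := P j) φ
    rintro _ ⟨g, rfl⟩ x
    rw [← hf]
    exact apply_mem_traceOn (P := P) hj g (f x)
  · intro g hg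
    have := hf k
    have := hp k
    obtain ⟨n, p, x, hx⟩ := exists_dual_basis (A := A) (P k)
    have hg' : g = ∑ l, MulOpposite.op (g (p l)) • x l := by
      ext q
      conv_lhs => rw [← hx q]
      simp
    rw [hg']
    refine sum_mem fun l _ => ?_
    refine traceOn_induction (p := fun a => MulOpposite.op a • x l ∈ _) (fun j hj f y => ?_) ?_ ?_
      (hg (p l))
    · have : MulOpposite.op (f y) • x l = transpose ((x l).smulRight y) f := by
        ext q
        simp [transpose]
      rw [this]
      exact apply_mem_traceOn (P := fun i => dual (P i)) hj (transpose ((x l).smulRight y)) f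
    · rw [MulOpposite.op_zero, zero_smul]
      exact zero_mem _
    · intro a b ha hb
      rw [MulOpposite.op_add, add_smul]
      exact add_mem ha hb

end DualTrace

namespace ProjSystem

variable {A : Type u} [Ring A] {κ : Type} [Fintype κ] [LinearOrder κ]
  {Ψ P : κ → ModuleCat.{u} A}

/-- The `v l` lift, through `β a`, a basis of `Hom(P k, Ψ a)` over the division ring `End(Ψ a)`. For
`N = Ψ a` the claim holds because `Hom(P a, Ψ a)` consists of the multiples of `β a`; projectivity
extends it along the filtration of `N`, as in the five lemma. -/
theorem exists_hom_basis (R : Type w) [CommRing R] [IsArtinianRing R] [Algebra R A]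
    [Module.Finite R A] (h : ProjSystem Ψ P) (k a : κ) :
    ∃ (n : ℕ) (v : Fin n → (P k →ₗ[A] P a)), ∀ {N : Type u} [AddCommGroup N] [Module A N],
      IsFiltered Ψ {a} N → Function.Bijective
        (fun g : Fin n → (P a →ₗ[A] N) => ∑ l, g l ∘ₗ v l) := by
  have : IsArtinianRing A := IsArtinianRing.of_finite R A
  have := h.finite k
  have := h.finite_Ψ a
  have := h.nontrivial a
  have hfin := finite_hom R (A := A) (P k) (Ψ a)
  let D : DivisionRing (Module.End A (Ψ a)) := DivisionRing.ofIsUnitOrEqZero fun f =>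
    or_iff_not_imp_right.2 fun hf => (Module.End.isUnit_iff f).2 (h.division a f hf)
  let b := Module.finBasis (Module.End A (Ψ a)) (P k →ₗ[A] Ψ a)
  choose v hv using fun l => h.exists_lift (h.β a) (h.β_surjective a) (b l)
  refine ⟨_, v, fun {N} _ _ hN => ?_⟩
  have inj_iff : ∀ {N : Type u} [AddCommGroup N] [Module A N], Function.Injective
      (fun g : Fin _ → (P a →ₗ[A] N) => ∑ l, g l ∘ₗ v l) ↔
      ∀ g : Fin _ → (P a →ₗ[A] N), ∑ l, g l ∘ₗ v l = 0 → g = 0 := by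
    intro N _ _
    constructor
    · intro hi g hg
      exact hi (hg.trans (by simp))
    · intro hi g g' hgg
      rw [← sub_eq_zero]
      apply hi
      simp only [Pi.sub_apply, LinearMap.sub_comp, Finset.sum_sub_distrib]
      exact sub_eq_zero.2 hgg
  have base : (∀ g : Fin _ → (P a →ₗ[A] Ψ a), ∑ l, g l ∘ₗ v l = 0 → g = 0) ∧
      ∀ f : P k →ₗ[A] Ψ a, ∃ g : Fin _ → (P a →ₗ[A] Ψ a), ∑ l, g l ∘ₗ v l = f := by
    constructor
    · intro g hg
      choose d hd using fun l => h.exists_eq_comp_β (g l)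
      have h0 : ∑ l, (show Module.End A (Ψ a) from d l) • b l = 0 := by
        rw [← hg]
        refine Finset.sum_congr rfl fun l _ => ?_
        rw [← hd l, ← hv l]
        rfl
      have := Fintype.linearIndependent_iff.1 b.linearIndependent _ h0
      funext l
      rw [← hd l, show d l = 0 from this l]
      rfl
    · intro f
      refine ⟨fun l => (b.repr f l : Ψ a →ₗ[A] Ψ a) ∘ₗ h.β a, ?_⟩
      conv_rhs => rw [← b.sum_repr f]
      refine Finset.sum_congr rfl fun l _ => ?_
      rw [← hv l]
      rfl
  induction hN with
  | zero =>
    refine ⟨fun g g' _ => funext fun l => LinearMap.ext fun x => Subsingleton.elim _ _,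
      fun f => ⟨0, LinearMap.ext fun x => Subsingleton.elim _ _⟩⟩
  | step j hj π hπ _ ih =>
    obtain rfl : j = a := hj
    obtain ⟨ih1, ih2⟩ := ih
    rw [inj_iff] at ih1
    constructor
    · rw [inj_iff]
      intro g hg
      have h1 := base.1 (fun l => π ∘ₗ g l) (by
        ext x
        have := congrArg π (LinearMap.congr_fun hg x)
        simpa using this)
      have h2 : ∀ l x, g l x ∈ LinearMap.ker π := fun l x =>
        LinearMap.congr_fun (congrFun h1 l) x
      have h3 := ih1 (fun l => (g l).codRestrict _ (h2 l)) (by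
        ext x
        have := LinearMap.congr_fun hg x
        simpa using this)
      funext l
      ext x
      exact congrArg Subtype.val (LinearMap.congr_fun (congrFun h3 l) x)
    · intro f
      obtain ⟨g, hg⟩ := base.2 (π ∘ₗ f)
      choose g' hg' using fun l => h.exists_lift π hπ (g l)
      have h1 : ∀ x, (f - ∑ l, g' l ∘ₗ v l) x ∈ LinearMap.ker π := by
        intro x
        have := LinearMap.congr_fun hg x
        simp only [← hg', LinearMap.sum_apply, LinearMap.comp_apply] at this
        simp [this]
      obtain ⟨g'', hg''⟩ := ih2 ((f - ∑ l, g' l ∘ₗ v l).codRestrict _ h1)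
      refine ⟨fun l => g' l + (LinearMap.ker π).subtype ∘ₗ g'' l, ?_⟩
      ext x
      have := congrArg Subtype.val (LinearMap.congr_fun hg'' x)
      simp only [LinearMap.sum_apply, LinearMap.comp_apply, LinearMap.codRestrict_apply,
        LinearMap.sub_apply, AddSubmonoidClass.coe_finsetSum] at this
      simp [Finset.sum_add_distrib, this]

theorem mem_traceOn_Ici {κ : Type} [LinearOrder κ] {P : κ → ModuleCat.{u} A} (s : Set κ) {a : κ}
    (hs : s ⊆ Set.Ici a)
    (x : traceOn P (Set.Ici a) A) :
    x ∈ traceOn P s (traceOn P (Set.Ici a) A) ↔ (x : A) ∈ traceOn P s A := by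
  constructor
  · intro hx
    exact map_mem_traceOn (traceOn P (Set.Ici a) A).subtype hx
  · intro hx
    have hle : traceOn P s A ≤ (traceOn P s (traceOn P (Set.Ici a) A)).map
        (traceOn P (Set.Ici a) A).subtype := by
      refine traceOn_le fun j hj f => ?_
      rintro _ ⟨y, rfl⟩
      exact ⟨_, apply_mem_traceOn hj
        (f.codRestrict _ fun y => apply_mem_traceOn (hs hj) f y) y, rfl⟩
    obtain ⟨y, hy, hyx⟩ := hle hx
    rwa [← Subtype.ext hyx]

theorem isFiltered_regular (h : ProjSystem Ψ P) : IsFiltered Ψ Set.univ A :=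
  (IsFiltered.pi_fintype fun i => (h.isFiltered_P i).mono (Set.subset_univ _)).of_equiv
    h.total.some

/-- The regular module is filtered; cutting it with the upper sets `Ici a` and `Ioi a` leaves only
the factor `Ψ a`. -/
theorem isFiltered_layer (h : ProjSystem Ψ P) (a : κ) :
    IsFiltered Ψ {a} (traceOn P (Set.Ici a) A ⧸
      traceOn P (Set.Ioi a) (traceOn P (Set.Ici a) A)) := by
  have h1 := (h.isFiltered_traceOn (isUpperSet_Ici a) h.isFiltered_regular).1
  have h2 := (h.isFiltered_traceOn (isUpperSet_Ioi a) h1).2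
  refine h2.mono ?_
  rintro x ⟨⟨-, hx⟩, hx'⟩
  exact le_antisymm (not_lt.1 hx') hx

/-- Modulo forms with values in the smaller ideal, forms with values in `L` become `Hom(P k, L ⧸
T)`, and the hom basis turns this into `Hom(P a, L ⧸ T)^n`. All forms on `P a` take values in `L`,
so `Hom(P a, L ⧸ T)` is `(P a)^*` modulo the forms in the smaller ideal, which is the standard
module at `a`. -/
theorem isFiltered_formsIn_Ici (R : Type w) [CommRing R] [IsArtinianRing R] [Algebra R A]
    [Module.Finite R A] (h : ProjSystem Ψ P) (k a : κ)
    (hk : IsFiltered (standard fun i => dual (P i)) Set.univ (formsIn P (Set.Ioi a) (P k))) :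
    IsFiltered (standard fun i => dual (P i)) Set.univ (formsIn P (Set.Ici a) (P k)) := by
  obtain ⟨n, v, hv⟩ := h.exists_hom_basis R k a
  set L := traceOn P (Set.Ici a) A with hL
  set T := traceOn P (Set.Ioi a) L with hT
  have hbij := hv (h.isFiltered_layer a)
  have hsub : Set.Ioi a ⊆ Set.Ici a := Set.Ioi_subset_Ici_self
  have hmem : ∀ x : L, T.mkQ x = 0 ↔ (x : A) ∈ traceOn P (Set.Ioi a) A := fun x => by
    rw [← mem_traceOn_Ici (Set.Ioi a) hsub x, ← LinearMap.mem_ker, Submodule.ker_mkQ]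
  have hle : formsIn P (Set.Ioi a) (P k) ≤ formsIn P (Set.Ici a) (P k) :=
    fun g hg x => traceOn_mono hsub (hg x)
  let Θ₀ : (Fin n → (P a →ₗ[A] A)) →ₗ[Aᵐᵒᵖ] (P k →ₗ[A] A) :=
    ∑ l, transpose (v l) ∘ₗ LinearMap.proj l
  have hΘ₀ : ∀ g x, Θ₀ g x = ∑ l, g l (v l x) := fun g x => by
    simp [Θ₀, transpose]
  have hPL : ∀ (f : P a →ₗ[A] A) x, f x ∈ L := fun f x => apply_mem_traceOn Set.self_mem_Ici f x
  have hΘs : ∀ f ∈ formsIn P (Set.Ici a) (P k), ∃ g, f - Θ₀ g ∈ formsIn P (Set.Ioi a) (P k) := by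
    intro f hf
    obtain ⟨g, hg⟩ := hbij.2 (T.mkQ ∘ₗ f.codRestrict L hf)
    choose g' hg' using fun l => h.exists_lift T.mkQ T.mkQ_surjective (g l)
    refine ⟨fun l => L.subtype ∘ₗ g' l, fun x => ?_⟩
    have h1 : T.mkQ (f.codRestrict L hf x - ∑ l, g' l (v l x)) = 0 := by
      rw [map_sub, sub_eq_zero, map_sum]
      have := LinearMap.congr_fun hg x
      simp only [← hg', LinearMap.sum_apply, LinearMap.comp_apply] at this
      exact this.symm
    have h2 := (hmem _).1 h1
    rw [AddSubgroupClass.coe_sub, AddSubmonoidClass.coe_finsetSum] at h2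
    rw [LinearMap.sub_apply, hΘ₀]
    exact h2
  have htr : trace Aᵐᵒᵖ (∀ j : {j // a < j}, dual (P j)) (dual (P a)) =
      formsIn P (Set.Ioi a) (P a) :=
    (trace_pi (P := fun i => dual (P i)) (Set.Ioi a)).trans
      (traceOn_dual h.finite h.projective (Set.Ioi a) a)
  let Ξ : (Fin n → (P a →ₗ[A] A)) →ₗ[Aᵐᵒᵖ] (Fin n → standard (fun i => dual (P i)) a) :=
    LinearMap.pi fun l => (Submodule.mkQ
      (trace Aᵐᵒᵖ (∀ j : {j // a < j}, dual (P j)) (dual (P a)))) ∘ₗ LinearMap.proj l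
  have hΞs : Function.Surjective Ξ := by
    intro y
    choose g hg using fun l => Submodule.mkQ_surjective
      (trace Aᵐᵒᵖ (∀ j : {j // a < j}, dual (P j)) (dual (P a))) (y l)
    exact ⟨g, funext hg⟩
  have hker : ∀ g, Θ₀ g ∈ formsIn P (Set.Ioi a) (P k) ↔ Ξ g = 0 := by
    intro g
    have e1 : Ξ g = 0 ↔ ∀ l, g l ∈ formsIn P (Set.Ioi a) (P a) := by
      rw [funext_iff]
      refine forall_congr' fun l => ?_
      rw [← htr]
      exact Submodule.Quotient.mk_eq_zero _
    rw [e1]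
    let g' : Fin n → (P a →ₗ[A] L) := fun l => (g l).codRestrict L (hPL (g l))
    constructor
    · intro hg l x
      -- Injectivity for the hom basis: if the combination of the `g l` vanishes modulo `T`, so does
      -- each `g l`.
      have h0 : (fun l => T.mkQ ∘ₗ g' l) = 0 := hbij.1 (by
        ext x
        have h1 : T.mkQ (∑ l, g' l (v l x)) = 0 := by
          rw [hmem]
          have := hg x
          rw [hΘ₀] at this
          simpa [g'] using this
        rw [map_sum] at h1
        simpa using h1)
      exact (hmem (g' l x)).1 (LinearMap.congr_fun (congrFun h0 l) x)
    · intro hg x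
      rw [hΘ₀]
      exact sum_mem fun l _ => hg l _
  refine hk.of_layer _ _ hle Θ₀ (fun g x => ?_) Ξ hΞs hΘs hker ?_
  · rw [hΘ₀]
    exact sum_mem fun l _ => hPL _ _
  · exact .pi_fintype fun l => isFiltered_of_equiv_member (Set.mem_univ a)
      (LinearEquiv.refl Aᵐᵒᵖ _)

/-- Indices are added downwards: in an upper set with least element `a`, the other elements are
exactly those above `a`. -/
theorem isFiltered_formsIn (R : Type w) [CommRing R] [IsArtinianRing R] [Algebra R A]
    [Module.Finite R A] (h : ProjSystem Ψ P) (k : κ) (t : Finset κ) :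
    IsUpperSet (t : Set κ) →
    IsFiltered (standard fun i => dual (P i)) Set.univ (formsIn P ↑t (P k)) := by
  induction t using Finset.induction_on_min with
  | empty =>
    intro _
    have : Subsingleton (formsIn P ↑(∅ : Finset κ) (P k)) := by
      refine ⟨fun f g => Subtype.ext (LinearMap.ext fun x => ?_)⟩
      have h0 : traceOn P ↑(∅ : Finset κ) A = ⊥ := by
        rw [eq_bot_iff]
        exact traceOn_le fun j hj => by simp at hj
      have hf := f.2 x
      have hg := g.2 x
      rw [h0, Submodule.mem_bot] at hf hg
      rw [hf, hg]
    exact .zero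
  | insert a t ha ih =>
    intro ht
    have e1 : (t : Set κ) = Set.Ioi a := by
      ext x
      refine ⟨fun hx => ha x hx, fun hx => ?_⟩
      have : x ∈ (↑(insert a t) : Set κ) := ht (le_of_lt hx) (by simp)
      simp only [Finset.coe_insert, Set.mem_insert_iff] at this
      exact this.resolve_left (ne_of_gt hx)
    have e2 : (↑(insert a t) : Set κ) = Set.Ici a := by
      rw [Finset.coe_insert, e1, Set.Ioi_insert]
    rw [e2]
    refine h.isFiltered_formsIn_Ici R k a ?_
    rw [← e1]
    exact ih (e1 ▸ isUpperSet_Ioi a)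

/-- The opposite algebra is standardly stratified. -/
theorem isStandardlyStratified_dual (R : Type w) [CommRing R] [IsArtinianRing R] [Algebra R A]
    [Module.Finite R A] (h : ProjSystem Ψ P) :
    IsStandardlyStratified fun i => dual (P i) := by
  have := isArtinianRing_mulOpposite R (A := A)
  have e := (nonempty_equiv_pi_dual h.total.some).some
  have hi : ∀ i, IsIndec Aᵐᵒᵖ (dual (P i)) := fun i =>
    have := h.finite i
    have := h.projective i
    isIndec_dual (h.indec i)
  refine ⟨isRepresentativeSet_of_equiv e (fun i => ?_) (fun i => ?_) hi (fun i j hij => ?_),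
    fun M hM hM' => ?_⟩
  · have := h.finite i
    have := h.projective i
    exact finite_dual (P i)
  · have := h.finite i
    have := h.projective i
    exact projective_dual (P i)
  · have := h.finite i
    have := h.projective i
    have := h.finite j
    have := h.projective j
    exact ⟨fun ε => (h.not_iso hij).false (nonempty_equiv_of_dual ε).some⟩
  · rw [filt_iff_isFiltered]
    refine isFiltered_of_projective e hi fun k => ?_
    have h1 := h.isFiltered_formsIn R k Finset.univ (by
      rw [Finset.coe_univ]
      exact isUpperSet_univ)
    have h2 : IsFiltered (standard fun i => dual (P i)) Set.univ (P k →ₗ[A] A) := by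
      refine h1.of_eq_top (eq_top_iff.2 fun g _ x => ?_)
      rw [Finset.coe_univ, h.traceOn_eq_top h.isFiltered_regular]
      trivial
    exact h2

end ProjSystem


/-! ### Vanishing of Ext and lifting of maps -/

section ExtVanishing

variable {A : Type u} [Ring A]

/-- Writing the identity of `X` as a sum of maps through the `Z k` writes every extension class as a
sum of pullbacks of classes in the zero groups. -/
theorem subsingleton_ext_of_retract {X Y : ModuleCat.{u} A} {n : ℕ} {Z : Fin n → ModuleCat.{u} A}
    (s : ∀ k, X ⟶ Z k) (r : ∀ k, Z k ⟶ X) (hsr : ∑ k, s k ≫ r k = 𝟙 X)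
    (hZ : ∀ k, Subsingleton (Abelian.Ext (Z k) Y 1)) : Subsingleton (Abelian.Ext X Y 1) := by
  refine subsingleton_of_forall_eq 0 fun x => ?_
  rw [← Abelian.Ext.mk₀_id_comp x, ← hsr, Abelian.Ext.mk₀_sum, Abelian.Ext.sum_comp]
  refine Finset.sum_eq_zero fun k _ => ?_
  rw [← Abelian.Ext.mk₀_comp_mk₀, Abelian.Ext.comp_assoc_of_second_deg_zero,
    Subsingleton.elim ((Abelian.Ext.mk₀ (r k)).comp x _) 0, Abelian.Ext.comp_zero]

theorem subsingleton_ext_of_isFiltered {ι : Type w} {C : ι → ModuleCat.{u} A} {s : Set ι}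
    {X : ModuleCat.{u} A} (hX : ∀ j, Subsingleton (Abelian.Ext X (C j) 1)) {M : Type u}
    [AddCommGroup M] [Module A M] (hM : IsFiltered C s M) :
    Subsingleton (Abelian.Ext X (ModuleCat.of A M) 1) := by
  induction hM with
  | @zero M =>
    refine subsingleton_of_forall_eq 0 fun x => ?_
    have h0 : 𝟙 (ModuleCat.of A M) = 0 := by
      ext y
      exact Subsingleton.elim _ _
    rw [← Abelian.Ext.comp_mk₀_id x, h0, Abelian.Ext.mk₀_zero, Abelian.Ext.comp_zero]
  | step j _ π hπ _ ih =>
    have hS := LinearMap.shortExact_shortComplexKer hπ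
    have := hX j
    refine subsingleton_of_forall_eq 0 fun x => ?_
    obtain ⟨y, rfl⟩ := Abelian.Ext.covariant_sequence_exact₂ X hS x (Subsingleton.elim _ _)
    rw [Subsingleton.elim y 0, Abelian.Ext.zero_comp]

/-- The obstruction to lifting `φ` is its connecting class in `Ext¹(X, ker π)`. -/
theorem exists_lift_of_subsingleton_ext {X : ModuleCat.{u} A} {M L : Type u} [AddCommGroup M]
    [Module A M] [AddCommGroup L] [Module A L] (π : M →ₗ[A] L) (hπ : Function.Surjective π)
    (hX : Subsingleton (Abelian.Ext X (ModuleCat.of A (LinearMap.ker π)) 1)) (φ : X →ₗ[A] L) :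
    ∃ ψ : X →ₗ[A] M, π ∘ₗ ψ = φ := by
  have hS := LinearMap.shortExact_shortComplexKer hπ
  obtain ⟨y, hy⟩ := Abelian.Ext.covariant_sequence_exact₃ X hS
    (Abelian.Ext.mk₀ (ModuleCat.ofHom φ)) (zero_add 1) (Subsingleton.elim _ _)
  obtain ⟨ψ, rfl⟩ := (Abelian.Ext.mk₀_bijective _ _).2 y
  rw [Abelian.Ext.mk₀_comp_mk₀] at hy
  have := (Abelian.Ext.mk₀_bijective _ _).1 hy
  exact ⟨ψ.hom, congrArg ModuleCat.Hom.hom this⟩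

end ExtVanishing

/-! ### The additive closure of a module -/

section Add

variable {A : Type u} [Ring A] {S : ModuleCat.{u} A} {X Y : Type u} [AddCommGroup X] [Module A X]
  [AddCommGroup Y] [Module A Y]

/-- The identity of `X` is a sum of endomorphisms that factor through `S`. -/
def InAdd (S : ModuleCat.{u} A) (X : Type u) [AddCommGroup X] [Module A X] : Prop :=
  ∃ (n : ℕ) (s : Fin n → (X →ₗ[A] S)) (r : Fin n → (S →ₗ[A] X)),
    ∑ k, r k ∘ₗ s k = LinearMap.id

theorem addClosure_iff {X : ModuleCat.{u} A} : addClosure S X ↔ InAdd S X := by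
  classical
  constructor
  · rintro ⟨n, s, r, hrs⟩
    refine ⟨n, fun k => LinearMap.proj k ∘ₗ s,
      fun k => r ∘ₗ LinearMap.single A (fun _ => (S : Type u)) k, ?_⟩
    ext x
    have h1 : ∑ k, Pi.single k (s x k) = s x := Finset.univ_sum_single _
    have h2 : r (s x) = x := LinearMap.congr_fun hrs x
    rw [LinearMap.id_apply, LinearMap.sum_apply]
    conv_rhs => rw [← h2, ← h1, map_sum]
    rfl
  · rintro ⟨n, s, r, hsr⟩
    refine ⟨n, LinearMap.pi s, ∑ k, r k ∘ₗ LinearMap.proj k, ?_⟩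
    rw [← hsr]
    ext x
    simp

theorem InAdd.of_retract (hY : InAdd S Y) (s : X →ₗ[A] Y) (r : Y →ₗ[A] X)
    (hrs : r ∘ₗ s = LinearMap.id) : InAdd S X := by
  obtain ⟨n, s', r', h⟩ := hY
  refine ⟨n, fun k => s' k ∘ₗ s, fun k => r ∘ₗ r' k, ?_⟩
  ext x
  have h1 := LinearMap.congr_fun h (s x)
  have h2 : r (s x) = x := LinearMap.congr_fun hrs x
  simp only [LinearMap.sum_apply, LinearMap.comp_apply, LinearMap.id_apply] at h1 ⊢
  rw [← map_sum, h1, h2]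

theorem inAdd_self : InAdd S S :=
  ⟨1, fun _ => LinearMap.id, fun _ => LinearMap.id, by simp⟩

theorem InAdd.prod (hX : InAdd S X) (hY : InAdd S Y) : InAdd S (X × Y) := by
  obtain ⟨n, s, r, h⟩ := hX
  obtain ⟨m, s', r', h'⟩ := hY
  refine ⟨n + m, Fin.append (fun k => s k ∘ₗ LinearMap.fst A X Y)
    (fun k => s' k ∘ₗ LinearMap.snd A X Y), Fin.append (fun k => LinearMap.inl A X Y ∘ₗ r k)
    (fun k => LinearMap.inr A X Y ∘ₗ r' k), ?_⟩
  rw [Fin.sum_univ_add]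
  simp only [Fin.append_left, Fin.append_right]
  refine LinearMap.ext fun ⟨x, y⟩ => ?_
  have h1 := LinearMap.congr_fun h x
  have h2 := LinearMap.congr_fun h' y
  simp only [LinearMap.sum_apply, LinearMap.comp_apply, LinearMap.id_apply] at h1 h2
  simp only [LinearMap.add_apply, LinearMap.sum_apply, LinearMap.comp_apply, LinearMap.fst_apply,
    LinearMap.snd_apply, LinearMap.id_apply, ← map_sum, h1, h2]
  simp

theorem inAdd_of_subsingleton [Subsingleton X] : InAdd S X :=
  ⟨0, Fin.elim0, Fin.elim0, LinearMap.ext fun _ => Subsingleton.elim _ _⟩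

theorem inAdd_sum {ι : Type} [Fintype ι] (Q : ι → ModuleCat.{u} A) (i : ι) :
    InAdd (sum Q) (Q i) := by
  classical
  refine inAdd_self.of_retract (LinearMap.single A (fun i => (Q i : Type u)) i)
    (LinearMap.proj (φ := fun i => (Q i : Type u)) i) ?_
  ext x
  exact Pi.single_eq_same (M := fun i => (Q i : Type u)) i x

theorem InAdd.finite (hX : InAdd S X) [Module.Finite A S] : Module.Finite A X := by
  obtain ⟨n, s, r, hsr⟩ := hX
  refine .of_surjective (∑ k, r k ∘ₗ LinearMap.proj (φ := fun _ : Fin n => (S : Type u)) k)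
    fun x => ⟨fun k => s k x, ?_⟩
  simpa using LinearMap.congr_fun hsr x

theorem InAdd.subsingleton_ext {X Y : ModuleCat.{u} A} (hX : InAdd S X)
    (hS : Subsingleton (Abelian.Ext S Y 1)) : Subsingleton (Abelian.Ext X Y 1) := by
  obtain ⟨n, s, r, hsr⟩ := hX
  refine subsingleton_ext_of_retract (Z := fun _ => S) (fun k => ModuleCat.ofHom (s k))
    (fun k => ModuleCat.ofHom (r k)) ?_ fun _ => hS
  ext x
  simpa using LinearMap.congr_fun hsr x

end Add

/-! ### Presentations of filtered modules by `add Q` -/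

namespace IsProperCostratifyingSystem

variable {A : Type u} [Ring A] {ι : Type} [Fintype ι] [LinearOrder ι] {Ψ Q : ι → ModuleCat.{u} A}
  {M N L : Type u} [AddCommGroup M] [Module A M] [AddCommGroup N] [Module A N] [AddCommGroup L]
  [Module A L]

theorem subsingleton_ext (h : IsProperCostratifyingSystem Ψ Q) {X : ModuleCat.{u} A}
    (hX : InAdd (sum Q) X) {s : Set ι} (hM : IsFiltered Ψ s M) :
    Subsingleton (Abelian.Ext X (ModuleCat.of A M) 1) := by
  classical
  refine hX.subsingleton_ext ?_
  let e := Fintype.equivFin ι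
  refine subsingleton_ext_of_retract (Z := fun k => Q (e.symm k))
    (fun k => ModuleCat.ofHom (LinearMap.proj (φ := fun i => (Q i : Type u)) (e.symm k)))
    (fun k => ModuleCat.ofHom (LinearMap.single A (fun i => (Q i : Type u)) (e.symm k))) ?_
    fun k => subsingleton_ext_of_isFiltered (fun j => h.ext_eq_zero _ j) hM
  rw [Equiv.sum_comp e.symm (fun i => (ModuleCat.ofHom (LinearMap.proj
    (φ := fun i => (Q i : Type u)) i) ≫
      ModuleCat.ofHom (LinearMap.single A (fun i => (Q i : Type u)) i) : sum Q ⟶ sum Q))]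
  refine ModuleCat.hom_ext (LinearMap.ext fun x => ?_)
  rw [ModuleCat.hom_sum, LinearMap.sum_apply]
  exact Finset.univ_sum_single (M := fun i => (Q i : Type u)) x

theorem exists_lift (h : IsProperCostratifyingSystem Ψ Q) {X : Type u} [AddCommGroup X]
    [Module A X] (hX : InAdd (sum Q) X) {s : Set ι} (π : M →ₗ[A] L)
    (hπ : Function.Surjective π) (hk : IsFiltered Ψ s (LinearMap.ker π)) (φ : X →ₗ[A] L) :
    ∃ ψ : X →ₗ[A] M, π ∘ₗ ψ = φ :=
  exists_lift_of_subsingleton_ext (X := ModuleCat.of A X) π hπ (h.subsingleton_ext hX hk) φ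

theorem exists_cover (h : IsProperCostratifyingSystem Ψ Q) (i : ι) : ∃ β : Q i →ₗ[A] Ψ i,
    Function.Surjective β ∧ IsFiltered Ψ (Set.Iic i) (LinearMap.ker β) := by
  obtain ⟨Z, α, β, hα, hαβ, hβ, hZ⟩ := h.exact_sequence i
  refine ⟨β, hβ, (filt_subtype_iff (s := Set.Iic i)).1 hZ |>.of_equiv ?_⟩
  exact (LinearEquiv.ofInjective α hα ≪≫ₗ
    LinearEquiv.ofEq _ _ (LinearMap.exact_iff.1 hαβ).symm).symm

/-- Filtered modules are covered by modules in `add Q`, with filtered kernels. -/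
theorem exists_presentation (h : IsProperCostratifyingSystem Ψ Q)
    (hM : IsFiltered Ψ Set.univ M) : ∃ (X : ModuleCat.{u} A) (p : X →ₗ[A] M), InAdd (sum Q) X ∧
      Function.Surjective p ∧ IsFiltered Ψ Set.univ (LinearMap.ker p) := by
  induction hM with
  | @zero M =>
    refine ⟨ModuleCat.of A PUnit, 0, inAdd_of_subsingleton, fun x => ⟨0, Subsingleton.elim _ _⟩,
      .zero⟩
  | @step M _ _ j hj π hπ hk ih =>
    obtain ⟨X, p, hX, hp, hpk⟩ := ih
    obtain ⟨β, hβ, hβk⟩ := h.exists_cover j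
    obtain ⟨l, hl⟩ := h.exists_lift (inAdd_sum Q j) π hπ hk β
    have hl' : ∀ q, π (l q) = β q := LinearMap.congr_fun hl
    -- Horseshoe construction: the cover of `ker π` and a lift of `Q j → Ψ j` to `M` combine into a
    -- cover of `M`, whose kernel is an extension of `ker β` by `ker p`.
    let P : (X × Q j) →ₗ[A] M := ((LinearMap.ker π).subtype ∘ₗ p).coprod l
    have hP : ∀ x q, P (x, q) = p x + l q := fun x q => rfl
    have hπP : ∀ x q, π (P (x, q)) = β q := fun x q => by
      have : π (p x) = 0 := (p x).2
      rw [hP, map_add, this, zero_add, hl']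
    refine ⟨ModuleCat.of A (X × Q j), P, hX.prod (inAdd_sum Q j), fun m => ?_, ?_⟩
    · obtain ⟨q, hq⟩ := hβ (π m)
      obtain ⟨x, hx⟩ := hp ⟨m - l q, by rw [LinearMap.mem_ker, map_sub, hl', hq, sub_self]⟩
      exact ⟨(x, q), by rw [hP, hx, sub_add_cancel]⟩
    · refine (hβk.mono (Set.subset_univ _)).of_exact
        ((LinearMap.inl A X (Q j) ∘ₗ (LinearMap.ker p).subtype).codRestrict (LinearMap.ker P)
          fun x => ?_)
        ((LinearMap.snd A X (Q j) ∘ₗ (LinearMap.ker P).subtype).codRestrict (LinearMap.ker β)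
          fun x => ?_) ?_ ?_ ?_ hpk
      · have : p x = 0 := x.2
        rw [LinearMap.mem_ker, LinearMap.comp_apply, LinearMap.inl_apply, hP]
        simp [this]
      · obtain ⟨⟨x, q⟩, hx⟩ := x
        rw [LinearMap.mem_ker]
        change β q = 0
        rw [← hπP x q, show P (x, q) = 0 from hx, map_zero]
      · intro x y hxy
        have : ((x : X), (0 : Q j)) = ((y : X), 0) :=
          congrArg (fun z : LinearMap.ker P => (z : X × Q j)) hxy
        exact Subtype.ext (congrArg Prod.fst this)
      · rintro ⟨⟨x, q⟩, hx⟩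
        constructor
        · intro h0
          have hq : q = 0 := congrArg (fun z : LinearMap.ker β => (z : Q j)) h0
          subst hq
          have hx' : P (x, 0) = 0 := hx
          rw [hP, map_zero, add_zero] at hx'
          exact ⟨⟨x, Subtype.ext hx'⟩, rfl⟩
        · rintro ⟨y, hy⟩
          have : ((y : X), (0 : Q j)) = (x, q) :=
            congrArg (fun z : LinearMap.ker P => (z : X × Q j)) hy
          exact Subtype.ext (congrArg Prod.snd this).symm
      · rintro ⟨q, hq⟩
        obtain ⟨x, hx⟩ := hp ⟨- l q, by
          rw [LinearMap.mem_ker, map_neg, hl', show β q = 0 from hq, neg_zero]⟩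
        refine ⟨⟨(x, q), ?_⟩, rfl⟩
        rw [LinearMap.mem_ker, hP, hx, neg_add_cancel]

end IsProperCostratifyingSystem


/-! ### The functor `Hom(S, -)` on `add S` -/

section HomFunctor

variable {A : Type u} [Ring A] (S : ModuleCat.{u} A) {M N L : ModuleCat.{u} A}

/-- The map induced by `f` on `Hom(S, -)`. -/
def homMap (f : M →ₗ[A] N) : (S ⟶ M) →ₗ[EndOp S] (S ⟶ N) where
  toFun g := g ≫ ModuleCat.ofHom f
  map_add' _ _ := Preadditive.add_comp _ _ _ _ _ _
  map_smul' _ _ := Category.assoc _ _ _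

theorem homMap_apply (f : M →ₗ[A] N) (g : S ⟶ M) (x : S) : (homMap S f g).hom x = f (g.hom x) :=
  rfl

theorem homMap_comp (f : M →ₗ[A] N) (g : N →ₗ[A] L) :
    homMap S (g ∘ₗ f) = homMap S g ∘ₗ homMap S f := rfl

theorem homMap_zero : homMap S (0 : M →ₗ[A] N) = 0 := rfl

theorem homMap_id : homMap S (LinearMap.id : M →ₗ[A] M) = LinearMap.id := rfl

variable {S}

theorem homMap_injective {f : M →ₗ[A] N} (hf : Function.Injective f) :
    Function.Injective (homMap S f) := by
  intro a b hab
  ext x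
  exact hf (LinearMap.congr_fun (congrArg ModuleCat.Hom.hom hab) x)

theorem homMap_exact {f : M →ₗ[A] N} {g : N →ₗ[A] L} (hf : Function.Injective f)
    (hfg : Function.Exact f g) : Function.Exact (homMap S f) (homMap S g) := by
  intro b
  constructor
  · intro hb
    have hb' : ∀ x, ∃ y, f y = b.hom x := fun x =>
      (hfg (b.hom x)).1 (LinearMap.congr_fun (congrArg ModuleCat.Hom.hom hb) x)
    refine ⟨ModuleCat.ofHom ((LinearEquiv.ofInjective f hf).symm.toLinearMap ∘ₗ
      b.hom.codRestrict (LinearMap.range f) hb'), ?_⟩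
    ext x
    exact congrArg Subtype.val
      ((LinearEquiv.ofInjective f hf).apply_symm_apply ⟨b.hom x, hb' x⟩)
  · rintro ⟨a, rfl⟩
    ext x
    exact hfg.apply_apply_eq_zero (a.hom x)

theorem homMap_surjective {f : M →ₗ[A] N}
    (hf : ∀ φ : S →ₗ[A] N, ∃ ψ : S →ₗ[A] M, f ∘ₗ ψ = φ) : Function.Surjective (homMap S f) := by
  intro φ
  obtain ⟨ψ, hψ⟩ := hf φ.hom
  exact ⟨ModuleCat.ofHom ψ, ModuleCat.hom_ext hψ⟩

/-- The equivalence induced by an isomorphism. -/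
def homEquivOfEquiv (e : M ≃ₗ[A] N) : (S ⟶ M) ≃ₗ[EndOp S] (S ⟶ N) :=
  LinearEquiv.ofLinearMap (homMap S e.toLinearMap) (homMap S e.symm.toLinearMap)
    (by rw [← homMap_comp]; simp [homMap_id]) (by rw [← homMap_comp]; simp [homMap_id])

/-- Every `g : S → M` equals `∑ k, r k ∘ (s k ∘ g)`, that is, a `Γ`-combination of the `r k`. Hence
`φ` is determined by the `φ (r k)`, from which the map is assembled. -/
theorem InAdd.homMap_full (hM : InAdd S M) (φ : (S ⟶ M) →ₗ[EndOp S] (S ⟶ N)) :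
    ∃ f : M →ₗ[A] N, homMap S f = φ := by
  obtain ⟨n, s, r, hsr⟩ := hM
  refine ⟨∑ k, (φ (ModuleCat.ofHom (r k))).hom ∘ₗ s k, LinearMap.ext fun g => ?_⟩
  have h1 : g = ∑ k, (MulOpposite.op (g ≫ ModuleCat.ofHom (s k)) : EndOp S) •
      ModuleCat.ofHom (r k) := by
    refine ModuleCat.hom_ext (LinearMap.ext fun x => ?_)
    have := LinearMap.congr_fun hsr (g.hom x)
    rw [ModuleCat.hom_sum, LinearMap.sum_apply]
    rw [LinearMap.sum_apply] at this
    exact this.symm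
  conv_rhs => rw [h1, map_sum]
  refine ModuleCat.hom_ext (LinearMap.ext fun x => ?_)
  rw [homMap_apply, ModuleCat.hom_sum, LinearMap.sum_apply, LinearMap.sum_apply]
  refine Finset.sum_congr rfl fun k _ => ?_
  rw [map_smul]
  rfl

theorem InAdd.homMap_faithful (hM : InAdd S M) {f : M →ₗ[A] N} (hf : homMap S f = 0) :
    f = 0 := by
  obtain ⟨n, s, r, hsr⟩ := hM
  ext x
  have h1 := LinearMap.congr_fun hsr x
  rw [LinearMap.id_apply, LinearMap.sum_apply] at h1
  rw [← h1, map_sum]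
  refine Finset.sum_eq_zero fun k _ => ?_
  exact LinearMap.congr_fun (congrArg ModuleCat.Hom.hom
    (LinearMap.congr_fun hf (ModuleCat.ofHom (r k)))) (s k x)

theorem homMap_sub (f g : M →ₗ[A] N) : homMap S (f - g) = homMap S f - homMap S g := by
  refine LinearMap.ext fun x => ModuleCat.hom_ext (LinearMap.ext fun y => ?_)
  rfl

end HomFunctor

/-! ### The counit of tensor and Hom -/

section Counit

variable {A : Type u} [Ring A] (S : ModuleCat.{u} A) {M N : ModuleCat.{u} A}

/-- The evaluation map `S ⊗_ℤ Hom(S, M) → M`. -/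
def evalTensor (M : ModuleCat.{u} A) : (S ⊗[ℤ] (homFunctor S).obj M) →ₗ[A] M :=
  TensorProduct.AlgebraTensorModule.lift
    { toFun := fun x =>
        AddMonoidHom.toIntLinearMap
          { toFun := fun f : S ⟶ M => f.hom x
            map_zero' := rfl
            map_add' := fun _ _ => rfl }
      map_add' := fun x y => by
        ext f
        exact map_add (ModuleCat.Hom.hom (show S ⟶ M from f)) x y
      map_smul' := fun a x => by
        ext f
        exact map_smul (ModuleCat.Hom.hom (show S ⟶ M from f)) a x }

theorem balancing_le_ker (M : ModuleCat.{u} A) :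
    balancing S ((homFunctor S).obj M) ≤ LinearMap.ker (evalTensor S M) := by
  refine Submodule.span_le.2 ?_
  rintro _ ⟨γ, x, f, rfl⟩
  rw [SetLike.mem_coe, LinearMap.mem_ker, map_sub, sub_eq_zero]
  rfl

/-- The counit `S ⊗_Γ Hom(S, M) → M`. -/
def counit (M : ModuleCat.{u} A) :
    (tensorFunctor S).obj ((homFunctor S).obj M) →ₗ[A] M :=
  (balancing S ((homFunctor S).obj M)).liftQ (evalTensor S M) (balancing_le_ker S M)

/-- The class of `x ⊗ y`. -/
def tmulMk {Y : ModuleCat.{u} (EndOp S)} (x : S) (y : Y) : (tensorFunctor S).obj Y :=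
  (balancing S Y).mkQ (x ⊗ₜ[ℤ] y)

theorem tmulMk_smul {Y : ModuleCat.{u} (EndOp S)} (γ : EndOp S) (x : S) (y : Y) :
    tmulMk S (γ.unop.hom x) y = tmulMk S x (γ • y) :=
  (Submodule.Quotient.eq _).2 (Submodule.subset_span ⟨γ, x, y, rfl⟩)

theorem tmulMk_add_left {Y : ModuleCat.{u} (EndOp S)} (x x' : S) (y : Y) :
    tmulMk S (x + x') y = tmulMk S x y + tmulMk S x' y := by
  rw [tmulMk, TensorProduct.add_tmul, map_add]
  rfl

theorem tmulMk_sum_right {Y : ModuleCat.{u} (EndOp S)} {n : ℕ} (x : S) (y : Fin n → Y) :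
    tmulMk S x (∑ k, y k) = ∑ k, tmulMk S x (y k) := by
  rw [tmulMk, TensorProduct.tmul_sum, map_sum]
  rfl

theorem tensor_induction {Y : ModuleCat.{u} (EndOp S)} {p : (tensorFunctor S).obj Y → Prop}
    (h0 : p 0) (ht : ∀ x y, p (tmulMk S x y)) (ha : ∀ x y, p x → p y → p (x + y))
    (z : (tensorFunctor S).obj Y) : p z := by
  obtain ⟨z, rfl⟩ := (balancing S Y).mkQ_surjective z
  induction z using TensorProduct.induction_on with
  | zero => exact h0
  | tmul x y => exact ht x y
  | add x y hx hy =>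
    rw [map_add]
    exact ha _ _ hx hy

theorem tensorFunctor_map_tmulMk {Y Y' : ModuleCat.{u} (EndOp S)} (f : Y ⟶ Y') (x : S) (y : Y) :
    ((tensorFunctor S).map f).hom (tmulMk S x y) = tmulMk S x (f.hom y) := rfl

theorem counit_naturality (f : M ⟶ N)
    (z : (tensorFunctor S).obj ((homFunctor S).obj M)) :
    counit S N (((tensorFunctor S).map ((homFunctor S).map f)).hom z) = f.hom (counit S M z) := by
  refine tensor_induction S (p := fun z => counit S N
    (((tensorFunctor S).map ((homFunctor S).map f)).hom z) = f.hom (counit S M z)) ?_ ?_ ?_ z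
  · simp only [map_zero]
  · intro x y
    rfl
  · intro x y hx hy
    simp only [map_add, hx, hy]

theorem tensorFunctor_map_surjective {Y Y' : ModuleCat.{u} (EndOp S)} (f : Y ⟶ Y')
    (hf : Function.Surjective f.hom) : Function.Surjective ((tensorFunctor S).map f).hom := by
  intro z
  refine tensor_induction S (p := fun z => ∃ w, ((tensorFunctor S).map f).hom w = z) ?_ ?_ ?_ z
  · exact ⟨0, map_zero _⟩
  · intro x y
    obtain ⟨y, rfl⟩ := hf y
    exact ⟨tmulMk S x y, rfl⟩
  · rintro x y ⟨a, rfl⟩ ⟨b, rfl⟩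
    exact ⟨a + b, map_add _ _ _⟩

variable {S}

/-- The inverse is `m ↦ ∑ k, s k m ⊗ r k`; moving the endomorphisms `s k ∘ f` across the tensor sign
shows that it is a left inverse. -/
theorem InAdd.counit_bijective (hM : InAdd S M) : Function.Bijective (counit S M) := by
  obtain ⟨n, s, r, hsr⟩ := hM
  have hsr' : ∀ m, ∑ k, r k (s k m) = m := fun m => by
    simpa using LinearMap.congr_fun hsr m
  let r' : Fin n → (homFunctor S).obj M := fun k => (ModuleCat.ofHom (r k) : S ⟶ M)
  refine Function.bijective_iff_has_inverse.2
    ⟨fun m => ∑ k, tmulMk S (s k m) (r' k), fun z => ?_, fun m => ?_⟩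
  · refine tensor_induction S (p := fun z => ∑ k, tmulMk S (s k (counit S M z)) (r' k) = z)
      ?_ ?_ ?_ z
    · refine Finset.sum_eq_zero fun k _ => ?_
      rw [map_zero, map_zero, tmulMk, TensorProduct.zero_tmul, map_zero]
      rfl
    · intro x f
      have h1 : f = ∑ k, (MulOpposite.op ((show S ⟶ M from f) ≫ ModuleCat.ofHom (s k)) :
          EndOp S) • r' k := by
        change (show S ⟶ M from f) = ∑ k, ((show S ⟶ M from f) ≫ ModuleCat.ofHom (s k)) ≫
          ModuleCat.ofHom (r k)
        refine ModuleCat.hom_ext (LinearMap.ext fun y => ?_)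
        rw [ModuleCat.hom_sum, LinearMap.sum_apply]
        exact (hsr' _).symm
      conv_rhs => rw [h1, tmulMk_sum_right]
      refine Finset.sum_congr rfl fun k _ => ?_
      rw [← tmulMk_smul]
      rfl
    · intro x y hx hy
      simp only [map_add, tmulMk_add_left, Finset.sum_add_distrib, hx, hy]
  · change counit S M (∑ k, tmulMk S (s k m) (r' k)) = m
    rw [map_sum]
    exact hsr' m

end Counit


/-- Uniqueness of pushout extensions: two extensions of `W` by `X` into which the same
presentation `Z → P → W` maps, compatibly with a map `Z → X`, are isomorphic. -/
theorem nonempty_equiv_of_pushout {B : Type*} [Ring B] {X Z P W Y Y' : Type u} [AddCommGroup X]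
    [Module B X] [AddCommGroup Z] [Module B Z] [AddCommGroup P] [Module B P] [AddCommGroup W]
    [Module B W] [AddCommGroup Y] [Module B Y] [AddCommGroup Y'] [Module B Y']
    {α : Z →ₗ[B] P} {β : P →ₗ[B] W} (hαβ : Function.Exact α β) (hβ : Function.Surjective β)
    (κ : Z →ₗ[B] X) (f : X →ₗ[B] Y) (g : Y →ₗ[B] W) (l : P →ₗ[B] Y) (hf : Function.Injective f)
    (hfg : Function.Exact f g) (hl : ∀ p, g (l p) = β p) (hlα : ∀ z, l (α z) = f (κ z))
    (f' : X →ₗ[B] Y') (g' : Y' →ₗ[B] W) (l' : P →ₗ[B] Y') (hf' : Function.Injective f')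
    (hfg' : Function.Exact f' g') (hl' : ∀ p, g' (l' p) = β p)
    (hlα' : ∀ z, l' (α z) = f' (κ z)) : Nonempty (Y ≃ₗ[B] Y') := by
  have surj : ∀ {Y : Type u} [AddCommGroup Y] [Module B Y] (f : X →ₗ[B] Y) (g : Y →ₗ[B] W)
      (l : P →ₗ[B] Y), Function.Exact f g → (∀ p, g (l p) = β p) →
      Function.Surjective (f.coprod l) := by
    intro Y _ _ f g l hfg hl y
    obtain ⟨p, hp⟩ := hβ (g y)
    obtain ⟨x, hx⟩ := (hfg (y - l p)).1 (by rw [map_sub, hl, hp, sub_self])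
    exact ⟨(x, p), by rw [LinearMap.coprod_apply, hx, sub_add_cancel]⟩
  have ker : ∀ {Y : Type u} [AddCommGroup Y] [Module B Y] (f : X →ₗ[B] Y) (g : Y →ₗ[B] W)
      (l : P →ₗ[B] Y), Function.Injective f → Function.Exact f g → (∀ p, g (l p) = β p) →
      (∀ z, l (α z) = f (κ z)) → ∀ x p, (x, p) ∈ LinearMap.ker (f.coprod l) ↔
        ∃ z, p = α z ∧ x = - κ z := by
    intro Y _ _ f g l hf hfg hl hlα x p
    rw [LinearMap.mem_ker, LinearMap.coprod_apply]
    constructor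
    · intro h0
      have hp : β p = 0 := by
        have := congrArg g h0
        rwa [map_add, hfg.apply_apply_eq_zero, zero_add, map_zero, hl] at this
      obtain ⟨z, rfl⟩ := (hαβ p).1 hp
      refine ⟨z, rfl, hf ?_⟩
      rw [hlα] at h0
      rw [map_neg]
      exact eq_neg_of_add_eq_zero_left h0
    · rintro ⟨z, rfl, rfl⟩
      rw [hlα, map_neg, neg_add_cancel]
  refine nonempty_equiv_of_ker_eq (f.coprod l) (f'.coprod l') (surj f g l hfg hl)
    (surj f' g' l' hfg' hl') ?_
  ext ⟨x, p⟩
  rw [ker f g l hf hfg hl hlα, ker f' g' l' hf' hfg' hl' hlα']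

/-! ### Full faithfulness and the counit on filtered modules -/

namespace IsProperCostratifyingSystem

variable {A : Type u} [Ring A] {ι : Type} [Fintype ι] [LinearOrder ι] {Ψ Q : ι → ModuleCat.{u} A}
  {M N : ModuleCat.{u} A}

theorem homMap_surjective (h : IsProperCostratifyingSystem Ψ Q) {f : M →ₗ[A] N}
    (hf : Function.Surjective f) {s : Set ι} (hk : IsFiltered Ψ s (LinearMap.ker f)) :
    Function.Surjective (homMap (sum Q) f) :=
  Costrat.homMap_surjective fun φ => h.exists_lift inAdd_self f hf hk φ

theorem homMap_faithful (h : IsProperCostratifyingSystem Ψ Q) (hM : IsFiltered Ψ Set.univ M)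
    {f : M →ₗ[A] N} (hf : homMap (sum Q) f = 0) : f = 0 := by
  obtain ⟨X, p, hX, hp, hpk⟩ := h.exists_presentation hM
  have h0 : f ∘ₗ p = 0 := hX.homMap_faithful (by rw [homMap_comp, hf, LinearMap.zero_comp])
  ext m
  obtain ⟨x, rfl⟩ := hp m
  exact LinearMap.congr_fun h0 x

/-- For a presentation `Y → X → M` by `add Q`, the composite of `φ` with the image of `p` is induced
by some `f₀` on `X`. Faithfulness on `Y` gives `f₀ ∘ d = 0`, so `f₀` descends to `M`, and
surjectivity of `homMap p` shows that the descended map induces `φ`. -/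
theorem homMap_full (h : IsProperCostratifyingSystem Ψ Q) (hM : IsFiltered Ψ Set.univ M)
    (φ : (sum Q ⟶ M) →ₗ[EndOp (sum Q)] (sum Q ⟶ N)) :
    ∃ f : M →ₗ[A] N, homMap (sum Q) f = φ := by
  obtain ⟨X, p, hX, hp, hpk⟩ := h.exists_presentation hM
  obtain ⟨Y, q, hY, hq, -⟩ := h.exists_presentation hpk
  obtain ⟨f₀, hf₀⟩ := hX.homMap_full (φ ∘ₗ homMap (sum Q) p)
  let d : Y →ₗ[A] X := (LinearMap.ker p).subtype ∘ₗ q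
  have hpd : p ∘ₗ d = 0 := by
    ext y
    exact (q y).2
  have hd : f₀ ∘ₗ d = 0 := hY.homMap_faithful (by
    rw [homMap_comp, hf₀, LinearMap.comp_assoc, ← homMap_comp, hpd, homMap_zero,
      LinearMap.comp_zero])
  obtain ⟨f, hf⟩ := exists_comp_eq_of_ker_le p hp f₀ (fun x hx => by
    obtain ⟨y, hy⟩ := hq ⟨x, hx⟩
    have := LinearMap.congr_fun hd y
    rwa [LinearMap.comp_apply, show d y = x from congrArg Subtype.val hy] at this)
  refine ⟨f, LinearMap.ext fun g => ?_⟩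
  obtain ⟨g, rfl⟩ := h.homMap_surjective hp hpk g
  rw [← hf, homMap_comp] at hf₀
  exact LinearMap.congr_fun hf₀ g

/-- Naturality along `Y → X → M`: the counits at `X` and `Y` are bijective, the presentation is
exact, and `G(F(p))` is onto with `G(F(d))` composing to zero. This suffices for the diagram chase;
exactness of the tensored sequence in the middle is not needed. -/
theorem counit_bijective (h : IsProperCostratifyingSystem Ψ Q) (hM : IsFiltered Ψ Set.univ M) :
    Function.Bijective (counit (sum Q) M) := by
  obtain ⟨X, p, hX, hp, hpk⟩ := h.exists_presentation hM
  obtain ⟨Y, q, hY, hq, -⟩ := h.exists_presentation hpk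
  let d : Y →ₗ[A] X := (LinearMap.ker p).subtype ∘ₗ q
  have hpd : p ∘ₗ d = 0 := by
    ext y
    exact (q y).2
  have hsurj := h.homMap_surjective hp hpk
  constructor
  · rw [← LinearMap.ker_eq_bot, eq_bot_iff]
    intro z hz
    obtain ⟨w, rfl⟩ := tensorFunctor_map_surjective (sum Q)
      ((homFunctor (sum Q)).map (ModuleCat.ofHom p)) hsurj z
    have hz' : p (counit (sum Q) X w) = 0 :=
      (counit_naturality (sum Q) (ModuleCat.ofHom p) w).symm.trans hz
    obtain ⟨y, hy⟩ := hq ⟨_, hz'⟩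
    obtain ⟨v, rfl⟩ := hY.counit_bijective.2 y
    have hw : w = ((tensorFunctor (sum Q)).map
        ((homFunctor (sum Q)).map (ModuleCat.ofHom d))).hom v := by
      apply hX.counit_bijective.1
      rw [counit_naturality]
      exact (congrArg Subtype.val hy).symm
    have h0 : ModuleCat.ofHom d ≫ ModuleCat.ofHom p = 0 := ModuleCat.hom_ext hpd
    have h1 : ((tensorFunctor (sum Q)).map ((homFunctor (sum Q)).map (ModuleCat.ofHom d)) ≫
        (tensorFunctor (sum Q)).map ((homFunctor (sum Q)).map (ModuleCat.ofHom p))).hom v = 0 := by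
      rw [← Functor.map_comp, ← Functor.map_comp, h0]
      refine tensor_induction (sum Q) (p := fun v => ((tensorFunctor (sum Q)).map
        ((homFunctor (sum Q)).map (0 : Y ⟶ M))).hom v = 0) (map_zero _) (fun x y => ?_)
        (fun x y hx hy => by rw [map_add, hx, hy, add_zero]) v
      rw [tensorFunctor_map_tmulMk, tmulMk]
      rw [show ((homFunctor (sum Q)).map (0 : Y ⟶ M)).hom y = 0 from
        Limits.comp_zero (C := ModuleCat.{u} A), TensorProduct.tmul_zero, map_zero]
      rfl
    rw [hw]
    exact h1
  · intro m
    obtain ⟨x, rfl⟩ := hp m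
    obtain ⟨w, rfl⟩ := hX.counit_bijective.2 x
    exact ⟨_, counit_naturality (sum Q) (ModuleCat.ofHom p) w⟩

end IsProperCostratifyingSystem

/-! ### Transfer of the system to `Γ` -/

section Transfer

variable {A : Type u} [Ring A] {ι : Type} [Fintype ι]

/-- The modules `F(Ψ i)`, indexed by `ι` with the opposite order. -/
def ΓΨ (Ψ Q : ι → ModuleCat.{u} A) : ιᵒᵈ → ModuleCat.{u} (EndOp (sum Q)) :=
  fun i => (homFunctor (sum Q)).obj (Ψ (OrderDual.ofDual i))

theorem nonempty_equiv_pi_ΓP (Q : ι → ModuleCat.{u} A) :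
    Nonempty (EndOp (sum Q) ≃ₗ[EndOp (sum Q)] ∀ i, ΓP Q i) := by
  let φ : EndOp (sum Q) →ₗ[EndOp (sum Q)] ∀ i : ιᵒᵈ, (sum Q ⟶ Q (OrderDual.ofDual i)) :=
    { toFun := fun γ i => γ.unop ≫ ModuleCat.ofHom (LinearMap.proj
        (φ := fun i => (Q i : Type u)) (OrderDual.ofDual i))
      map_add' := fun γ δ => funext fun i => Preadditive.add_comp _ _ _ _ _ _
      map_smul' := fun γ δ => funext fun i => Category.assoc _ _ _ }
  refine ⟨LinearEquiv.ofBijective φ ⟨fun γ δ hγδ => ?_, fun g => ?_⟩⟩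
  · apply MulOpposite.unop_injective
    refine ModuleCat.hom_ext (LinearMap.ext fun x => funext fun i => ?_)
    exact LinearMap.congr_fun (congrArg ModuleCat.Hom.hom (congrFun hγδ (OrderDual.toDual i))) x
  · let g' : ∀ i, sum Q →ₗ[A] Q i := fun i =>
      ModuleCat.Hom.hom (show sum Q ⟶ Q i from g (OrderDual.toDual i))
    refine ⟨MulOpposite.op (ModuleCat.ofHom (LinearMap.pi g') : sum Q ⟶ sum Q), ?_⟩
    rfl

variable [LinearOrder ι] {Ψ Q : ι → ModuleCat.{u} A}

namespace IsProperCostratifyingSystem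

/-- Each step of the filtration has filtered kernel, so Ext-vanishing keeps it short exact under
`Hom(Q, -)`. -/
theorem isFiltered_hom (h : IsProperCostratifyingSystem Ψ Q) {s : Set ι} {M : Type u}
    [AddCommGroup M] [Module A M] (hM : IsFiltered Ψ s M) :
    IsFiltered (ΓΨ Ψ Q) (OrderDual.ofDual ⁻¹' s) (sum Q ⟶ ModuleCat.of A M) := by
  induction hM with
  | @zero M =>
    have : Subsingleton (sum Q ⟶ ModuleCat.of A M) :=
      ⟨fun f g => by ext x; exact Subsingleton.elim _ _⟩
    exact .zero
  | @step M _ _ j hj π hπ hk ih =>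
    have hj' : OrderDual.toDual j ∈ OrderDual.ofDual ⁻¹' s := hj
    have e : IsFiltered (ΓΨ Ψ Q) (OrderDual.ofDual ⁻¹' s) (sum Q ⟶ Ψ j) :=
      isFiltered_of_equiv_member (C := ΓΨ Ψ Q) hj' (LinearEquiv.refl _ (sum Q ⟶ Ψ j))
    exact e.of_exact
      (homMap (M := ModuleCat.of A (LinearMap.ker π)) (N := ModuleCat.of A M) (sum Q)
        (LinearMap.ker π).subtype)
      (homMap (M := ModuleCat.of A M) (sum Q) π)
      (homMap_injective (Submodule.injective_subtype _))
      (homMap_exact (Submodule.injective_subtype _) (LinearMap.exact_subtype_ker_map π))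
      (h.homMap_surjective (M := ModuleCat.of A M) hπ hk) ih

end IsProperCostratifyingSystem

end Transfer


theorem exists_pushout {B : Type*} [Ring B] {X P W : Type u} [AddCommGroup X] [Module B X]
    [AddCommGroup P] [Module B P] [AddCommGroup W] [Module B W] (β : P →ₗ[B] W)
    (hβ : Function.Surjective β) (k : LinearMap.ker β →ₗ[B] X) :
    ∃ (Y : ModuleCat.{u} B) (a : X →ₗ[B] Y) (g : Y →ₗ[B] W) (b : P →ₗ[B] Y),
      Function.Injective a ∧ Function.Exact a g ∧ Function.Surjective g ∧ g ∘ₗ b = β ∧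
      b ∘ₗ (LinearMap.ker β).subtype = a ∘ₗ k := by
  -- The pushout is `X × P` modulo the antidiagonal copy of `ker β`.
  let j : LinearMap.ker β →ₗ[B] (X × P) := (-k).prod (LinearMap.ker β).subtype
  let J := LinearMap.range j
  let g₀ : (X × P) →ₗ[B] W := β ∘ₗ LinearMap.snd B X P
  have hJ : J ≤ LinearMap.ker g₀ := by
    rintro _ ⟨z, rfl⟩
    exact z.2
  refine ⟨ModuleCat.of B ((X × P) ⧸ J), J.mkQ ∘ₗ LinearMap.inl B X P, J.liftQ g₀ hJ,
    J.mkQ ∘ₗ LinearMap.inr B X P, ?_, ?_, ?_, ?_, ?_⟩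
  · rw [← LinearMap.ker_eq_bot, eq_bot_iff]
    intro x hx
    obtain ⟨z, hz⟩ := (Submodule.Quotient.mk_eq_zero J).1 hx
    have h1 : (z : P) = 0 := congrArg Prod.snd hz
    have h2 : - k z = x := congrArg Prod.fst hz
    rw [Submodule.mem_bot, ← h2, show z = 0 from Subtype.ext h1, map_zero, neg_zero]
  · intro y
    obtain ⟨⟨x, p⟩, rfl⟩ := J.mkQ_surjective y
    constructor
    · intro hp
      have hp' : β p = 0 := hp
      refine ⟨x + k ⟨p, hp'⟩, ?_⟩
      refine (Submodule.Quotient.eq J).2 ⟨-⟨p, hp'⟩, ?_⟩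
      refine Prod.ext ?_ ?_
      · simp [j]
      · simp [j]
    · rintro ⟨x', hx'⟩
      rw [← hx']
      exact map_zero β
  · intro w
    obtain ⟨p, rfl⟩ := hβ w
    exact ⟨J.mkQ (0, p), rfl⟩
  · rfl
  · ext z
    refine (Submodule.Quotient.eq J).2 ⟨z, Prod.ext ?_ ?_⟩
    · simp [j]
    · simp [j]

section Transfer

variable {A : Type u} [Ring A] {ι : Type} [Fintype ι] {Ψ Q : ι → ModuleCat.{u} A}

theorem finite_ΓP (Q : ι → ModuleCat.{u} A) (i : ιᵒᵈ) :
    Module.Finite (EndOp (sum Q)) (ΓP Q i) := by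
  classical
  obtain ⟨e⟩ := nonempty_equiv_pi_ΓP Q
  refine .of_surjective (LinearMap.proj i ∘ₗ e.toLinearMap) fun x => ⟨e.symm (Pi.single i x), ?_⟩
  simp

theorem projective_ΓP (Q : ι → ModuleCat.{u} A) (i : ιᵒᵈ) :
    Module.Projective (EndOp (sum Q)) (ΓP Q i) := by
  classical
  obtain ⟨e⟩ := nonempty_equiv_pi_ΓP Q
  refine .of_split (e.symm.toLinearMap ∘ₗ LinearMap.single (EndOp (sum Q)) (fun i => ΓP Q i) i)
    (LinearMap.proj i ∘ₗ e.toLinearMap) ?_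
  ext x
  simp

variable [LinearOrder ι]

namespace IsProperCostratifyingSystem

theorem isIndec_ΓP (h : IsProperCostratifyingSystem Ψ Q) (i : ιᵒᵈ) :
    IsIndec (EndOp (sum Q)) (ΓP Q i) := by
  have hi := indecomposable_iff.1 (h.indecomposable (OrderDual.ofDual i))
  have hadd := inAdd_sum Q (OrderDual.ofDual i)
  have hn := hi.nontrivial
  have h1 : IsIndec (EndOp (sum Q)) (sum Q ⟶ Q (OrderDual.ofDual i)) := by
    constructor
    · by_contra hs
      rw [not_nontrivial_iff_subsingleton] at hs
      have h0 := hadd.homMap_faithful (f := (LinearMap.id : Q (OrderDual.ofDual i) →ₗ[A] _))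
        (LinearMap.ext fun _ => Subsingleton.elim _ _)
      obtain ⟨x, hx⟩ := exists_ne (0 : Q (OrderDual.ofDual i))
      exact hx (LinearMap.congr_fun h0 x)
    · intro φ hφ
      obtain ⟨f, rfl⟩ := hadd.homMap_full φ
      rcases hi.idempotent f (by
        rw [← sub_eq_zero]
        refine hadd.homMap_faithful ?_
        rw [homMap_sub, sub_eq_zero]
        exact hφ) with rfl | rfl
      · exact .inl (homMap_zero _)
      · exact .inr (homMap_id _)
  exact h1

theorem nontrivial_Ψ (h : IsProperCostratifyingSystem Ψ Q) (i : ι) : Nontrivial (Ψ i) := by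
  by_contra hs
  rw [not_nontrivial_iff_subsingleton] at hs
  obtain ⟨f, g, hfg⟩ := (h.division i).1
  exact hfg (LinearMap.ext fun _ => Subsingleton.elim _ _)

/-- The image of a proper costratifying system under `Hom(Q, -)`. -/
theorem projSystem (h : IsProperCostratifyingSystem Ψ Q) :
    ProjSystem (ΓΨ Ψ Q) (ΓP Q) where
  finite := finite_ΓP Q
  projective := projective_ΓP Q
  indec := h.isIndec_ΓP
  total := nonempty_equiv_pi_ΓP Q
  nontrivial i := by
    by_contra hs
    rw [not_nontrivial_iff_subsingleton] at hs
    have hs' : Subsingleton (sum Q ⟶ Ψ (OrderDual.ofDual i)) := hs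
    have h0 := h.homMap_faithful (isFiltered_member Ψ (Set.mem_univ (OrderDual.ofDual i)))
      (f := LinearMap.id) (LinearMap.ext fun _ => Subsingleton.elim _ _)
    have := h.nontrivial_Ψ (OrderDual.ofDual i)
    obtain ⟨x, hx⟩ := exists_ne (0 : Ψ (OrderDual.ofDual i))
    exact hx (LinearMap.congr_fun h0 x)
  division i φ hφ := by
    obtain ⟨f, rfl⟩ := h.homMap_full (isFiltered_member Ψ (Set.mem_univ (OrderDual.ofDual i)))
      (N := Ψ (OrderDual.ofDual i)) φ
    have hf : IsUnit f := (h.division _).2 f fun h0 => hφ (by rw [h0]; rfl)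
    exact (homEquivOfEquiv (LinearEquiv.ofBijective f ((Module.End.isUnit_iff f).1 hf))).bijective
  hom_eq_zero i j hij φ := by
    obtain ⟨f, rfl⟩ := h.homMap_full (isFiltered_member Ψ (Set.mem_univ (OrderDual.ofDual i)))
      (N := Ψ (OrderDual.ofDual j)) φ
    rw [h.hom_eq_zero _ _ (OrderDual.ofDual_lt_ofDual.2 hij) f]
    rfl
  cover i := by
    obtain ⟨β, hβ, hk⟩ := h.exists_cover (OrderDual.ofDual i)
    refine ⟨homMap (sum Q) β, h.homMap_surjective hβ hk, ?_⟩
    let K := ModuleCat.of A (LinearMap.ker β)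
    have hinj : Function.Injective (homMap (M := K) (sum Q) (LinearMap.ker β).subtype) :=
      homMap_injective (Submodule.injective_subtype _)
    have hex : Function.Exact (homMap (M := K) (sum Q) (LinearMap.ker β).subtype)
        (homMap (sum Q) β) :=
      homMap_exact (Submodule.injective_subtype _) (LinearMap.exact_subtype_ker_map β)
    exact (h.isFiltered_hom hk).of_equiv (LinearEquiv.ofInjective _ hinj ≪≫ₗ
      LinearEquiv.ofEq _ _ (LinearMap.exact_iff.1 hex).symm).symm

/-- The functor `Hom(Q, -)` is essentially surjective on filtered modules. -/
theorem exists_equiv_hom (h : IsProperCostratifyingSystem Ψ Q) {Y : Type u} [AddCommGroup Y]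
    [Module (EndOp (sum Q)) Y] (hY : IsFiltered (ΓΨ Ψ Q) Set.univ Y) :
    ∃ M : ModuleCat.{u} A, IsFiltered Ψ Set.univ M ∧
      Nonempty (Y ≃ₗ[EndOp (sum Q)] (sum Q ⟶ M)) := by
  induction hY with
  | @zero Y =>
    refine ⟨ModuleCat.of A PUnit, .zero, ⟨?_⟩⟩
    have : Subsingleton (sum Q ⟶ ModuleCat.of A PUnit.{u + 1}) :=
      ⟨fun f g => by ext x⟩
    exact LinearEquiv.ofSubsingleton _ _
  | @step Y _ _ i _ π hπ hk ih =>
    obtain ⟨M', hM', ⟨e⟩⟩ := ih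
    obtain ⟨β, hβ, hβk⟩ := h.exists_cover (OrderDual.ofDual i)
    let K := ModuleCat.of A (LinearMap.ker β)
    let π' : Y →ₗ[EndOp (sum Q)] (sum Q ⟶ Ψ (OrderDual.ofDual i)) := π
    have hproj : Module.Projective (EndOp (sum Q)) (sum Q ⟶ Q (OrderDual.ofDual i)) :=
      projective_ΓP Q i
    obtain ⟨l, hl⟩ := Module.projective_lifting_property π' (homMap (sum Q) β) hπ
    have hl' : ∀ p, π' (l p) = homMap (sum Q) β p := LinearMap.congr_fun hl
    let α : (sum Q ⟶ K) →ₗ[EndOp (sum Q)] (sum Q ⟶ Q (OrderDual.ofDual i)) :=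
      homMap (M := K) (sum Q) (LinearMap.ker β).subtype
    have hex : Function.Exact α (homMap (sum Q) β) :=
      homMap_exact (Submodule.injective_subtype _) (LinearMap.exact_subtype_ker_map β)
    have hmem : ∀ z, (l ∘ₗ α) z ∈ LinearMap.ker π := fun z =>
      (hl' (α z)).trans (hex.apply_apply_eq_zero z)
    -- The map encoding the extension `Y`: lift `F(β)` through `π` to `l` and restrict `l` to `F(ker
    -- β)`. By fullness it comes from a map `k` over `Λ`.
    let κ₀ : (sum Q ⟶ K) →ₗ[EndOp (sum Q)] (sum Q ⟶ M') :=
      e.toLinearMap ∘ₗ (l ∘ₗ α).codRestrict (LinearMap.ker π) hmem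
    obtain ⟨k, hκ⟩ := h.homMap_full (M := K) (hβk.mono (Set.subset_univ _)) κ₀
    obtain ⟨M, a, g, b, ha, hag, hg, hgb, hba⟩ := exists_pushout β hβ k
    have hM : IsFiltered Ψ Set.univ M :=
      (isFiltered_member Ψ (Set.mem_univ (OrderDual.ofDual i))).of_exact a g ha hag hg hM'
    refine ⟨M, hM, nonempty_equiv_of_pushout hex (h.homMap_surjective hβ hβk) κ₀
      ((LinearMap.ker π).subtype ∘ₗ e.symm.toLinearMap) π' l
      ((Submodule.injective_subtype _).comp e.symm.injective) ?_ hl' ?_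
      (homMap (sum Q) a) (homMap (sum Q) g) (homMap (sum Q) b) (homMap_injective ha)
      (homMap_exact ha hag) ?_ ?_⟩
    · rw [LinearMap.exact_iff, LinearEquiv.range_comp, Submodule.range_subtype]
      rfl
    · intro z
      simp [κ₀]
    · intro p
      rw [← hgb]
      rfl
    · intro z
      rw [← hκ]
      exact LinearMap.congr_fun (congrArg (homMap (M := K) (sum Q)) hba) z

end IsProperCostratifyingSystem

end Transfer

/-- The endomorphism algebra of a finitely generated module over an artin algebra is an artin
algebra. -/
theorem exists_algebra_finite_endOp (R : Type w) [CommRing R] [IsArtinianRing R] {A : Type u}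
    [Ring A] [Algebra R A] [Module.Finite R A] (S : ModuleCat.{u} A) [Module.Finite A S] :
    ∃ _ : Algebra R (EndOp S), Module.Finite R (EndOp S) := by
  let _ : Module R S := Module.compHom S (algebraMap R A)
  have hst : IsScalarTower R A S := ⟨fun r a y => by
    rw [Algebra.smul_def, mul_smul]
    rfl⟩
  have : SMulCommClass A R S := IsScalarTower.to_smulCommClass'
  have hfin : Module.Finite R (Module.End A S) := finite_hom_restrictScalars R (A := A) S S
  let ε : Module.End A S ≃+* End S := S.endRingEquiv.symm
  let alg : Algebra R (End S) := (ε.toRingHom.comp (algebraMap R (Module.End A S))).toAlgebra'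
    fun r x => by
      obtain ⟨y, rfl⟩ := ε.surjective x
      change ε _ * ε y = ε y * ε _
      rw [← map_mul, ← map_mul, Algebra.commutes]
  let φ : Module.End A S →ₗ[R] End S :=
    { toFun := ε
      map_add' := map_add ε
      map_smul' := fun r x => by
        rw [Algebra.smul_def, map_mul]
        rfl }
  have : Module.Finite R (End S) := .of_surjective φ ε.surjective
  exact ⟨inferInstance, .equiv (MulOpposite.opLinearEquiv R)⟩


/-! ### Conclusion: `add Q` and the exact equivalence -/

section Projective

variable {A : Type u} [Ring A] {S : ModuleCat.{u} A} {X : ModuleCat.{u} A}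

theorem InAdd.exists_hom_retract (hX : InAdd S X) :
    ∃ (n : ℕ) (s : (S ⟶ X) →ₗ[EndOp S] (Fin n → EndOp S))
      (r : (Fin n → EndOp S) →ₗ[EndOp S] (S ⟶ X)), r ∘ₗ s = LinearMap.id := by
  obtain ⟨n, s, r, hsr⟩ := hX
  refine ⟨n,
    { toFun := fun f k => MulOpposite.op (f ≫ ModuleCat.ofHom (s k))
      map_add' := fun f g => by
        funext k
        exact congrArg MulOpposite.op (Preadditive.add_comp _ _ _ f g _)
      map_smul' := fun γ f => by
        funext k
        exact congrArg MulOpposite.op (Category.assoc _ _ _) },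
    { toFun := fun c => ∑ k, c k • ModuleCat.ofHom (r k)
      map_add' := fun c d => by simp [add_smul, Finset.sum_add_distrib]
      map_smul' := fun γ c => by simp [mul_smul, Finset.smul_sum] }, ?_⟩
  refine LinearMap.ext fun f => ModuleCat.hom_ext (LinearMap.ext fun x => ?_)
  have h1 := LinearMap.congr_fun hsr (f.hom x)
  rw [LinearMap.sum_apply] at h1
  change (∑ k, (f ≫ ModuleCat.ofHom (s k)) ≫ ModuleCat.ofHom (r k)).hom x = f.hom x
  rw [ModuleCat.hom_sum, LinearMap.sum_apply]
  exact h1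

theorem InAdd.finite_hom (hX : InAdd S X) : Module.Finite (EndOp S) (S ⟶ X) := by
  obtain ⟨n, s, r, hrs⟩ := hX.exists_hom_retract
  exact .of_surjective r fun x => ⟨s x, LinearMap.congr_fun hrs x⟩

theorem InAdd.projective_hom (hX : InAdd S X) : Module.Projective (EndOp S) (S ⟶ X) := by
  obtain ⟨n, s, r, hrs⟩ := hX.exists_hom_retract
  exact .of_split s r hrs

end Projective

section Counit

variable {A : Type u} [Ring A] {S M : ModuleCat.{u} A}

/-- The isomorphism `S ⊗_Γ Hom(S, M) ≅ M`. -/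
def counitEquiv (hM : Function.Bijective (counit S M)) :
    (tensorFunctor S).obj ((homFunctor S).obj M) ≃ₗ[A] M :=
  LinearEquiv.ofBijective (counit S M) hM

theorem nonempty_equiv_of_homEquiv (hM : Function.Bijective (counit S M))
    {Y : ModuleCat.{u} (EndOp S)} (e : Y ≃ₗ[EndOp S] (S ⟶ M)) :
    Nonempty ((tensorFunctor S).obj Y ≃ₗ[A] M) := by
  let i : Y ≅ (homFunctor S).obj M :=
    LinearEquiv.toModuleIso (X₂ := ((homFunctor S).obj M : Type u)) e
  exact ⟨((tensorFunctor S).mapIso i).toLinearEquiv ≪≫ₗ counitEquiv hM⟩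

end Counit

namespace IsProperCostratifyingSystem

variable {A : Type u} [Ring A] {ι : Type} [Fintype ι] [LinearOrder ι] {Ψ Q : ι → ModuleCat.{u} A}
  {M N : ModuleCat.{u} A}

/-- `Hom(Q, M)` is a finitely generated projective, hence filtered and isomorphic to some `Hom(Q,
N)` with `N` filtered. Tensoring back, the two counits give `M ≅ N`; this settles that summands of
sums of copies of `Q` are filtered. -/
theorem isFiltered_of_inAdd [IsArtinianRing (EndOp (sum Q))]
    (h : IsProperCostratifyingSystem Ψ Q) (hM : InAdd (sum Q) M) : IsFiltered Ψ Set.univ M := by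
  have hP := h.projSystem
  have := hM.finite_hom
  have := hM.projective_hom
  have h1 : IsFiltered (ΓΨ Ψ Q) Set.univ (sum Q ⟶ M) :=
    isFiltered_of_projective hP.total.some hP.indec
      fun i => (hP.isFiltered_P i).mono (Set.subset_univ _)
  obtain ⟨N, hN, ⟨e⟩⟩ := h.exists_equiv_hom h1
  obtain ⟨e'⟩ := nonempty_equiv_of_homEquiv (Y := (homFunctor (sum Q)).obj M)
    (h.counit_bijective hN) e
  exact hN.of_equiv ((counitEquiv hM.counit_bijective).symm ≪≫ₗ e')

theorem addClosure_eq [IsArtinianRing (EndOp (sum Q))] (h : IsProperCostratifyingSystem Ψ Q) :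
    addClosure (sum Q) = Filt Ψ ⊓ leftPerpOne (Filt Ψ) := by
  have hfin : Module.Finite A (sum Q) := by
    have := h.finite_Q
    change Module.Finite A (∀ i, Q i)
    infer_instance
  ext X
  rw [addClosure_iff]
  constructor
  · intro hX
    exact ⟨filt_iff_isFiltered.2 (h.isFiltered_of_inAdd hX), hX.finite, fun Y hY =>
      h.subsingleton_ext hX (filt_iff_isFiltered.1 hY)⟩
  · rintro ⟨hX, -, hX'⟩
    obtain ⟨Y, p, hY, hp, hpk⟩ := h.exists_presentation (filt_iff_isFiltered.1 hX)
    -- The cover from `add Q` has filtered kernel, so the Ext-vanishing of `X` splits it.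
    obtain ⟨s, hs⟩ := exists_lift_of_subsingleton_ext p hp
      (hX' (ModuleCat.of A (LinearMap.ker p)) (filt_iff_isFiltered.2 hpk)) LinearMap.id
    exact hY.of_retract s p hs

theorem isExactEquivalence [IsArtinianRing (EndOp (sum Q))]
    (h : IsProperCostratifyingSystem Ψ Q) :
    IsExactEquivalenceWithQuasiInverse (Filt Ψ) (Filt (properStandard (ΓP Q)))
      (homFunctor (sum Q)) (tensorFunctor (sum Q)) := by
  have hP := h.projSystem
  have hF : ∀ M : (Filt Ψ).FullSubcategory,
      Filt (properStandard (ΓP Q)) (((Filt Ψ).ι ⋙ homFunctor (sum Q)).obj M) := fun M =>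
    hP.filt_properStandard_iff.2 (h.isFiltered_hom (filt_iff_isFiltered.1 M.property))
  have hG : ∀ N : (Filt (properStandard (ΓP Q))).FullSubcategory,
      Filt Ψ (((Filt (properStandard (ΓP Q))).ι ⋙ tensorFunctor (sum Q)).obj N) := fun N => by
    obtain ⟨M, hM, ⟨e⟩⟩ := h.exists_equiv_hom (hP.filt_properStandard_iff.1 N.property)
    obtain ⟨e'⟩ := nonempty_equiv_of_homEquiv (h.counit_bijective hM) e
    exact filt_iff_isFiltered.2 (hM.of_equiv e')
  have hfull : ((Filt Ψ).ι ⋙ homFunctor (sum Q)).Full := ⟨fun {M N} φ => by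
    obtain ⟨f, hf⟩ := h.homMap_full (N := N.obj) (filt_iff_isFiltered.1 M.property) φ.hom
    exact ⟨ObjectProperty.homMk (ModuleCat.ofHom f), ModuleCat.hom_ext hf⟩⟩
  have hfaithful : ((Filt Ψ).ι ⋙ homFunctor (sum Q)).Faithful := ⟨fun {M N f g} hfg => by
    have h0 : f.hom.hom - g.hom.hom = 0 :=
      h.homMap_faithful (filt_iff_isFiltered.1 M.property) (by
        rw [homMap_sub, sub_eq_zero]
        exact congrArg ModuleCat.Hom.hom hfg)
    exact ObjectProperty.hom_ext _ (ModuleCat.hom_ext (sub_eq_zero.1 h0))⟩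
  let F' := (Filt (properStandard (ΓP Q))).lift ((Filt Ψ).ι ⋙ homFunctor (sum Q)) hF
  let G' := (Filt Ψ).lift ((Filt (properStandard (ΓP Q))).ι ⋙ tensorFunctor (sum Q)) hG
  have hess : F'.EssSurj := ⟨fun N => by
    obtain ⟨M, hM, ⟨e⟩⟩ := h.exists_equiv_hom (hP.filt_properStandard_iff.1 N.property)
    refine ⟨⟨M, filt_iff_isFiltered.2 hM⟩, ⟨ObjectProperty.isoMk _ ?_⟩⟩
    exact (LinearEquiv.toModuleIso (X₂ := ((homFunctor (sum Q)).obj M : Type u)) e).symm⟩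
  have hequiv : F'.IsEquivalence :=
    { faithful := inferInstanceAs ((Filt (properStandard (ΓP Q))).lift _ hF).Faithful
      full := inferInstanceAs ((Filt (properStandard (ΓP Q))).lift _ hF).Full
      essSurj := hess }
  have i₁ : F' ⋙ G' ≅ 𝟭 (Filt Ψ).FullSubcategory :=
    NatIso.ofComponents (fun M => ObjectProperty.isoMk _
      (counitEquiv (h.counit_bijective (filt_iff_isFiltered.1 M.property))).toModuleIso)
      (fun {M N} f => ObjectProperty.hom_ext _ (ModuleCat.hom_ext
        (LinearMap.ext fun z => counit_naturality (sum Q) f.hom z)))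
  refine ⟨hF, hG, hequiv, fun S h1 h2 h3 hS => ?_, ⟨i₁⟩, ⟨?_⟩⟩
  · have hex := (ShortComplex.ShortExact.moduleCat_exact_iff_function_exact S).1 hS.exact
    have hk : IsFiltered Ψ Set.univ (LinearMap.ker S.g.hom) :=
      (filt_iff_isFiltered.1 h1).of_equiv (LinearEquiv.ofInjective S.f.hom
        hS.moduleCat_injective_f ≪≫ₗ
          LinearEquiv.ofEq _ _ (LinearMap.exact_iff.1 hex).symm).symm
    exact ModuleCat.shortComplex_shortExact _ (homMap_exact hS.moduleCat_injective_f hex)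
      (homMap_injective hS.moduleCat_injective_f)
      (h.homMap_surjective hS.moduleCat_surjective_g hk)
  · let E := F'.asEquivalence
    -- The counit makes `G'` a left inverse of the equivalence `F'`, so `G'` is isomorphic to the
    -- chosen inverse and hence a quasi-inverse on the other side too.
    exact Functor.isoWhiskerRight ((Functor.leftUnitor _).symm ≪≫
      Functor.isoWhiskerRight E.counitIso.symm G' ≪≫ Functor.associator _ _ _ ≪≫
      Functor.isoWhiskerLeft E.inverse i₁ ≪≫ Functor.rightUnitor _) F' ≪≫ E.counitIso

end IsProperCostratifyingSystem

end

end Costrat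

theorem mainTheorem1 {R : Type w} [CommRing R] [IsArtinianRing R]
    {Λ : Type u} [Ring Λ] [Algebra R Λ] [Module.Finite R Λ]
    {ι : Type} [Fintype ι] [LinearOrder ι] (Ψ Q : ι → ModuleCat.{u} Λ)
    (h : Costrat.IsProperCostratifyingSystem Ψ Q) :
    -- (a)
    (Costrat.IsRepresentativeSet (Costrat.ΓP Q) ∧
      Costrat.IsBasic (Costrat.EndOp (Costrat.sum Q)) ∧
      Module.rank ℤ (Costrat.K0 (Costrat.EndOp (Costrat.sum Q))) = (Fintype.card ι : Cardinal)) ∧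
    -- (b)
    Costrat.IsExactEquivalenceWithQuasiInverse (Costrat.Filt Ψ)
      (Costrat.Filt (Costrat.properStandard (Costrat.ΓP Q)))
      (Costrat.homFunctor (Costrat.sum Q)) (Costrat.tensorFunctor (Costrat.sum Q)) ∧
    -- (c)
    (∀ i : ι, Nonempty ((Costrat.homFunctor (Costrat.sum Q)).obj (Ψ i) ≅
      Costrat.properStandard (Costrat.ΓP Q) (OrderDual.toDual i))) ∧
    -- (d)
    Costrat.IsStandardlyStratified (fun i : ιᵒᵈ => Costrat.dual (Costrat.ΓP Q i)) ∧
    -- (e)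
    Costrat.addClosure (Costrat.sum Q) =
      Costrat.Filt Ψ ⊓ Costrat.leftPerpOne (Costrat.Filt Ψ) ∧
    -- (f)
    Costrat.IsResolving (Costrat.Filt (Costrat.properStandard (Costrat.ΓP Q))) ∧
    (Costrat.Filt (Costrat.properStandard (Costrat.ΓP Q))).IsStableUnderRetracts := by
  have hQ : Module.Finite Λ (Costrat.sum Q) := by
    have := h.finite_Q
    change Module.Finite Λ (∀ i, Q i)
    infer_instance
  -- `Γ` is again an artin algebra over `R`; this supplies the artinian property and the
  -- finite-dimensional linear algebra used for the opposite algebra.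
  obtain ⟨_, _⟩ := Costrat.exists_algebra_finite_endOp R (Costrat.sum Q)
  have : IsArtinianRing (Costrat.EndOp (Costrat.sum Q)) := IsArtinianRing.of_finite R _
  have hP := h.projSystem
  have hrep := hP.isRepresentativeSet
  exact ⟨⟨hrep, Costrat.isBasic_of_equiv hP.total.some hrep,
      Costrat.rank_K0 hrep hP.total.some⟩, h.isExactEquivalence,
    fun i => ⟨(hP.nonempty_equiv_properStandard (OrderDual.toDual i)).some.toModuleIso⟩,
    hP.isStandardlyStratified_dual R, h.addClosure_eq, hP.isResolving, hP.isStableUnderRetracts⟩
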